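/- Let $\Delta\subset\mathbb R^n$ be a nonempty bounded open polytope, $\Delta=\{x:\delta_k(x)>0,\ k=1,\dots,m\}$, where the $\delta_k$ are affine functions whose zero sets define the pairwise distinct facets of $\Delta$. Put $u_o=\sum_k\delta_k\log\delta_k$, let $d\mu$ be Lebesgue measure, and let $d\sigma$ be the measure on $\partial\Delta$ that on the facet $\{\delta_k=0\}$ equals $|\nabla\delta_k|^{-1}$ times $(n-1)$-dimensional Euclidean area. Let $\mathcal S$ be the set of continuous convex functions $u$ on $\bar\Delta$ such that $u-u_o$ is smooth on $\bar\Delta$. For $p_o\in\Delta$ let $\tilde{\mathcal C}$ be the set of continuous convex functions $u$ on $\bar\Delta$ that are smooth in $\Delta$ and satisfy $u\ge u(p_o)=0$. For such $u$ write $\|u\|_b=\int_{\partial\Delta}u\,d\sigma$. For a smooth function $A$ on $\bar\Delta$ put $\mathcal L_A(u)=\int_{\partial\Delta}u\,d\sigma-\int_\Delta Au\,d\mu$. For $\lambda>0$ call $\Delta$ $(A,\lambda)$-stable if $\mathcal L_A(u)\ge\lambda\|u\|_b$ for all $u\in\tilde{\mathcal C}$, and call $(\Delta,A)$ uniformly K-stable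 if it is $(A,\lambda)$-stable for some $\lambda>0$. For every such $\Delta$ there is a function $\lambda\mapsto C(\lambda)$, depending only on $\Delta$, with the following property. Let $p_o\in\Delta$, let $A$ be smooth on $\bar\Delta$ with $\mathcal L_A(\ell)=0$ for every affine function $\ell$, and let $v\in\mathcal S$ solve the Abreu equation $$\sum_{i,j}\frac{\partial^2 v^{ij}}{\partial x_i\partial x_j}=-A\quad\text{in }\Delta,$$ where the Hessian $(v_{ij})$ is invertible on $\Delta$ with inverse $(v^{ij})$. Then $(\Delta,A)$ is uniformly K-stable; and for every $\lambda>0$ such that $\Delta$ is $(A,\lambda)$-stable, if $v$ is normalized by $v\ge v(p_o)=0$ on $\bar\Delta$, then $$\|v\|_b\le C(\lambda).$$ -/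

import Mathlib

open MeasureTheory Set
open scoped ContDiff RealInnerProductSpace

namespace Toric

/-- A bounded open polytope in `ℝⁿ` together with its facet-defining affine functions
`δ_k(x) = ⟪a_k, x⟫ - c_k`.  The polytope is `{x | ∀ k, 0 < δ_k x}`; the last field says that
each `δ_k = 0` really cuts out a facet, and that different indices give different facets. -/
structure Polytope (n : ℕ) where
  m : ℕ
  normal : Fin m → EuclideanSpace ℝ (Fin n)
  offset : Fin m → ℝ
  nonempty : ∃ x : EuclideanSpace ℝ (Fin n), ∀ k, 0 < ⟪normal k, x⟫ - offset k
  bounded : Bornology.IsBounded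
    {x : EuclideanSpace ℝ (Fin n) | ∀ k, 0 < ⟪normal k, x⟫ - offset k}
  facet_exists : ∀ k, ∃ x : EuclideanSpace ℝ (Fin n),
    ⟪normal k, x⟫ - offset k = 0 ∧ ∀ j, j ≠ k → 0 < ⟪normal j, x⟫ - offset j

namespace Polytope

variable {n : ℕ}

/-- The affine function `δ_k`. -/
noncomputable def delta (Δ : Polytope n) (k : Fin Δ.m) (x : EuclideanSpace ℝ (Fin n)) : ℝ :=
  ⟪Δ.normal k, x⟫ - Δ.offset k

/-- The open polytope. -/
def carrier (Δ : Polytope n) : Set (EuclideanSpace ℝ (Fin n)) :=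
  {x | ∀ k, 0 < Δ.delta k x}

/-- The closed facet on which `δ_k` vanishes. -/
def facet (Δ : Polytope n) (k : Fin Δ.m) : Set (EuclideanSpace ℝ (Fin n)) :=
  {x ∈ closure Δ.carrier | Δ.delta k x = 0}

/-- The boundary measure `dσ`: on the facet `δ_k = 0` it is the `(n-1)`-dimensional Euclidean
area divided by `‖∇δ_k‖`, i.e. the measure with `dσ ∧ dδ_k = ± dμ`. -/
noncomputable def boundaryMeasure (Δ : Polytope n) : Measure (EuclideanSpace ℝ (Fin n)) :=
  ∑ k, ENNReal.ofReal (‖Δ.normal k‖⁻¹) •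
    (Measure.euclideanHausdorffMeasure (n - 1)).restrict (Δ.facet k)

/-- Guillemin's function `u_o = ∑ δ_k log δ_k` (with `0 log 0 = 0` on the boundary). -/
noncomputable def guillemin (Δ : Polytope n) (x : EuclideanSpace ℝ (Fin n)) : ℝ :=
  ∑ k, Δ.delta k x * Real.log (Δ.delta k x)

/-- The class `𝒮`: continuous convex functions `u` on the closed polytope such that `u - u_o`
is smooth on the closed polytope. -/
def ClassS (Δ : Polytope n) (u : EuclideanSpace ℝ (Fin n) → ℝ) : Prop :=
  ContinuousOn u (closure Δ.carrier) ∧ ConvexOn ℝ (closure Δ.carrier) u ∧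
    ContDiffOn ℝ ∞ (fun x => u x - Δ.guillemin x) (closure Δ.carrier)

/-- The class `𝒞_∞`: continuous convex functions on the closed polytope, smooth in the
interior. -/
def ClassCInfty (Δ : Polytope n) (u : EuclideanSpace ℝ (Fin n) → ℝ) : Prop :=
  ContinuousOn u (closure Δ.carrier) ∧ ConvexOn ℝ (closure Δ.carrier) u ∧
    ContDiffOn ℝ ∞ u Δ.carrier

/-- `u` is normalized at `p`: `u ≥ u(p) = 0` on the closed polytope. -/
def Normalized (Δ : Polytope n) (p : EuclideanSpace ℝ (Fin n))
    (u : EuclideanSpace ℝ (Fin n) → ℝ) : Prop :=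
  u p = 0 ∧ ∀ x ∈ closure Δ.carrier, 0 ≤ u x

/-- The class `𝒞~` of functions in `𝒞_∞` normalized at `p`. -/
def ClassCTilde (Δ : Polytope n) (p : EuclideanSpace ℝ (Fin n))
    (u : EuclideanSpace ℝ (Fin n) → ℝ) : Prop :=
  Δ.ClassCInfty u ∧ Δ.Normalized p u

/-- `‖u‖_b = ∫_{∂Δ} u dσ`. -/
noncomputable def normB (Δ : Polytope n) (u : EuclideanSpace ℝ (Fin n) → ℝ) : ℝ :=
  ∫ x, u x ∂Δ.boundaryMeasure

/-- `ℒ_A(u) = ∫_{∂Δ} u dσ - ∫_Δ A u dμ`. -/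
noncomputable def functionalL (Δ : Polytope n) (A u : EuclideanSpace ℝ (Fin n) → ℝ) : ℝ :=
  ∫ x, u x ∂Δ.boundaryMeasure - ∫ x in Δ.carrier, A x * u x

/-- Every affine function `x ↦ ⟪a, x⟫ + b` is extremal, i.e. is annihilated by `ℒ_A`. -/
def AffineExtremal (Δ : Polytope n) (A : EuclideanSpace ℝ (Fin n) → ℝ) : Prop :=
  ∀ (a : EuclideanSpace ℝ (Fin n)) (b : ℝ), Δ.functionalL A (fun x => ⟪a, x⟫ + b) = 0

/-- `Δ` is `(A, lam)`-stable (with normalization at `p`):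
`lam > 0` and `ℒ_A(u) ≥ lam ∫_{∂Δ} u dσ` for all `u ∈ 𝒞~`. -/
def IsStable (Δ : Polytope n) (p : EuclideanSpace ℝ (Fin n))
    (A : EuclideanSpace ℝ (Fin n) → ℝ) (lam : ℝ) : Prop :=
  0 < lam ∧ ∀ u, Δ.ClassCTilde p u → lam * Δ.normB u ≤ Δ.functionalL A u

/-- `(Δ, A)` is uniformly K-stable. -/
def UniformlyKStable (Δ : Polytope n) (p : EuclideanSpace ℝ (Fin n))
    (A : EuclideanSpace ℝ (Fin n) → ℝ) : Prop :=
  ∃ lam : ℝ, Δ.IsStable p A lam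

end Polytope

/-- The partial derivative `∂u/∂x_i`. -/
noncomputable def partialDeriv {n : ℕ} (i : Fin n) (u : EuclideanSpace ℝ (Fin n) → ℝ)
    (x : EuclideanSpace ℝ (Fin n)) : ℝ :=
  fderiv ℝ u x (EuclideanSpace.single i 1)

/-- The Hessian matrix `(u_{ij})`. -/
noncomputable def hessian {n : ℕ} (u : EuclideanSpace ℝ (Fin n) → ℝ)
    (x : EuclideanSpace ℝ (Fin n)) : Matrix (Fin n) (Fin n) ℝ :=
  Matrix.of fun i j => partialDeriv i (partialDeriv j u) x

/-- `u` solves the Abreu equation `∑ ∂²u^{ij}/∂x_i∂x_j = -A` in the open polytope, where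
`(u^{ij})` is the inverse of the Hessian matrix, which has to be invertible there. -/
def SolvesAbreu {n : ℕ} (Δ : Polytope n) (A u : EuclideanSpace ℝ (Fin n) → ℝ) : Prop :=
  ∀ x ∈ Δ.carrier, (hessian u x).det ≠ 0 ∧
    ∑ i, ∑ j, partialDeriv i (partialDeriv j (fun y => (hessian u y)⁻¹ i j)) x = -A x

end Toric

/-! Write H for the Hessian of `v`, G for its inverse, V for the divergence of G. Two integrations
by parts formally turn the Abreu equation into ℒ_A(u) = ∫ G:D²u, the boundary integral being
produced by the logarithmic singularities of `v`. Only the inequality ℒ_A(u) ≥ ∫ h for integrable h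
≤ G:D²u is needed, and it is proved for u ≥ 1 whose radial derivative about `p` is bounded above
(`ClassS.integral_le_functionalL`). The bound u ≥ 1 costs nothing, since ℒ_A annihilates constants.

The cutoff is a function of the Legendre-type potential r = ⟨x - p, ∇v⟩ - v + v(p) + 1. By convexity
r ≥ 1; near the boundary r is -∑ δ_k(p) log δ_k up to a bounded error, so its sublevel sets are
compact. Moreover ∇r = H(x - p), hence G∇r = x - p and V·∇r is minus the radial derivative of log
det H. Thus every term carrying the derivative of the cutoff involves only radial derivatives
(`ClassS.integral_cut_eq`). As the cutoff parameter R grows, the term with the radial derivative of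
u is O(1/R). In the other one, log det H = C - ∑ log δ_k - N with N ≥ 0. The logarithms give kernels
δ_k(p)/δ_k whose mass near the facet is at most 1, hence at most ∫ u dσ in the limit
(`ClassS.eventually_integral_cutSlope_div_le`). The N term is integrated by parts once more and is
at most O(1/R), because the cutoff is concave enough to absorb the unfavourable terms near the
boundary (`ClassS.exists_integral_radial_le`).

Testing with a constant minus `v`, where G:D²v = n, gives ℒ_A(v) ≤ n vol(Δ)
(`ClassS.functionalL_le`). Stability applied to `v` itself then yields C(λ) = n vol(Δ)/λ.

Testing with normalized convex u smooth up to the boundary bounds ∫_K Δu by a multiple of ℒ_A(u) for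
compact K. A Harnack-type estimate and connectedness upgrade this to u ≤ C ℒ_A(u) on compact sets
(`ClassS.exists_le_of_isCompact`). The integral of u over a thin collar is a small multiple of its
boundary norm (`lintegral_collar_le`), so the term ∫ A u can be absorbed, which is uniform stability
for such u; dilating about `p` reaches all of the class `ClassCTilde`. -/

namespace Toric

open Filter Topology

local notation "𝔼" n => EuclideanSpace ℝ (Fin n)

/-! ### Coordinate derivatives and integration by parts. -/

section Calculus

variable {n : ℕ} {u w : (𝔼 n) → ℝ} {x : 𝔼 n} {i j : Fin n} {U : Set (𝔼 n)}

theorem partialDeriv_congr (h : u =ᶠ[𝓝 x] w) : partialDeriv i u x = partialDeriv i w x := by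
  unfold partialDeriv; rw [h.fderiv_eq]

theorem partialDeriv_congr_of_isOpen (hU : IsOpen U) (hx : x ∈ U) (h : ∀ y ∈ U, u y = w y) :
    partialDeriv i u x = partialDeriv i w x :=
  partialDeriv_congr (Filter.eventuallyEq_of_mem (hU.mem_nhds hx) h)

theorem partialDeriv_of_hasFDerivAt {u' : (𝔼 n) →L[ℝ] ℝ} (h : HasFDerivAt u u' x) :
    partialDeriv i u x = u' (EuclideanSpace.single i 1) := by
  unfold partialDeriv; rw [h.fderiv]

@[simp] theorem partialDeriv_const (c : ℝ) : partialDeriv i (fun _ : 𝔼 n => c) x = 0 := by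
  simp [partialDeriv]

theorem partialDeriv_add (hu : DifferentiableAt ℝ u x) (hw : DifferentiableAt ℝ w x) :
    partialDeriv i (fun y => u y + w y) x = partialDeriv i u x + partialDeriv i w x := by
  simp [partialDeriv, fderiv_fun_add hu hw]

theorem partialDeriv_sub (hu : DifferentiableAt ℝ u x) (hw : DifferentiableAt ℝ w x) :
    partialDeriv i (fun y => u y - w y) x = partialDeriv i u x - partialDeriv i w x := by
  simp [partialDeriv, fderiv_fun_sub hu hw]

theorem partialDeriv_neg : partialDeriv i (fun y => - u y) x = - partialDeriv i u x := by
  simp [partialDeriv, fderiv_fun_neg]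

theorem partialDeriv_mul (hu : DifferentiableAt ℝ u x) (hw : DifferentiableAt ℝ w x) :
    partialDeriv i (fun y => u y * w y) x
      = u x * partialDeriv i w x + partialDeriv i u x * w x := by
  simp [partialDeriv, fderiv_fun_mul hu hw]; ring

theorem partialDeriv_const_mul (c : ℝ) (hu : DifferentiableAt ℝ u x) :
    partialDeriv i (fun y => c * u y) x = c * partialDeriv i u x := by
  simp [partialDeriv, fderiv_const_mul hu]

theorem partialDeriv_sum {ι : Type*} {s : Finset ι} {F : ι → (𝔼 n) → ℝ}
    (h : ∀ k ∈ s, DifferentiableAt ℝ (F k) x) :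
    partialDeriv i (fun y => ∑ k ∈ s, F k y) x = ∑ k ∈ s, partialDeriv i (F k) x := by
  simp [partialDeriv, fderiv_fun_sum h]

theorem partialDeriv_comp {g : ℝ → ℝ} {g' : ℝ} (hg : HasDerivAt g g' (u x))
    (hu : DifferentiableAt ℝ u x) :
    partialDeriv i (fun y => g (u y)) x = g' * partialDeriv i u x := by
  have : HasFDerivAt (fun y => g (u y)) (g' • fderiv ℝ u x) x :=
    hg.comp_hasFDerivAt x hu.hasFDerivAt
  rw [partialDeriv_of_hasFDerivAt this]
  simp [partialDeriv]

theorem hasFDerivAt_coord : HasFDerivAt (fun y : 𝔼 n => y i)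
    (EuclideanSpace.proj i : (𝔼 n) →L[ℝ] ℝ) x :=
  (EuclideanSpace.proj i : (𝔼 n) →L[ℝ] ℝ).hasFDerivAt

theorem partialDeriv_coord : partialDeriv i (fun y : 𝔼 n => y j) x = if j = i then 1 else 0 := by
  rw [partialDeriv_of_hasFDerivAt hasFDerivAt_coord]
  simp

theorem partialDeriv_coord_sub (c : ℝ) :
    partialDeriv i (fun y : 𝔼 n => y j - c) x = if j = i then 1 else 0 := by
  rw [partialDeriv_sub hasFDerivAt_coord.differentiableAt (differentiableAt_const c),
    partialDeriv_coord]
  simp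

theorem fderiv_eq_sum_partialDeriv (u : (𝔼 n) → ℝ) (x z : 𝔼 n) :
    fderiv ℝ u x z = ∑ i, z i * partialDeriv i u x := by
  have hz : z = ∑ i, z i • EuclideanSpace.single i (1 : ℝ) := by
    ext j
    simp [Pi.single_apply]
  conv_lhs => rw [hz]
  simp [partialDeriv]

theorem contDiffOn_partialDeriv (hU : IsOpen U) (hu : ContDiffOn ℝ ∞ u U) :
    ContDiffOn ℝ ∞ (partialDeriv i u) U := by
  have h := hu.fderiv_of_isOpen hU (m := ∞) (by simp)
  exact h.clm_apply contDiffOn_const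

theorem continuousOn_partialDeriv (hU : IsOpen U) (hu : ContDiffOn ℝ 1 u U) :
    ContinuousOn (partialDeriv i u) U := by
  have h := hu.continuousOn_fderiv_of_isOpen hU (by simp)
  exact h.clm_apply continuousOn_const

theorem ContDiffOn.differentiableAt_of_isOpen {m : WithTop ℕ∞} (hU : IsOpen U)
    (hu : ContDiffOn ℝ m u U) (hm : 1 ≤ m) (hx : x ∈ U) : DifferentiableAt ℝ u x :=
  (hu.differentiableOn (by rintro rfl; simp at hm)).differentiableAt (hU.mem_nhds hx)

theorem partialDeriv_comm (hU : IsOpen U) (hu : ContDiffOn ℝ ∞ u U) (hx : x ∈ U) :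
    partialDeriv i (partialDeriv j u) x = partialDeriv j (partialDeriv i u) x := by
  have hc : ContDiffAt ℝ ∞ u x := hu.contDiffAt (hU.mem_nhds hx)
  have hs : IsSymmSndFDerivAt ℝ u x := hc.isSymmSndFDerivAt
    (by simpa using (WithTop.coe_le_coe.2 le_top : ((2 : ℕ∞) : WithTop ℕ∞) ≤ ((⊤ : ℕ∞) : WithTop ℕ∞)))
  have hd : DifferentiableAt ℝ (fderiv ℝ u) x :=
    ((hu.fderiv_of_isOpen hU (m := ∞) (by simp)).contDiffAt (hU.mem_nhds hx)).differentiableAt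
      (by simp)
  have key : ∀ a b : Fin n, partialDeriv a (partialDeriv b u) x
      = fderiv ℝ (fderiv ℝ u) x (EuclideanSpace.single a 1) (EuclideanSpace.single b 1) := by
    intro a b
    unfold partialDeriv
    rw [fderiv_clm_apply hd (differentiableAt_const _)]
    simp
  rw [key, key, hs.eq]

theorem hessian_apply : hessian u x i j = partialDeriv i (partialDeriv j u) x := rfl

theorem hessian_comm (hU : IsOpen U) (hu : ContDiffOn ℝ ∞ u U) (hx : x ∈ U) :
    hessian u x i j = hessian u x j i := partialDeriv_comm hU hu hx

theorem contDiffOn_hessian (hU : IsOpen U) (hu : ContDiffOn ℝ ∞ u U) :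
    ContDiffOn ℝ ∞ (fun y => hessian u y i j) U :=
  contDiffOn_partialDeriv hU (contDiffOn_partialDeriv hU hu)

/-- A function continuous on an open set and vanishing off a compact subset of it is integrable. -/
theorem integrableOn_of_continuousOn_of_eq_zero {F : (𝔼 n) → ℝ} {K : Set (𝔼 n)}
    (hK : IsCompact K) (hKU : K ⊆ U) (hF : ContinuousOn F U) (h0 : ∀ y ∈ U, y ∉ K → F y = 0)
    (hU : IsOpen U) : IntegrableOn F U := by
  have h1 : IntegrableOn F K := (hF.mono hKU).integrableOn_compact hK
  have h2 : IntegrableOn F (U \ K) := by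
    refine IntegrableOn.congr_fun (f := fun _ => (0 : ℝ)) integrableOn_zero
      (fun y hy => (h0 y hy.1 hy.2).symm) ?_
    exact hU.measurableSet.diff hK.measurableSet
  have := h1.union h2
  rwa [union_sdiff_cancel hKU] at this

/-- Integration by parts against a test function supported in a compact subset of `U`. -/
theorem integral_mul_partialDeriv {F ψ : (𝔼 n) → ℝ} {K : Set (𝔼 n)} (hU : IsOpen U)
    (hK : IsCompact K) (hKU : K ⊆ U) (hF : ContDiffOn ℝ 1 F U) (hψ : ContDiffOn ℝ 1 ψ U)
    (h0 : ∀ y ∈ U, y ∉ K → ψ y = 0) (i : Fin n) :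
    ∫ y in U, F y * partialDeriv i ψ y = - ∫ y in U, partialDeriv i F y * ψ y := by
  -- Extending ψ by zero gives a function differentiable everywhere, since ψ already vanishes on U
  -- outside K. F has to be differentiable only on the support of this extension, so it may blow up
  -- at the boundary of U.
  set Ψ : (𝔼 n) → ℝ := U.indicator ψ with hΨ
  have hΨU : ∀ y ∈ U, Ψ y = ψ y := fun y hy => indicator_of_mem hy ψ
  have hΨ0 : ∀ y, y ∉ K → Ψ y = 0 := by
    intro y hy
    by_cases hyU : y ∈ U
    · rw [hΨU y hyU, h0 y hyU hy]
    · exact indicator_of_notMem hyU ψ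
  have hsupp : tsupport Ψ ⊆ K := by
    refine closure_minimal ?_ hK.isClosed
    intro y hy
    by_contra h
    exact hy (hΨ0 y h)
  have hdΨ : ∀ y ∉ K, fderiv ℝ Ψ y = 0 := by
    intro y hy
    have : Ψ =ᶠ[𝓝 y] fun _ => 0 :=
      Filter.eventuallyEq_of_mem (hK.isClosed.isOpen_compl.mem_nhds hy) (fun z hz => hΨ0 z hz)
    rw [this.fderiv_eq]; simp
  have hpΨ : ∀ y ∈ U, partialDeriv i Ψ y = partialDeriv i ψ y := fun y hy =>
    partialDeriv_congr_of_isOpen hU hy hΨU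
  have hΨd : ∀ y, DifferentiableAt ℝ Ψ y := by
    intro y
    by_cases hy : y ∈ U
    · exact (ContDiffOn.differentiableAt_of_isOpen hU hψ le_rfl hy).congr_of_eventuallyEq
        (Filter.eventuallyEq_of_mem (hU.mem_nhds hy) hΨU)
    · have hyK : y ∉ K := fun h => hy (hKU h)
      have : Ψ =ᶠ[𝓝 y] fun _ => 0 :=
        Filter.eventuallyEq_of_mem (hK.isClosed.isOpen_compl.mem_nhds hyK) (fun z hz => hΨ0 z hz)
      exact (differentiableAt_const (0 : ℝ)).congr_of_eventuallyEq this
  have hFc := hF.continuousOn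
  have hψc := hψ.continuousOn
  have hdF : ContinuousOn (partialDeriv i F) U := continuousOn_partialDeriv hU hF
  have hdψ : ContinuousOn (partialDeriv i ψ) U := continuousOn_partialDeriv hU hψ
  have ext : ∀ {Φ : (𝔼 n) → ℝ} {φ : (𝔼 n) → ℝ}, ContinuousOn φ U → (∀ y ∈ U, Φ y = φ y) →
      (∀ y ∉ K, Φ y = 0) → Integrable Φ ∧ ∫ y, Φ y = ∫ y in U, φ y := by
    intro Φ φ hφ h1 h2
    have hi : IntegrableOn Φ U := by
      refine (integrableOn_of_continuousOn_of_eq_zero hK hKU hφ ?_ hU).congr_fun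
        (fun y hy => (h1 y hy).symm) hU.measurableSet
      intro y hy hyK
      rw [← h1 y hy, h2 y hyK]
    have h3 : ∀ y ∉ U, Φ y = 0 := fun y hy => h2 y (fun h => hy (hKU h))
    refine ⟨?_, ?_⟩
    · rwa [← integrableOn_iff_integrable_of_support_subset (s := U)]
      intro y hy
      by_contra h
      exact hy (h3 y h)
    · rw [← setIntegral_eq_integral_of_forall_compl_eq_zero h3]
      exact setIntegral_congr_fun hU.measurableSet h1
  have e1 := ext (Φ := fun y => F y * partialDeriv i Ψ y)
    (φ := fun y => F y * partialDeriv i ψ y) (hFc.mul hdψ)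
    (fun y hy => by rw [hpΨ y hy])
    (fun y hy => by simp [partialDeriv, hdΨ y hy])
  have e2 := ext (Φ := fun y => partialDeriv i F y * Ψ y)
    (φ := fun y => partialDeriv i F y * ψ y) (hdF.mul hψc)
    (fun y hy => by rw [hΨU y hy]) (fun y hy => by simp [hΨ0 y hy])
  have e3 := ext (Φ := fun y => F y * Ψ y)
    (φ := fun y => F y * ψ y) (hFc.mul hψc)
    (fun y hy => by rw [hΨU y hy]) (fun y hy => by simp [hΨ0 y hy])
  rw [← e1.2, ← e2.2]
  exact integral_mul_fderiv_eq_neg_fderiv_mul_of_integrable e2.1 e1.1 e3.1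
    (fun y hy => ContDiffOn.differentiableAt_of_isOpen hU hF le_rfl (hKU (hsupp hy)))
    (fun y _ => hΨd y)

end Calculus

/-! ### Derivatives of determinants and inverses, and matrix inequalities. -/

section MatrixCalculus

open Matrix

variable {n : ℕ}

theorem det_updateRow_eq_sum (A : Matrix (Fin n) (Fin n) ℝ) (i : Fin n) (b : Fin n → ℝ) :
    (A.updateRow i b).det = ∑ j, b j * A.adjugate j i := by
  rw [det_eq_sum_mul_adjugate_row (A.updateRow i b) i]
  refine Finset.sum_congr rfl fun j _ => ?_
  rw [adjugate_apply, adjugate_apply]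
  simp

/-- The determinant is a continuous multilinear map of the rows, so its derivative replaces one row
at a time; expanding along the replaced row produces the adjugate. -/
theorem partialDeriv_det {M : (𝔼 n) → Matrix (Fin n) (Fin n) ℝ} {x : 𝔼 n}
    (hM : ∀ i j, DifferentiableAt ℝ (fun y => M y i j) x) (k : Fin n) :
    partialDeriv k (fun y => (M y).det) x
      = ∑ i, ∑ j, partialDeriv k (fun y => M y i j) x * (M x).adjugate j i := by
  let D : ContinuousMultilinearMap ℝ (fun _ : Fin n => Fin n → ℝ) ℝ :=
    { toMultilinearMap := (detRowAlternating : (Fin n → ℝ) [⋀^Fin n]→ₗ[ℝ] ℝ).toMultilinearMap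
      cont := by
        have : Continuous fun A : Matrix (Fin n) (Fin n) ℝ => A.det := continuous_id.matrix_det
        exact this }
  have hMd : HasFDerivAt (fun y i => M y i)
      (ContinuousLinearMap.pi fun i => ContinuousLinearMap.pi fun j =>
        fderiv ℝ (fun y => M y i j) x) x := by
    rw [hasFDerivAt_pi]
    intro i
    rw [hasFDerivAt_pi]
    exact fun j => (hM i j).hasFDerivAt
  have h := (D.hasFDerivAt (fun i => M x i)).comp x hMd
  have h' : HasFDerivAt (fun y => (M y).det) _ x := h
  rw [partialDeriv_of_hasFDerivAt h', ContinuousLinearMap.comp_apply,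
    ContinuousMultilinearMap.linearDeriv_apply]
  refine Finset.sum_congr rfl fun i _ => ?_
  exact det_updateRow_eq_sum (M x) i _

theorem inv_apply_eq (A : Matrix (Fin n) (Fin n) ℝ) (i j : Fin n) :
    A⁻¹ i j = A.det⁻¹ * A.adjugate i j := by
  rw [inv_def, Matrix.smul_apply, Ring.inverse_eq_inv', smul_eq_mul]

/-- Jacobi's formula. -/
theorem partialDeriv_log_det {M : (𝔼 n) → Matrix (Fin n) (Fin n) ℝ} {x : 𝔼 n}
    (hM : ∀ i j, DifferentiableAt ℝ (fun y => M y i j) x) (h0 : (M x).det ≠ 0) (k : Fin n) :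
    partialDeriv k (fun y => Real.log (M y).det) x
      = ∑ i, ∑ j, (M x)⁻¹ j i * partialDeriv k (fun y => M y i j) x := by
  have hd : DifferentiableAt ℝ (fun y => (M y).det) x := by
    simp only [det_apply]
    fun_prop
  rw [partialDeriv_comp (Real.hasDerivAt_log h0) hd, partialDeriv_det hM, Finset.mul_sum]
  refine Finset.sum_congr rfl fun i _ => ?_
  rw [Finset.mul_sum]
  refine Finset.sum_congr rfl fun j _ => ?_
  rw [inv_apply_eq]; ring

theorem contDiffOn_det {M : (𝔼 n) → Matrix (Fin n) (Fin n) ℝ} {U : Set (𝔼 n)}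
    {m : WithTop ℕ∞} (hM : ∀ i j, ContDiffOn ℝ m (fun y => M y i j) U) :
    ContDiffOn ℝ m (fun y => (M y).det) U := by
  simp only [det_apply]
  refine ContDiffOn.sum fun σ _ => ContDiffOn.const_smul _ ?_
  exact contDiffOn_prod fun i _ => hM _ _

theorem contDiffOn_inv_apply {M : (𝔼 n) → Matrix (Fin n) (Fin n) ℝ} {U : Set (𝔼 n)}
    {m : WithTop ℕ∞} (hM : ∀ i j, ContDiffOn ℝ m (fun y => M y i j) U)
    (h0 : ∀ y ∈ U, (M y).det ≠ 0) (i j : Fin n) :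
    ContDiffOn ℝ m (fun y => (M y)⁻¹ i j) U := by
  simp only [inv_apply_eq, adjugate_apply]
  refine ((contDiffOn_det hM).inv h0).mul (contDiffOn_det fun a b => ?_)
  by_cases h : a = j
  · subst h; simp only [updateRow_self]; exact contDiffOn_const
  · simp only [updateRow_ne h]; exact hM a b

/-- Derivative of the inverse matrix, in the form `∂G H = - G ∂H`. -/
theorem sum_partialDeriv_inv_mul {M : (𝔼 n) → Matrix (Fin n) (Fin n) ℝ} {U : Set (𝔼 n)}
    (hU : IsOpen U) (hM : ∀ i j, ContDiffOn ℝ ∞ (fun y => M y i j) U)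
    (h0 : ∀ y ∈ U, (M y).det ≠ 0) {x : 𝔼 n} (hx : x ∈ U) (i k l : Fin n) :
    ∑ j, partialDeriv l (fun y => (M y)⁻¹ i j) x * M x j k
      = - ∑ j, (M x)⁻¹ i j * partialDeriv l (fun y => M y j k) x := by
  have hMd : ∀ i j, DifferentiableAt ℝ (fun y => M y i j) x := fun i j =>
    ContDiffOn.differentiableAt_of_isOpen hU (hM i j) (by simp) hx
  have hGd : ∀ i j, DifferentiableAt ℝ (fun y => (M y)⁻¹ i j) x := fun i j =>
    ContDiffOn.differentiableAt_of_isOpen hU (contDiffOn_inv_apply hM h0 i j) (by simp) hx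
  have hc : partialDeriv l (fun y => ∑ j, (M y)⁻¹ i j * M y j k) x = 0 := by
    rw [partialDeriv_congr_of_isOpen (w := fun _ => (1 : Matrix (Fin n) (Fin n) ℝ) i k) hU hx]
    · simp
    · intro y hy
      rw [← Matrix.mul_apply, nonsing_inv_mul _ (isUnit_iff_ne_zero.2 (h0 y hy))]
  rw [partialDeriv_sum (F := fun j y => (M y)⁻¹ i j * M y j k)
    (fun j _ => (hGd i j).mul (hMd j k))] at hc
  simp only [partialDeriv_mul (hGd i _) (hMd _ k), Finset.sum_add_distrib] at hc
  linarith

open scoped MatrixOrder in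
theorem exists_eq_transpose_mul_self {W : Matrix (Fin n) (Fin n) ℝ} (hW : W.PosSemidef) :
    ∃ B : Matrix (Fin n) (Fin n) ℝ, W = Bᵀ * B := by
  obtain ⟨B, rfl⟩ := CStarAlgebra.nonneg_iff_eq_star_mul_self.mp hW.nonneg
  exact ⟨B, by rw [star_eq_conjTranspose, conjTranspose_eq_transpose_of_trivial]⟩

/-- Factor H = CᵀC and put c = H⁻¹b. Then b = Cᵀ(Cc), while b·H⁻¹b = |Cc|² and tr H is the sum of
the squares of the entries of C, so Cauchy–Schwarz in each coordinate suffices. -/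
theorem dotProduct_self_le_trace_mul {H : Matrix (Fin n) (Fin n) ℝ} (hH : H.PosDef)
    (b : Fin n → ℝ) : b ⬝ᵥ b ≤ H.trace * (b ⬝ᵥ (H⁻¹ *ᵥ b)) := by
  obtain ⟨C, hC⟩ := exists_eq_transpose_mul_self hH.posSemidef
  set c := H⁻¹ *ᵥ b with hc
  have hb : b = H *ᵥ c := by
    rw [hc, mulVec_mulVec, mul_nonsing_inv _ (isUnit_iff_ne_zero.2 hH.det_pos.ne'), one_mulVec]
  have h1 : b ⬝ᵥ c = (C *ᵥ c) ⬝ᵥ (C *ᵥ c) := by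
    rw [hb, dotProduct_comm, hC, ← mulVec_mulVec, dotProduct_mulVec, vecMul_transpose]
  have h2 : ∀ i, b i = ∑ l, C l i * (C *ᵥ c) l := by
    intro i
    conv_lhs => rw [hb, hC, ← mulVec_mulVec]
    simp [mulVec, dotProduct]
  have h3 : H.trace = ∑ i, ∑ l, C l i ^ 2 := by
    rw [hC]
    simp [trace, Matrix.mul_apply, sq]
  rw [h1, h3, Finset.sum_mul]
  unfold dotProduct
  refine Finset.sum_le_sum fun i _ => ?_
  rw [← sq, h2 i]
  refine (Finset.sum_mul_sq_le_sq_mul_sq _ _ _).trans (le_of_eq ?_)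
  simp only [sq]

/-- A factorization W = BᵀB reduces this to the vector inequality for each row of B. It turns
control of G:D²u into control of the Laplacian of u wherever the trace of H is bounded. -/
theorem trace_le_trace_mul_sum {H W : Matrix (Fin n) (Fin n) ℝ} (hH : H.PosDef)
    (hW : W.PosSemidef) : W.trace ≤ H.trace * ∑ i, ∑ j, H⁻¹ i j * W i j := by
  obtain ⟨B, hB⟩ := exists_eq_transpose_mul_self hW
  have h1 : W.trace = ∑ a, B a ⬝ᵥ B a := by
    rw [hB]
    simp only [trace, diag, Matrix.mul_apply, transpose_apply, dotProduct]
    exact Finset.sum_comm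
  have h2 : ∑ i, ∑ j, H⁻¹ i j * W i j = ∑ a, B a ⬝ᵥ (H⁻¹ *ᵥ B a) := by
    rw [hB]
    simp only [Matrix.mul_apply, transpose_apply, dotProduct, mulVec, Finset.mul_sum]
    rw [Finset.sum_congr rfl (fun i _ => Finset.sum_comm), Finset.sum_comm]
    refine Finset.sum_congr rfl fun a _ => Finset.sum_congr rfl fun i _ =>
      Finset.sum_congr rfl fun j _ => ?_
    ring
  rw [h1, h2, Finset.mul_sum]
  exact Finset.sum_le_sum fun a _ => dotProduct_self_le_trace_mul hH (B a)

/-- The determinant of a bounded perturbation of `∑ z_k a_k a_kᵀ` is `O(∏ (1 + z_k))`. -/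
theorem exists_det_sum_le {m : ℕ} (a : Fin m → Fin n → ℝ) (M : ℝ) :
    ∃ C : ℝ, ∀ (z : Fin m → ℝ) (F : Matrix (Fin n) (Fin n) ℝ), (∀ k, 0 ≤ z k) →
      (∀ i j, |F i j| ≤ M) →
      (Matrix.of fun i j => ∑ k, z k * (a k i * a k j) + F i j).det ≤ C * ∏ k, (1 + z k) := by
  set B : ℝ := M + ∑ k, ∑ i, ∑ j, |a k i * a k j| with hB
  refine ⟨∑ _f : Fin n → Option (Fin m), (Nat.factorial n : ℝ) * |B| ^ n, ?_⟩
  intro z F hz hF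
  -- Each row is a sum of the row of F (index `none`, weight 1) and one multiple of `a k` per k
  -- (weight `z k`), so multilinearity expands the determinant over choice functions f.
  let row : Fin n → Option (Fin m) → Fin n → ℝ := fun i c =>
    c.elim (F i) (fun k => a k i • a k)
  let ζ : Option (Fin m) → ℝ := fun c => c.elim 1 z
  have hζ : ∀ c, 0 ≤ ζ c := by
    rintro (_ | k)
    · exact zero_le_one
    · exact hz k
  have hrow : ∀ i, (fun j => ∑ k, z k * (a k i * a k j) + F i j) = ∑ c, ζ c • row i c := by
    intro i
    ext j
    simp [Fintype.sum_option, ζ, row, add_comm]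
  have hexp : (Matrix.of fun i j => ∑ k, z k * (a k i * a k j) + F i j).det
      = ∑ f : Fin n → Option (Fin m), (∏ i, ζ (f i)) * (Matrix.of fun i => row i (f i)).det := by
    have h := (detRowAlternating : (Fin n → ℝ) [⋀^Fin n]→ₗ[ℝ] ℝ).toMultilinearMap.map_sum
      (fun i c => ζ c • row i c)
    have h' : (Matrix.of fun i => ∑ c, ζ c • row i c).det
      = ∑ f : Fin n → Option (Fin m), (Matrix.of fun i => ζ (f i) • row i (f i)).det := h
    have e : (Matrix.of fun i j => ∑ k, z k * (a k i * a k j) + F i j)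
        = Matrix.of fun i => ∑ c, ζ c • row i c := by
      ext i j
      exact congrFun (hrow i) j
    rw [e, h']
    refine Finset.sum_congr rfl fun f _ => ?_
    rw [← det_mul_column]
    congr 1
  rw [hexp, Finset.sum_mul]
  refine Finset.sum_le_sum fun f _ => ?_
  have hprod1 : 1 ≤ ∏ k, (1 + z k) :=
    Finset.one_le_prod fun k _ => by linarith [hz k]
  -- Choosing the same k for two rows gives two proportional rows and contributes nothing. Hence
  -- each `z k` occurs to power at most one, which makes the coefficient of log δ_k in the bound on
  -- log det exactly one.
  by_cases hinj : ∃ i j k, i ≠ j ∧ f i = some k ∧ f j = some k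
  · obtain ⟨i, j, k, hij, hi, hj⟩ := hinj
    have hdet : (Matrix.of fun i => row i (f i)).det = 0 := by
      have hri : (Matrix.of fun i => row i (f i)) i = a k i • a k := by
        change row i (f i) = _
        rw [hi]; rfl
      have hrj : (Matrix.of fun i => row i (f i)) j = a k j • a k := by
        change row j (f j) = _
        rw [hj]; rfl
      set A := Matrix.of fun i => row i (f i)
      have hA : A = (A.updateRow i (a k i • a k)) := by
        rw [← hri, updateRow_eq_self]
      rw [hA, det_updateRow_smul]
      have hA2 : (A.updateRow i (a k)) = ((A.updateRow i (a k)).updateRow j (a k j • a k)) := by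
        rw [← hrj, ← updateRow_ne (M := A) (b := a k) hij.symm, updateRow_eq_self]
      rw [hA2, det_updateRow_smul, det_zero_of_row_eq hij]
      · simp
      · rw [updateRow_self, updateRow_ne hij, updateRow_self]
    rw [hdet, mul_zero]
    positivity
  · push Not at hinj
    have hz' : ∏ i, ζ (f i) ≤ ∏ k, (1 + z k) := by
      have h1 : ∏ i, ζ (f i) ≤ ∏ i, ∏ k, (if f i = some k then 1 + z k else 1) := by
        refine Finset.prod_le_prod (fun i _ => hζ _) fun i _ => ?_
        rcases hfi : f i with _ | k
        · simp [ζ]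
        · have : ∀ k', (some k = some k') ↔ (k = k') := fun k' => by simp
          simp only [this]
          rw [Finset.prod_ite_eq]
          simp [ζ]
      refine h1.trans ?_
      rw [Finset.prod_comm]
      refine Finset.prod_le_prod (fun k _ => Finset.prod_nonneg fun i _ => ?_) fun k _ => ?_
      · split_ifs
        · linarith [hz k]
        · exact zero_le_one
      · by_cases hex : ∃ i, f i = some k
        · obtain ⟨i, hi⟩ := hex
          rw [Finset.prod_eq_single i]
          · simp [hi]
          · intro j _ hji
            rw [if_neg]
            intro hj
            exact hinj j i k hji hj hi
          · simp
        · push Not at hex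
          simp only [hex, if_false, Finset.prod_const_one]
          linarith [hz k]
    have hentry : ∀ i j, |(Matrix.of fun i => row i (f i)) i j| ≤ |B| := by
      intro i j
      refine le_trans ?_ (le_abs_self B)
      have hs : ∀ k, |a k i * a k j| ≤ ∑ k, ∑ i, ∑ j, |a k i * a k j| := by
        intro k
        refine le_trans ?_ (Finset.single_le_sum
          (f := fun k => ∑ i, ∑ j, |a k i * a k j|) (fun k _ => by positivity)
          (Finset.mem_univ k))
        refine le_trans ?_ (Finset.single_le_sum
          (f := fun i => ∑ j, |a k i * a k j|) (fun k _ => by positivity) (Finset.mem_univ i))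
        exact Finset.single_le_sum
          (f := fun j => |a k i * a k j|) (fun k _ => by positivity) (Finset.mem_univ j)
      have hM0 : 0 ≤ M := (abs_nonneg _).trans (hF i j)
      have hS0 : 0 ≤ ∑ k, ∑ i, ∑ j, |a k i * a k j| := by positivity
      rcases hfi : f i with _ | k
      · have := hF i j
        simp only [Matrix.of_apply, row, hfi, Option.elim]
        linarith
      · have := hs k
        simp only [Matrix.of_apply, row, hfi, Option.elim, Pi.smul_apply, smul_eq_mul]
        linarith
    have hd : |(Matrix.of fun i => row i (f i)).det| ≤ (Nat.factorial n : ℝ) * |B| ^ n := by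
      have := Matrix.det_le (abv := AbsoluteValue.abs) hentry
      simpa [nsmul_eq_mul] using this
    calc (∏ i, ζ (f i)) * (Matrix.of fun i => row i (f i)).det
        ≤ (∏ i, ζ (f i)) * |(Matrix.of fun i => row i (f i)).det| :=
          mul_le_mul_of_nonneg_left (le_abs_self _) (Finset.prod_nonneg fun i _ => hζ _)
      _ ≤ (∏ k, (1 + z k)) * ((Nat.factorial n : ℝ) * |B| ^ n) :=
          mul_le_mul hz' hd (abs_nonneg _) (by linarith)
      _ = _ := by ring

end MatrixCalculus

/-! ### Tangent planes and Hessians of convex functions. -/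

section Convex

variable {n : ℕ} {u : (𝔼 n) → ℝ} {U S : Set (𝔼 n)}

/-- A convex function lies above its tangent planes. -/
theorem ConvexOn.fderiv_le_sub (hu : ConvexOn ℝ S u) {x y : 𝔼 n} (hx : x ∈ S) (hy : y ∈ S)
    (hd : DifferentiableAt ℝ u x) : fderiv ℝ u x (y - x) ≤ u y - u x := by
  have hline : HasDerivAt (fun t : ℝ => u (x + t • (y - x))) (fderiv ℝ u x (y - x)) 0 := by
    have h1 : HasDerivAt (fun t : ℝ => x + t • (y - x)) (y - x) 0 := by
      simpa using ((hasDerivAt_id (0 : ℝ)).smul_const (y - x)).const_add x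
    have h2 : HasFDerivAt u (fderiv ℝ u x) (x + (0 : ℝ) • (y - x)) := by simpa using hd.hasFDerivAt
    exact h2.comp_hasDerivAt (0 : ℝ) h1
  have hlim := (hasDerivAt_iff_tendsto_slope_zero.1 hline).mono_left
    (nhdsWithin_mono (0 : ℝ) (show Ioi (0 : ℝ) ⊆ {0}ᶜ from fun t ht => (ne_of_gt ht)))
  refine le_of_tendsto hlim ?_
  filter_upwards [Ioc_mem_nhdsGT (zero_lt_one (α := ℝ))] with t ht
  have hconv := hu.2 hx hy (sub_nonneg.2 ht.2) ht.1.le (by ring)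
  have e : (1 - t) • x + t • y = x + t • (y - x) := by
    rw [sub_smul, smul_sub, one_smul]; abel
  rw [e] at hconv
  simp only [zero_add, zero_smul, add_zero, smul_eq_mul] at hconv ⊢
  rw [inv_mul_le_iff₀ ht.1]
  linarith

/-- The Hessian of a convex function is positive semidefinite. -/
theorem ConvexOn.posSemidef_hessian (hu : ConvexOn ℝ U u) (hU : IsOpen U)
    (hs : ContDiffOn ℝ ∞ u U) {x : 𝔼 n} (hx : x ∈ U) : (hessian u x).PosSemidef := by
  refine Matrix.PosSemidef.of_dotProduct_mulVec_nonneg ?_ ?_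
  · ext i j
    simp [hessian_comm hU hs hx (i := i) (j := j)]
  intro b
  have hb : ∃ z : 𝔼 n, ∀ i, z i = b i := ⟨WithLp.toLp 2 b, fun i => rfl⟩
  obtain ⟨z, hz⟩ := hb
  have hline : HasDerivAt (fun t : ℝ => x + t • z) z 0 := by
    simpa using ((hasDerivAt_id (0 : ℝ)).smul_const z).const_add x
  have hd1 : ∀ i, HasDerivAt (fun t : ℝ => partialDeriv i u (x + t • z))
      (fderiv ℝ (partialDeriv i u) x z) 0 := by
    intro i
    have h2 : HasFDerivAt (partialDeriv i u) (fderiv ℝ (partialDeriv i u) x)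
        (x + (0 : ℝ) • z) := by
      simpa using (ContDiffOn.differentiableAt_of_isOpen hU (contDiffOn_partialDeriv hU hs)
        (by simp) hx).hasFDerivAt
    exact h2.comp_hasDerivAt (0 : ℝ) hline
  have hd2 : HasDerivAt (fun t : ℝ => ∑ i, z i * partialDeriv i u (x + t • z))
      (∑ i, z i * fderiv ℝ (partialDeriv i u) x z) 0 :=
    HasDerivAt.fun_sum fun i _ => (hd1 i).const_mul (z i)
  have hlim := (hasDerivAt_iff_tendsto_slope_zero.1 hd2).mono_left
    (nhdsWithin_mono (0 : ℝ) (show Ioi (0 : ℝ) ⊆ {0}ᶜ from fun t ht => (ne_of_gt ht)))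
  have hval : star b ⬝ᵥ (hessian u x).mulVec b = ∑ i, z i * fderiv ℝ (partialDeriv i u) x z := by
    simp only [star_trivial, dotProduct, Matrix.mulVec, fderiv_eq_sum_partialDeriv, hz]
    refine Finset.sum_congr rfl fun i _ => ?_
    congr 1
    refine Finset.sum_congr rfl fun j _ => ?_
    rw [hessian_comm hU hs hx, hessian_apply, mul_comm]
  rw [hval]
  refine ge_of_tendsto hlim ?_
  have hmem : ∀ᶠ t : ℝ in 𝓝[>] 0, x + t • z ∈ U := by
    have hc : ContinuousAt (fun t : ℝ => x + t • z) 0 := hline.continuousAt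
    have := hc.preimage_mem_nhds (t := U) (by simpa using hU.mem_nhds hx)
    exact mem_nhdsWithin_of_mem_nhds this
  filter_upwards [hmem, self_mem_nhdsWithin] with t ht ht0
  have ht0 : 0 < t := ht0
  -- The tangent-plane inequalities at x and at x + t z add up to monotonicity of the gradient along
  -- z; the second derivative is a limit of these nonnegative quotients.
  have h1 := ConvexOn.fderiv_le_sub hu hx ht (ContDiffOn.differentiableAt_of_isOpen hU hs (by simp) hx)
  have h2 := ConvexOn.fderiv_le_sub hu ht hx
    (ContDiffOn.differentiableAt_of_isOpen hU hs (by simp) ht)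
  have e1 : x + t • z - x = t • z := by abel
  have e2 : x - (x + t • z) = - (t • z) := by abel
  rw [e1, map_smul, smul_eq_mul, fderiv_eq_sum_partialDeriv] at h1
  rw [e2, map_neg, map_smul, smul_eq_mul, fderiv_eq_sum_partialDeriv] at h2
  simp only [zero_add, zero_smul, add_zero, smul_eq_mul]
  refine mul_nonneg (inv_nonneg.2 ht0.le) ?_
  have : t * (∑ i, z i * partialDeriv i u x) ≤ t * ∑ i, z i * partialDeriv i u (x + t • z) := by
    linarith
  linarith [le_of_mul_le_mul_left this ht0]

end Convex

/-! ### Fubini's theorem along a direction and the Hausdorff measure on hyperplanes. -/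

section Slices

open Module

variable {n : ℕ}

/-- Fubini's theorem along the direction `v` and its orthogonal complement. -/
theorem lintegral_eq_lintegral_slices {v : 𝔼 n} (hv : v ≠ 0) (x₀ : 𝔼 n)
    {f : (𝔼 n) → ENNReal} (hf : Measurable f) :
    ∫⁻ x, f x = ‖v‖ₑ * ∫⁻ t : ℝ, ∫⁻ w : (ℝ ∙ v)ᗮ, f (t • v + (w : 𝔼 n) + x₀) := by
  have hmp := ((ℝ ∙ v).measurePreserving_measurableEquivProd x₀).symm
  rw [InnerProductSpace.euclideanHausdorffMeasure_eq_volume] at hmp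
  rw [← hmp.lintegral_comp hf, Measure.volume_eq_prod, lintegral_prod
    (fun z => f (((ℝ ∙ v).measurableEquivProd x₀).symm z)) (hf.comp hmp.measurable).aemeasurable]
  simp only [Submodule.measurableEquivProd_symm_apply, vadd_eq_add]
  have hrank : finrank ℝ (ℝ ∙ v) = 1 := finrank_span_singleton hv
  let v' : (ℝ ∙ v) := ⟨v, Submodule.mem_span_singleton_self v⟩
  have hv' : v' ≠ 0 := by
    intro h
    exact hv (congrArg Subtype.val h)
  let e : ℝ ≃L[ℝ] (ℝ ∙ v) := ContinuousLinearEquiv.toSpanNonzeroSingleton ℝ v hv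
  have he : (volume : Measure (ℝ ∙ v)) = ‖v'‖ₑ • volume.map e :=
    volume_eq_of_finrank_eq_one hrank hv'
  have hemb : MeasurableEmbedding e := e.toHomeomorph.measurableEmbedding
  rw [he, lintegral_smul_measure, smul_eq_mul, hemb.lintegral_map]
  rfl

theorem lintegral_hyperplane {v : 𝔼 n} (hv : v ≠ 0) (x₀ : 𝔼 n)
    (f : (𝔼 n) → ENNReal) :
    ∫⁻ x in {x | ⟪v, x - x₀⟫ = 0}, f x ∂(Measure.euclideanHausdorffMeasure (n - 1))
      = ∫⁻ w : (ℝ ∙ v)ᗮ, f ((w : 𝔼 n) + x₀) := by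
  -- The truncated subtraction is genuine here, because a nonzero vector forces n ≥ 1.
  have hrank : finrank ℝ (ℝ ∙ v)ᗮ = n - 1 := by
    have h1 := (ℝ ∙ v).finrank_add_finrank_orthogonal
    rw [finrank_span_singleton hv, finrank_euclideanSpace_fin] at h1
    omega
  have hiso : Isometry (fun w : (ℝ ∙ v)ᗮ => (w : 𝔼 n) + x₀) :=
    (isometry_add_right x₀).comp isometry_subtype_coe
  have hemb : MeasurableEmbedding (fun w : (ℝ ∙ v)ᗮ => (w : 𝔼 n) + x₀) :=
    hiso.isClosedEmbedding.measurableEmbedding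
  have hrange : range (fun w : (ℝ ∙ v)ᗮ => (w : 𝔼 n) + x₀) = {x | ⟪v, x - x₀⟫ = 0} := by
    ext x
    simp only [mem_range, mem_ofPred_eq]
    constructor
    · rintro ⟨w, rfl⟩
      rw [add_sub_cancel_right]
      exact Submodule.mem_orthogonal_singleton_iff_inner_right.1 w.2
    · intro hx
      exact ⟨⟨x - x₀, Submodule.mem_orthogonal_singleton_iff_inner_right.2 hx⟩,
        sub_add_cancel _ _⟩
  rw [← hrange, ← hiso.map_euclideanHausdorffMeasure, hemb.lintegral_map, ← hrank,
    InnerProductSpace.euclideanHausdorffMeasure_eq_volume]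

end Slices

/-! ### Geometry of the polytope and slicing by the level sets of one δ_k. -/

namespace Polytope

variable {n : ℕ} (Δ : Polytope n)

theorem delta_sub (k : Fin Δ.m) (x y : 𝔼 n) :
    Δ.delta k x - Δ.delta k y = ⟪Δ.normal k, x - y⟫ := by
  simp [delta, inner_sub_right]

theorem delta_line (k : Fin Δ.m) (x y : 𝔼 n) (s : ℝ) :
    Δ.delta k (x + s • (y - x)) = (1 - s) * Δ.delta k x + s * Δ.delta k y := by
  simp only [delta, inner_add_right, inner_smul_right, inner_sub_right]; ring

theorem contDiff_delta (k : Fin Δ.m) {m : WithTop ℕ∞} : ContDiff ℝ m (Δ.delta k) :=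
  (contDiff_const.inner ℝ contDiff_id).sub contDiff_const

theorem continuous_delta (k : Fin Δ.m) : Continuous (Δ.delta k) :=
  (Δ.contDiff_delta k (m := 0)).continuous

theorem partialDeriv_delta (k : Fin Δ.m) (i : Fin n) (x : 𝔼 n) :
    partialDeriv i (Δ.delta k) x = Δ.normal k i := by
  have h : HasFDerivAt (Δ.delta k) (innerSL ℝ (Δ.normal k)) x :=
    ((innerSL ℝ (Δ.normal k)).hasFDerivAt).sub_const _
  rw [partialDeriv_of_hasFDerivAt h]
  simp [EuclideanSpace.inner_single_right]

theorem isOpen_carrier : IsOpen Δ.carrier := by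
  have : Δ.carrier = ⋂ k, {x | 0 < Δ.delta k x} := by ext; simp [carrier]
  rw [this]
  exact isOpen_iInter_of_finite fun k => isOpen_lt continuous_const (Δ.continuous_delta k)

theorem line_mem_carrier {p x : 𝔼 n} (hp : p ∈ Δ.carrier) (hx : ∀ k, 0 ≤ Δ.delta k x) {s : ℝ}
    (h0 : 0 ≤ s) (h1 : s < 1) : p + s • (x - p) ∈ Δ.carrier := by
  intro k
  rw [delta_line]
  have := mul_pos (sub_pos.2 h1) (hp k)
  have := mul_nonneg h0 (hx k)
  linarith

theorem carrier_nonempty : Δ.carrier.Nonempty := Δ.nonempty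

/-- A point with all δ_k ≥ 0 is the limit of the open segment towards it from an interior point, and
that segment lies in the polytope. -/
theorem closure_carrier : closure Δ.carrier = {x | ∀ k, 0 ≤ Δ.delta k x} := by
  apply Subset.antisymm
  · refine closure_minimal (fun x hx k => (hx k).le) ?_
    have : {x | ∀ k, 0 ≤ Δ.delta k x} = ⋂ k, {x | 0 ≤ Δ.delta k x} := by ext; simp
    rw [this]
    exact isClosed_iInter fun k => isClosed_le continuous_const (Δ.continuous_delta k)
  · intro x hx
    obtain ⟨p, hp⟩ := Δ.carrier_nonempty
    have hc : Tendsto (fun s : ℝ => p + s • (x - p)) (𝓝[<] 1) (𝓝 x) := by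
      have : Continuous fun s : ℝ => p + s • (x - p) := by fun_prop
      have h := this.tendsto 1
      simp only [one_smul, add_sub_cancel] at h
      exact h.mono_left nhdsWithin_le_nhds
    refine mem_closure_of_tendsto hc ?_
    filter_upwards [Ioo_mem_nhdsLT (zero_lt_one (α := ℝ))] with s hs
    exact Δ.line_mem_carrier hp hx hs.1.le hs.2

theorem mem_closure_carrier {x : 𝔼 n} : x ∈ closure Δ.carrier ↔ ∀ k, 0 ≤ Δ.delta k x := by
  rw [closure_carrier]; rfl

theorem isCompact_closure_carrier : IsCompact (closure Δ.carrier) :=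
  Δ.bounded.isCompact_closure

theorem convex_carrier : Convex ℝ Δ.carrier := by
  intro x hx y hy a b ha hb hab k
  have e : a • x + b • y = x + b • (y - x) := by
    rw [← eq_sub_iff_add_eq] at hab
    rw [hab, sub_smul, one_smul, smul_sub]; abel
  rw [e, delta_line, ← hab]
  rcases ha.eq_or_lt with rfl | ha
  · have hb' : b = 1 := by linarith
    subst hb'
    have := hy k
    linarith
  · have := mul_pos ha (hx k)
    have := mul_nonneg hb (hy k).le
    have : a + b - b = a := by ring
    rw [this]; linarith

theorem normal_ne_zero {p : 𝔼 n} (hp : p ∈ Δ.carrier) (k : Fin Δ.m) : Δ.normal k ≠ 0 := by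
  intro h
  obtain ⟨x, hx, -⟩ := Δ.facet_exists k
  have h1 := hp k
  simp only [delta, h, inner_zero_left] at h1 hx
  linarith

theorem isClosed_facet (k : Fin Δ.m) : IsClosed (Δ.facet k) :=
  isClosed_closure.inter (isClosed_eq (Δ.continuous_delta k) continuous_const)

theorem isCompact_facet (k : Fin Δ.m) : IsCompact (Δ.facet k) :=
  Δ.isCompact_closure_carrier.of_isClosed_subset (Δ.isClosed_facet k) (fun _ hx => hx.1)

theorem volume_carrier_lt_top : volume Δ.carrier < ⊤ := Δ.bounded.measure_lt_top

/-- The vector from the hyperplane `δ_k = 0` to `p`, orthogonal to the hyperplane. -/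
noncomputable def height (k : Fin Δ.m) (p : 𝔼 n) : 𝔼 n :=
  (Δ.delta k p / ‖Δ.normal k‖ ^ 2) • Δ.normal k

/-- The part of the boundary measure carried by one facet. -/
noncomputable def facetMeasure (k : Fin Δ.m) : Measure (𝔼 n) :=
  ENNReal.ofReal (‖Δ.normal k‖⁻¹) •
    (Measure.euclideanHausdorffMeasure (n - 1)).restrict (Δ.facet k)

theorem inner_height (k : Fin Δ.m) (p y : 𝔼 n) :
    ⟪Δ.height k p, y⟫ = Δ.delta k p / ‖Δ.normal k‖ ^ 2 * ⟪Δ.normal k, y⟫ := by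
  rw [height, inner_smul_left]; rfl

theorem boundaryMeasure_eq_sum : Δ.boundaryMeasure = ∑ k, Δ.facetMeasure k := rfl

variable {p : 𝔼 n} (hp : p ∈ Δ.carrier) (k : Fin Δ.m)
include hp

theorem norm_normal_pos : 0 < ‖Δ.normal k‖ := norm_pos_iff.2 (Δ.normal_ne_zero hp k)

theorem height_ne_zero : Δ.height k p ≠ 0 := by
  have := hp k
  have := Δ.norm_normal_pos hp k
  exact smul_ne_zero (by positivity) (Δ.normal_ne_zero hp k)

/-- This is the Jacobian of slicing along `height`. It splits into δ_k(p) and the density 1/|∇δ_k|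
of the facet measure, so slice integrals carry the same normalization as integrals over the facet.
-/
theorem enorm_height :
    ‖Δ.height k p‖ₑ = ENNReal.ofReal (Δ.delta k p) * ENNReal.ofReal (‖Δ.normal k‖⁻¹) := by
  have h1 := hp k
  have h2 := Δ.norm_normal_pos hp k
  rw [← ENNReal.ofReal_mul h1.le, ← ofReal_norm, height, norm_smul, Real.norm_of_nonneg
    (by positivity)]
  congr 1
  field_simp

theorem inner_normal_height : ⟪Δ.normal k, Δ.height k p⟫ = Δ.delta k p := by
  have h2 := Δ.norm_normal_pos hp k
  rw [height, inner_smul_right, real_inner_self_eq_norm_sq]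
  field_simp

theorem inner_normal_orthogonal (w : (ℝ ∙ Δ.height k p)ᗮ) : ⟪Δ.normal k, (w : 𝔼 n)⟫ = 0 := by
  have h1 := hp k
  have h2 := Δ.norm_normal_pos hp k
  have := Submodule.mem_orthogonal_singleton_iff_inner_right.1 w.2
  rw [inner_height] at this
  have h3 : 0 < Δ.delta k p / ‖Δ.normal k‖ ^ 2 := by positivity
  exact (mul_eq_zero.1 this).resolve_left h3.ne'

/-- The slice parameter is normalized: t = 0 is the hyperplane of the facet and t = 1 is the level
set through p. -/
theorem delta_slice (t : ℝ) (w : (ℝ ∙ Δ.height k p)ᗮ) :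
    Δ.delta k (t • Δ.height k p + (w : 𝔼 n) + (p - Δ.height k p)) = t * Δ.delta k p := by
  have h1 := Δ.inner_normal_height hp k
  have h2 := Δ.inner_normal_orthogonal hp k w
  have : Δ.delta k (t • Δ.height k p + (w : 𝔼 n) + (p - Δ.height k p))
      = t * ⟪Δ.normal k, Δ.height k p⟫ + ⟪Δ.normal k, (w : 𝔼 n)⟫
        + (Δ.delta k p - ⟪Δ.normal k, Δ.height k p⟫) := by
    simp only [delta, inner_add_right, inner_sub_right, inner_smul_right]; ring
  rw [this, h1, h2]; ring

/-- Slicing Lebesgue measure by the level sets of `δ_k`. -/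
theorem lintegral_eq_slices {f : (𝔼 n) → ENNReal} (hf : Measurable f) :
    ∫⁻ x, f x = ENNReal.ofReal (Δ.delta k p) * ∫⁻ t : ℝ, ENNReal.ofReal (‖Δ.normal k‖⁻¹) *
      ∫⁻ w : (ℝ ∙ Δ.height k p)ᗮ, f (t • Δ.height k p + (w : 𝔼 n) + (p - Δ.height k p)) := by
  rw [lintegral_eq_lintegral_slices (Δ.height_ne_zero hp k) (p - Δ.height k p) hf,
    Δ.enorm_height hp k, mul_assoc]
  congr 1
  rw [lintegral_const_mul' _ _ ENNReal.ofReal_ne_top]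

theorem lintegral_facetMeasure (f : (𝔼 n) → ENNReal) :
    ∫⁻ x, f x ∂(Δ.facetMeasure k) = ENNReal.ofReal (‖Δ.normal k‖⁻¹) *
      ∫⁻ w : (ℝ ∙ Δ.height k p)ᗮ, (Δ.facet k).indicator f ((w : 𝔼 n) + (p - Δ.height k p)) := by
  rw [facetMeasure, lintegral_smul_measure, smul_eq_mul,
    ← lintegral_hyperplane (Δ.height_ne_zero hp k)]
  congr 1
  have hsub : Δ.facet k ⊆ {x | ⟪Δ.height k p, x - (p - Δ.height k p)⟫ = 0} := by
    intro x hx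
    have h1 : Δ.delta k x = 0 := hx.2
    have h2 := Δ.inner_normal_height hp k
    have h3 : ⟪Δ.normal k, x - (p - Δ.height k p)⟫ = 0 := by
      have := Δ.delta_sub k x p
      rw [inner_sub_right] at this
      rw [inner_sub_right, inner_sub_right, h2]
      linarith
    change ⟪Δ.height k p, x - (p - Δ.height k p)⟫ = 0
    rw [inner_height, h3, mul_zero]
  rw [lintegral_indicator (Δ.isClosed_facet k).measurableSet, Measure.restrict_restrict
    (Δ.isClosed_facet k).measurableSet, inter_eq_self_of_subset_left hsub]

omit hp in
theorem isFiniteMeasure_facetMeasure : IsFiniteMeasure (Δ.facetMeasure k) := by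
  obtain ⟨p, hp⟩ := Δ.carrier_nonempty
  refine ⟨?_⟩
  rw [← lintegral_one, Δ.lintegral_facetMeasure hp]
  refine ENNReal.mul_lt_top ENNReal.ofReal_lt_top ?_
  have hcl : IsClosedEmbedding
      (fun w : (ℝ ∙ Δ.height k p)ᗮ => (w : 𝔼 n) + (p - Δ.height k p)) :=
    ((isometry_add_right _).comp isometry_subtype_coe).isClosedEmbedding
  have hK := hcl.isCompact_preimage (Δ.isCompact_facet k)
  have e : ∀ w : (ℝ ∙ Δ.height k p)ᗮ,
      (Δ.facet k).indicator (fun _ => (1 : ENNReal)) ((w : 𝔼 n) + (p - Δ.height k p))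
      = (((fun w : (ℝ ∙ Δ.height k p)ᗮ => (w : 𝔼 n) + (p - Δ.height k p)) ⁻¹' Δ.facet k).indicator
        (fun _ => (1 : ENNReal)) w) := fun w => rfl
  simp only [e]
  rw [lintegral_indicator_const hK.isClosed.measurableSet, one_mul]
  exact hK.measure_lt_top

omit hp in
instance isFiniteMeasure_boundaryMeasure : IsFiniteMeasure Δ.boundaryMeasure := by
  rw [boundaryMeasure_eq_sum]
  have := fun k => Δ.isFiniteMeasure_facetMeasure k
  refine ⟨?_⟩
  rw [Measure.finsetSum_apply]
  exact ENNReal.sum_lt_top.2 fun k _ => measure_lt_top _ _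

end Polytope

/-! ### Collar and boundary-layer integrals compared with facet integrals. -/

namespace Polytope

variable {n : ℕ} (Δ : Polytope n)

theorem measurable_indicator_of_continuousOn {α : Type*} [TopologicalSpace α] [MeasurableSpace α]
    [BorelSpace α] {u : α → ℝ} {S T : Set α} (hu : ContinuousOn u S) (hS : MeasurableSet S)
    (hT : MeasurableSet T) (hTS : T ⊆ S) :
    Measurable (T.indicator fun x => ENNReal.ofReal (u x)) := by
  classical
  have h1 : Measurable (S.piecewise u (fun _ => 0)) :=
    hu.measurable_piecewise continuousOn_const hS
  have h2 : T.indicator (fun x => ENNReal.ofReal (u x))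
      = T.indicator (fun x => ENNReal.ofReal (S.piecewise u (fun _ => 0) x)) := by
    refine indicator_congr fun x hx => ?_
    rw [piecewise_eq_of_mem _ _ _ (hTS hx)]
  rw [h2]
  exact (ENNReal.measurable_ofReal.comp h1).indicator hT

/-- The Jacobian of the substitution is s to the dimension of V, which is at most 1. -/
theorem lintegral_comp_inv_smul_le {V : Type*} [NormedAddCommGroup V] [NormedSpace ℝ V]
    [FiniteDimensional ℝ V] [MeasurableSpace V] [BorelSpace V] (μ : Measure V)
    [μ.IsAddHaarMeasure] {s : ℝ} (h0 : 0 < s) (h1 : s ≤ 1) (f : V → ENNReal) :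
    ∫⁻ w, f (s⁻¹ • w) ∂μ ≤ ∫⁻ w, f w ∂μ := by
  have hs : s⁻¹ ≠ 0 := inv_ne_zero h0.ne'
  have hemb : MeasurableEmbedding (fun w : V => s⁻¹ • w) :=
    (Homeomorph.smulOfNeZero s⁻¹ hs).measurableEmbedding
  rw [← hemb.lintegral_map, Measure.map_addHaar_smul μ hs, lintegral_smul_measure, smul_eq_mul]
  have : ENNReal.ofReal |(s⁻¹ ^ Module.finrank ℝ V)⁻¹| ≤ 1 := by
    rw [inv_pow, inv_inv, abs_of_nonneg (by positivity), ← ENNReal.ofReal_one]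
    exact ENNReal.ofReal_le_ofReal (pow_le_one₀ h0.le h1)
  calc _ ≤ 1 * ∫⁻ w, f w ∂μ := by gcongr
    _ = _ := one_mul _

variable {p : 𝔼 n}

/-- Projection from p: a point at level t lies on the ray from p through a point of the facet
hyperplane, at the fraction 1 - t of the way. -/
theorem slice_eq_add_smul (k : Fin Δ.m) (t : ℝ) (ht : t < 1) (w : 𝔼 n) :
    t • Δ.height k p + w + (p - Δ.height k p)
      = p + (1 - t) • (((1 - t)⁻¹ • w + (p - Δ.height k p)) - p) := by
  have : (1 - t) ≠ 0 := (sub_pos.2 ht).ne'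
  have e : (1 - t)⁻¹ • w + (p - Δ.height k p) - p = (1 - t)⁻¹ • w - Δ.height k p := by abel
  rw [e, smul_sub, smul_inv_smul₀ this, sub_smul, one_smul]
  abel

variable (hp : p ∈ Δ.carrier)
include hp

/-- The integral over the collar inside the cone on a facet is controlled by the facet. -/
theorem lintegral_cone_collar_le {u : (𝔼 n) → ℝ} (hc : ContinuousOn u (closure Δ.carrier))
    (hu : ConvexOn ℝ (closure Δ.carrier) u) (h0 : Δ.Normalized p u) {η : ℝ}
    (hη1 : η < 1) (k : Fin Δ.m) :
    ∫⁻ x in {x | x ∈ Δ.carrier ∧ (∀ l, Δ.delta k x * Δ.delta l p ≤ Δ.delta l x * Δ.delta k p) ∧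
        Δ.delta k x ≤ η * Δ.delta k p}, ENNReal.ofReal (u x)
      ≤ ENNReal.ofReal (Δ.delta k p) * (ENNReal.ofReal η *
        ∫⁻ x, ENNReal.ofReal (u x) ∂(Δ.facetMeasure k)) := by
  set T : Set (𝔼 n) := {x | x ∈ Δ.carrier ∧
    (∀ l, Δ.delta k x * Δ.delta l p ≤ Δ.delta l x * Δ.delta k p) ∧
        Δ.delta k x ≤ η * Δ.delta k p} with hT
  have hTm : MeasurableSet T := by
    have h1 : MeasurableSet {x | ∀ l, Δ.delta k x * Δ.delta l p ≤ Δ.delta l x * Δ.delta k p} := by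
      have : {x | ∀ l, Δ.delta k x * Δ.delta l p ≤ Δ.delta l x * Δ.delta k p}
          = ⋂ l, {x | Δ.delta k x * Δ.delta l p ≤ Δ.delta l x * Δ.delta k p} := by ext; simp
      rw [this]
      exact MeasurableSet.iInter fun l => (isClosed_le ((Δ.continuous_delta k).mul continuous_const)
        ((Δ.continuous_delta l).mul continuous_const)).measurableSet
    exact Δ.isOpen_carrier.measurableSet.inter (h1.inter
      (isClosed_le (Δ.continuous_delta k) continuous_const).measurableSet)
  have hpk : ∀ l, 0 < Δ.delta l p := hp
  rw [← lintegral_indicator hTm, Δ.lintegral_eq_slices hp k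
    (measurable_indicator_of_continuousOn hc isClosed_closure.measurableSet hTm
      (fun x hx => subset_closure hx.1)), Δ.lintegral_facetMeasure hp]
  refine mul_le_mul_right ?_ _
  set J := ENNReal.ofReal ‖Δ.normal k‖⁻¹ * ∫⁻ w : (ℝ ∙ Δ.height k p)ᗮ, (Δ.facet k).indicator
    (fun x => ENNReal.ofReal (u x)) ((w : 𝔼 n) + (p - Δ.height k p)) with hJ
  have hmain : ∀ t : ℝ, ENNReal.ofReal ‖Δ.normal k‖⁻¹ * ∫⁻ w : (ℝ ∙ Δ.height k p)ᗮ,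
      T.indicator (fun x => ENNReal.ofReal (u x))
        (t • Δ.height k p + (w : 𝔼 n) + (p - Δ.height k p))
      ≤ (Ioc 0 η).indicator (fun _ => J) t := by
    intro t
    by_cases ht : t ∈ Ioc 0 η
    · rw [indicator_of_mem ht, hJ]
      have ht1 : t < 1 := ht.2.trans_lt hη1
      refine mul_le_mul_right ?_ _
      -- Projecting the slice from p onto the facet rescales it by (1 - t)⁻¹, so the slice integral
      -- can be compared with the full facet integral at a factor at most 1.
      refine le_trans ?_ (lintegral_comp_inv_smul_le volume (sub_pos.2 ht1)
        (by linarith [ht.1]) _)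
      refine lintegral_mono fun w => ?_
      by_cases hx : t • Δ.height k p + (w : 𝔼 n) + (p - Δ.height k p) ∈ T
      swap
      · rw [indicator_of_notMem hx]; exact bot_le
      rw [indicator_of_mem hx]
      set y : 𝔼 n := (((1 - t)⁻¹ • w : (ℝ ∙ Δ.height k p)ᗮ) : 𝔼 n) + (p - Δ.height k p) with hy
      have hxy : t • Δ.height k p + (w : 𝔼 n) + (p - Δ.height k p) = p + (1 - t) • (y - p) :=
        Δ.slice_eq_add_smul k t ht1 w
      have hdx : Δ.delta k (t • Δ.height k p + (w : 𝔼 n) + (p - Δ.height k p))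
          = t * Δ.delta k p := Δ.delta_slice hp k t w
      rw [hxy] at hx hdx ⊢
      have hs : 0 < 1 - t := sub_pos.2 ht1
      have hdl : ∀ l, Δ.delta l (p + (1 - t) • (y - p))
          = t * Δ.delta l p + (1 - t) * Δ.delta l y := by
        intro l; rw [delta_line]; ring
      have hyk : Δ.delta k y = 0 := by
        have := hdl k
        rw [hdx] at this
        have : (1 - t) * Δ.delta k y = 0 := by linarith
        exact (mul_eq_zero.1 this).resolve_left hs.ne'
      -- The cone inequalities say exactly that the projection from p hits the facet itself and not
      -- merely its hyperplane.
      have hyc : y ∈ closure Δ.carrier := by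
        rw [mem_closure_carrier]
        intro l
        have h1 := hx.2.1 l
        rw [hdx, hdl l] at h1
        have h2 : 0 ≤ (1 - t) * Δ.delta l y * Δ.delta k p := by nlinarith
        exact nonneg_of_mul_nonneg_right (nonneg_of_mul_nonneg_left h2 (hpk k)) hs
      rw [indicator_of_mem (show y ∈ Δ.facet k from ⟨hyc, hyk⟩)]
      refine ENNReal.ofReal_le_ofReal ?_
      -- Convexity on the segment from p, where u vanishes, gives u(x) ≤ (1 - t) u(y) ≤ u(y).
      have h1 := hu.2 (subset_closure hp) hyc ht.1.le hs.le (by ring)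
      have e : t • p + (1 - t) • y = p + (1 - t) • (y - p) := by
        rw [smul_sub, sub_smul, sub_smul, one_smul, one_smul]; abel
      rw [e, h0.1] at h1
      have h2 := h0.2 y hyc
      simp only [smul_eq_mul] at h1
      nlinarith [ht.1]
    · rw [indicator_of_notMem ht]
      have : ∀ w : (ℝ ∙ Δ.height k p)ᗮ, T.indicator (fun x => ENNReal.ofReal (u x))
          (t • Δ.height k p + (w : 𝔼 n) + (p - Δ.height k p)) = 0 := by
        intro w
        refine indicator_of_notMem (fun hx => ht ?_) _
        have h1 := hx.1 k
        have h2 := hx.2.2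
        rw [Δ.delta_slice hp k t w] at h1 h2
        exact ⟨pos_of_mul_pos_left h1 (hpk k).le, le_of_mul_le_mul_right h2 (hpk k)⟩
      simp [this]
  refine (lintegral_mono hmain).trans ?_
  rw [lintegral_indicator_const measurableSet_Ioc, mul_comm]
  simp

/-- Each x belongs to the cone over the facet that minimizes δ_l(x)/δ_l(p), so the cone estimates
add up. The factor η is what later lets ∫ A u be absorbed into the boundary norm. -/
theorem lintegral_collar_le {u : (𝔼 n) → ℝ} (hc : ContinuousOn u (closure Δ.carrier))
    (hu : ConvexOn ℝ (closure Δ.carrier) u) (h0 : Δ.Normalized p u) {η : ℝ}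
    (hη1 : η < 1) :
    ∫⁻ x in {x | x ∈ Δ.carrier ∧ ∃ k, Δ.delta k x ≤ η * Δ.delta k p}, ENNReal.ofReal (u x)
      ≤ ENNReal.ofReal (∑ k, Δ.delta k p) * (ENNReal.ofReal η *
        ∫⁻ x, ENNReal.ofReal (u x) ∂Δ.boundaryMeasure) := by
  have hpk : ∀ l, 0 < Δ.delta l p := hp
  set T : Fin Δ.m → Set (𝔼 n) := fun k => {x | x ∈ Δ.carrier ∧
    (∀ l, Δ.delta k x * Δ.delta l p ≤ Δ.delta l x * Δ.delta k p) ∧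
        Δ.delta k x ≤ η * Δ.delta k p} with hT
  have hsub : {x | x ∈ Δ.carrier ∧ ∃ k, Δ.delta k x ≤ η * Δ.delta k p} ⊆ ⋃ k, T k := by
    rintro x ⟨hx, k, hk⟩
    obtain ⟨j, -, hj⟩ := Finset.exists_min_image Finset.univ
      (fun l => Δ.delta l x / Δ.delta l p) ⟨k, Finset.mem_univ k⟩
    refine mem_iUnion.2 ⟨j, hx, fun l => ?_, ?_⟩
    · have := hj l (Finset.mem_univ l)
      rwa [div_le_div_iff₀ (hpk j) (hpk l)] at this
    · have h1 := hj k (Finset.mem_univ k)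
      rw [div_le_iff₀ (hpk j)] at h1
      refine h1.trans (mul_le_mul_of_nonneg_right ?_ (hpk j).le)
      rwa [div_le_iff₀ (hpk k)]
  calc _ ≤ ∫⁻ x in ⋃ k, T k, ENNReal.ofReal (u x) := lintegral_mono_set hsub
    _ ≤ ∑' k, ∫⁻ x in T k, ENNReal.ofReal (u x) := lintegral_iUnion_le _ _
    _ = ∑ k, ∫⁻ x in T k, ENNReal.ofReal (u x) := tsum_fintype _
    _ ≤ ∑ k, ENNReal.ofReal (∑ k, Δ.delta k p) * (ENNReal.ofReal η *
        ∫⁻ x, ENNReal.ofReal (u x) ∂(Δ.facetMeasure k)) := by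
      refine Finset.sum_le_sum fun k _ => ?_
      refine (Δ.lintegral_cone_collar_le hp hc hu h0 hη1 k).trans ?_
      gcongr
      exact Finset.single_le_sum (f := fun k => Δ.delta k p) (fun l _ => (hpk l).le)
        (Finset.mem_univ k)
    _ = _ := by
      rw [← Finset.mul_sum, ← Finset.mul_sum, boundaryMeasure_eq_sum,
        lintegral_finsetSum_measure]

/-- Integrals of a continuous function over slices parallel to a facet are asymptotically at most
the integral over the facet. -/
theorem eventually_slice_le {u : (𝔼 n) → ℝ} (hc : ContinuousOn u (closure Δ.carrier))
    (k : Fin Δ.m) {ε : ENNReal} (hε : 0 < ε) :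
    ∀ᶠ t in 𝓝[>] (0 : ℝ), ENNReal.ofReal ‖Δ.normal k‖⁻¹ * ∫⁻ w : (ℝ ∙ Δ.height k p)ᗮ,
      (closure Δ.carrier).indicator (fun x => ENNReal.ofReal (u x))
        (t • Δ.height k p + (w : 𝔼 n) + (p - Δ.height k p))
      ≤ ∫⁻ x, ENNReal.ofReal (u x) ∂(Δ.facetMeasure k) + ε := by
  -- A failure yields levels tending to 0 along which the bound is violated; the reverse Fatou
  -- lemma, with a constant on a ball as dominating function, contradicts this.
  by_contra hcon
  rw [not_eventually] at hcon
  obtain ⟨t, ht, htP⟩ := exists_seq_forall_of_frequently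
    (hcon.and_eventually (Ioo_mem_nhdsGT (zero_lt_one (α := ℝ))))
  have ht0 : Tendsto t atTop (𝓝 0) := ht.mono_right nhdsWithin_le_nhds
  obtain ⟨B, hB⟩ := Δ.isCompact_closure_carrier.exists_bound_of_continuousOn hc
  obtain ⟨R, hR⟩ := Δ.isCompact_closure_carrier.isBounded.exists_norm_le
  set φ : (𝔼 n) → ENNReal := (closure Δ.carrier).indicator (fun x => ENNReal.ofReal (u x)) with hφ
  have hφm : Measurable φ := measurable_indicator_of_continuousOn hc
    isClosed_closure.measurableSet isClosed_closure.measurableSet Subset.rfl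
  set f : ℕ → (ℝ ∙ Δ.height k p)ᗮ → ENNReal := fun j w =>
    φ (t j • Δ.height k p + (w : 𝔼 n) + (p - Δ.height k p)) with hf
  set ρ := R + ‖Δ.height k p‖ + ‖p - Δ.height k p‖ with hρ
  have hbound : ∀ j w, f j w ≤ (Metric.closedBall (0 : (ℝ ∙ Δ.height k p)ᗮ) ρ).indicator
      (fun _ => ENNReal.ofReal B) w := by
    intro j w
    by_cases hx : t j • Δ.height k p + (w : 𝔼 n) + (p - Δ.height k p) ∈ closure Δ.carrier
    · have hw : w ∈ Metric.closedBall (0 : (ℝ ∙ Δ.height k p)ᗮ) ρ := by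
        rw [mem_closedBall_zero_iff]
        change ‖(w : 𝔼 n)‖ ≤ ρ
        have h1 := hR _ hx
        have h2 := (htP j).2
        have e : (w : 𝔼 n) = (t j • Δ.height k p + (w : 𝔼 n) + (p - Δ.height k p))
            - t j • Δ.height k p - (p - Δ.height k p) := by abel
        rw [e]
        refine (norm_sub_le _ _).trans ?_
        refine add_le_add ((norm_sub_le _ _).trans (add_le_add h1 ?_)) le_rfl
        rw [norm_smul, Real.norm_of_nonneg h2.1.le]
        exact mul_le_of_le_one_left (norm_nonneg _) h2.2.le
      rw [indicator_of_mem hw, hf]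
      simp only [hφ, indicator_of_mem hx]
      exact ENNReal.ofReal_le_ofReal ((le_abs_self _).trans (hB _ hx))
    · simp [hf, hφ, indicator_of_notMem hx]
  have hmeas : ∀ j, Measurable (f j) := fun j => hφm.comp (by fun_prop)
  have hlim := limsup_lintegral_le (μ := volume) _ hmeas (fun j => Eventually.of_forall (hbound j))
    (by
      rw [lintegral_indicator_const Metric.isClosed_closedBall.measurableSet]
      exact ENNReal.mul_ne_top ENNReal.ofReal_ne_top
        (isCompact_closedBall _ _).measure_lt_top.ne)
  -- Extension of a nonnegative continuous function by zero off a closed set is upper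
  -- semicontinuous; this is why only an upper bound is available, and it is all that is needed.
  have hpt : ∀ w, limsup (fun j => f j w) atTop ≤ φ ((w : 𝔼 n) + (p - Δ.height k p)) := by
    intro w
    have hcont : Tendsto (fun j => t j • Δ.height k p + (w : 𝔼 n) + (p - Δ.height k p)) atTop
        (𝓝 ((w : 𝔼 n) + (p - Δ.height k p))) := by
      have := ((ht0.smul_const (Δ.height k p)).add_const (w : 𝔼 n)).add_const (p - Δ.height k p)
      simpa using this
    by_cases hw : (w : 𝔼 n) + (p - Δ.height k p) ∈ closure Δ.carrier
    · refine le_of_forall_gt fun b hb => ?_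
      simp only [hφ, indicator_of_mem hw] at hb
      obtain ⟨b', hb1, hb2⟩ := exists_between hb
      refine lt_of_le_of_lt ?_ hb2
      refine limsup_le_of_le (h := ?_)
      have hct := (ENNReal.continuous_ofReal.continuousAt.comp_continuousWithinAt (hc _ hw))
      have hev := hct.eventually_lt continuousWithinAt_const hb1
      have := hcont.eventually (eventually_nhdsWithin_iff.1 hev)
      filter_upwards [this] with j hj
      simp only [hf, hφ]
      by_cases h : t j • Δ.height k p + (w : 𝔼 n) + (p - Δ.height k p) ∈ closure Δ.carrier
      · rw [indicator_of_mem h]; exact (hj h).le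
      · rw [indicator_of_notMem h]; exact bot_le
    · have hev := hcont.eventually (isClosed_closure.isOpen_compl.mem_nhds hw)
      refine limsup_le_of_le (h := ?_)
      filter_upwards [hev] with j hj
      simp only [hf, hφ, indicator_of_notMem hj]
      exact bot_le
  have hface : ∀ w : (ℝ ∙ Δ.height k p)ᗮ, φ ((w : 𝔼 n) + (p - Δ.height k p))
      = (Δ.facet k).indicator (fun x => ENNReal.ofReal (u x))
        ((w : 𝔼 n) + (p - Δ.height k p)) := by
    intro w
    have h0 : Δ.delta k ((w : 𝔼 n) + (p - Δ.height k p)) = 0 := by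
      have := Δ.delta_slice hp k 0 w
      simpa using this
    by_cases hw : (w : 𝔼 n) + (p - Δ.height k p) ∈ closure Δ.carrier
    · have : (w : 𝔼 n) + (p - Δ.height k p) ∈ Δ.facet k := ⟨hw, h0⟩
      rw [hφ, indicator_of_mem hw, indicator_of_mem this]
    · have : (w : 𝔼 n) + (p - Δ.height k p) ∉ Δ.facet k := fun h => hw h.1
      rw [hφ, indicator_of_notMem hw, indicator_of_notMem this]
  have hfin : ∫⁻ x, ENNReal.ofReal (u x) ∂(Δ.facetMeasure k) ≠ ⊤ := by
    have := Δ.isFiniteMeasure_facetMeasure k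
    have hb : ∀ᵐ x ∂(Δ.facetMeasure k), ENNReal.ofReal (u x) ≤ ENNReal.ofReal B := by
      refine Measure.ae_smul_measure ?_ _
      refine (ae_restrict_iff' (Δ.isClosed_facet k).measurableSet).2 (Eventually.of_forall ?_)
      exact fun x hx => ENNReal.ofReal_le_ofReal ((le_abs_self _).trans (hB x hx.1))
    refine ((lintegral_mono_ae hb).trans_lt ?_).ne
    rw [lintegral_const]
    exact ENNReal.mul_lt_top ENNReal.ofReal_lt_top (measure_lt_top _ _)
  have hle : limsup (fun j => ENNReal.ofReal ‖Δ.normal k‖⁻¹ * ∫⁻ w, f j w) atTop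
      ≤ ∫⁻ x, ENNReal.ofReal (u x) ∂(Δ.facetMeasure k) := by
    rw [ENNReal.limsup_const_mul_of_ne_top ENNReal.ofReal_ne_top, Δ.lintegral_facetMeasure hp]
    refine mul_le_mul_right ?_ _
    refine hlim.trans (lintegral_mono fun w => ?_)
    rw [← hface w]
    exact hpt w
  have hlt := hle.trans_lt (ENNReal.lt_add_right hfin hε.ne')
  obtain ⟨j, hj⟩ := (eventually_lt_of_limsup_lt hlt).exists
  exact (htP j).1 hj.le

/-- A kernel in `δ_k` concentrated near a facet against a continuous function. -/
theorem exists_lintegral_kernel_le {u : (𝔼 n) → ℝ} (hc : ContinuousOn u (closure Δ.carrier))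
    (k : Fin Δ.m) {ε : ENNReal} (hε : 0 < ε) :
    ∃ τ > 0, ∀ t₀, 0 < t₀ → t₀ ≤ τ → ∀ κ : ℝ → ENNReal, Measurable κ →
      ∫⁻ x in {x | x ∈ Δ.carrier ∧ Δ.delta k x < t₀ * Δ.delta k p},
          κ (Δ.delta k x / Δ.delta k p) * ENNReal.ofReal (u x)
        ≤ ENNReal.ofReal (Δ.delta k p) * ((∫⁻ t in Ioo 0 t₀, κ t) *
          (∫⁻ x, ENNReal.ofReal (u x) ∂(Δ.facetMeasure k) + ε)) := by
  have hpk : 0 < Δ.delta k p := hp k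
  obtain ⟨τ, hτ0, hτ⟩ := mem_nhdsGT_iff_exists_Ioo_subset.1 (Δ.eventually_slice_le hp hc k hε)
  refine ⟨τ, hτ0, fun t₀ ht₀ ht₀τ κ hκ => ?_⟩
  set T : Set (𝔼 n) := {x | x ∈ Δ.carrier ∧ Δ.delta k x < t₀ * Δ.delta k p} with hT
  have hTm : MeasurableSet T := Δ.isOpen_carrier.measurableSet.inter
    (isOpen_lt (Δ.continuous_delta k) continuous_const).measurableSet
  set J := ∫⁻ x, ENNReal.ofReal (u x) ∂(Δ.facetMeasure k) + ε with hJ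
  have hκd : Measurable fun x => κ (Δ.delta k x / Δ.delta k p) :=
    hκ.comp ((Δ.continuous_delta k).measurable.div_const _)
  have e1 : ∀ x, T.indicator (fun x => κ (Δ.delta k x / Δ.delta k p) * ENNReal.ofReal (u x)) x
      = κ (Δ.delta k x / Δ.delta k p) * T.indicator (fun x => ENNReal.ofReal (u x)) x := by
    intro x
    rw [indicator_mul_right]
  rw [← lintegral_indicator hTm]
  simp only [e1]
  have hTi := measurable_indicator_of_continuousOn hc isClosed_closure.measurableSet hTm
      (fun x hx => subset_closure hx.1)
  rw [Δ.lintegral_eq_slices hp k (f := fun x => κ (Δ.delta k x / Δ.delta k p) *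
    T.indicator (fun x => ENNReal.ofReal (u x)) x) (hκd.mul hTi)]
  refine mul_le_mul_right ?_ _
  -- The kernel is constant on each slice, so the integral factors slice by slice into the kernel at
  -- t times a slice integral that is already bounded uniformly in t.
  rw [← lintegral_mul_const _ hκ, ← lintegral_indicator measurableSet_Ioo]
  refine lintegral_mono fun t => ?_
  have e2 : ∀ w : (ℝ ∙ Δ.height k p)ᗮ,
      Δ.delta k (t • Δ.height k p + (w : 𝔼 n) + (p - Δ.height k p)) / Δ.delta k p = t := by
    intro w
    rw [Δ.delta_slice hp k t w, mul_div_cancel_right₀ _ hpk.ne']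
  simp only [e2]
  by_cases ht : t ∈ Ioo 0 t₀
  · have hTc : Measurable fun w : (ℝ ∙ Δ.height k p)ᗮ => T.indicator
        (fun x => ENNReal.ofReal (u x)) (t • Δ.height k p + (w : 𝔼 n) + (p - Δ.height k p)) :=
      hTi.comp (by fun_prop)
    rw [indicator_of_mem ht, lintegral_const_mul _ hTc, mul_left_comm]
    refine mul_le_mul_right ?_ _
    have := hτ ⟨ht.1, ht.2.trans_le ht₀τ⟩
    refine le_trans ?_ this
    refine mul_le_mul_right (lintegral_mono fun w => ?_) _
    exact indicator_le_indicator_of_subset (fun x hx => subset_closure hx.1)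
      (fun _ => bot_le) _
  · rw [indicator_of_notMem ht]
    have : ∀ w : (ℝ ∙ Δ.height k p)ᗮ, T.indicator (fun x => ENNReal.ofReal (u x))
          (t • Δ.height k p + (w : 𝔼 n) + (p - Δ.height k p)) = 0 := by
      intro w
      refine indicator_of_notMem (fun hx => ht ?_) _
      have h1 := hx.1 k
      have h2 := hx.2
      rw [Δ.delta_slice hp k t w] at h1 h2
      exact ⟨pos_of_mul_pos_left h1 hpk.le, lt_of_mul_lt_mul_right h2 hpk.le⟩
    simp [this]

end Polytope

/-! ### Guillemin boundary behaviour, the Hessian determinant and the potential. -/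

namespace Polytope

variable {n : ℕ} (Δ : Polytope n)

theorem sum_coord_mul_normal (k : Fin Δ.m) (x p : 𝔼 n) :
    ∑ i, (x i - p i) * Δ.normal k i = Δ.delta k x - Δ.delta k p := by
  rw [delta_sub, PiLp.inner_apply]
  simp

theorem uniqueDiffOn_closure : UniqueDiffOn ℝ (closure Δ.carrier) :=
  uniqueDiffOn_convex Δ.convex_carrier.closure
    (Δ.carrier_nonempty.mono (Δ.isOpen_carrier.subset_interior_iff.2 subset_closure))

/-- The derivative within the closed polytope is smooth up to the boundary and agrees with the
ordinary one inside. Compactness then bounds all interior derivatives. -/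
theorem exists_contDiffOn_partialDeriv {f : (𝔼 n) → ℝ}
    (hf : ContDiffOn ℝ ∞ f (closure Δ.carrier)) (i : Fin n) :
    ∃ f' : (𝔼 n) → ℝ, ContDiffOn ℝ ∞ f' (closure Δ.carrier) ∧
      ∀ x ∈ Δ.carrier, f' x = partialDeriv i f x := by
  refine ⟨fun x => fderivWithin ℝ f (closure Δ.carrier) x (EuclideanSpace.single i 1),
    (hf.fderivWithin Δ.uniqueDiffOn_closure (m := ∞) (by simp)).clm_apply contDiffOn_const, ?_⟩
  intro x hx
  simp only [partialDeriv]
  rw [fderivWithin_of_mem_nhds (Filter.mem_of_superset (Δ.isOpen_carrier.mem_nhds hx)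
    subset_closure)]

theorem exists_bound_of_continuousOn {f : (𝔼 n) → ℝ} (hf : ContinuousOn f (closure Δ.carrier)) :
    ∃ M : ℝ, 0 ≤ M ∧ ∀ x ∈ closure Δ.carrier, |f x| ≤ M := by
  obtain ⟨M, hM⟩ := Δ.isCompact_closure_carrier.exists_bound_of_continuousOn hf
  exact ⟨|M|, abs_nonneg M, fun x hx => (hM x hx).trans (le_abs_self M)⟩

theorem exists_bound_partialDeriv {f : (𝔼 n) → ℝ}
    (hf : ContDiffOn ℝ ∞ f (closure Δ.carrier)) :
    ∃ M : ℝ, 0 ≤ M ∧ ∀ x ∈ Δ.carrier, |f x| ≤ M ∧ (∀ i, |partialDeriv i f x| ≤ M) ∧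
      ∀ i j, |hessian f x i j| ≤ M := by
  obtain ⟨M0, hM0, h0⟩ := Δ.exists_bound_of_continuousOn hf.continuousOn
  choose f1 hf1 he1 using Δ.exists_contDiffOn_partialDeriv hf
  choose M1 hM1 h1 using fun i => Δ.exists_bound_of_continuousOn (hf1 i).continuousOn
  choose f2 hf2 he2 using fun j i => Δ.exists_contDiffOn_partialDeriv (hf1 j) i
  choose M2 hM2 h2 using fun j i => Δ.exists_bound_of_continuousOn (hf2 j i).continuousOn
  have s1 : 0 ≤ ∑ i, M1 i := Finset.sum_nonneg fun i _ => hM1 i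
  have s2 : 0 ≤ ∑ j, ∑ i, M2 j i :=
    Finset.sum_nonneg fun j _ => Finset.sum_nonneg fun i _ => hM2 j i
  refine ⟨M0 + ∑ i, M1 i + ∑ j, ∑ i, M2 j i, by positivity, fun x hx => ⟨?_, fun i => ?_,
    fun i j => ?_⟩⟩
  · linarith [h0 x (subset_closure hx)]
  · rw [← he1 i x hx]
    have := Finset.single_le_sum (f := M1) (fun i _ => hM1 i) (Finset.mem_univ i)
    linarith [h1 i x (subset_closure hx)]
  · rw [hessian_apply, partialDeriv_congr_of_isOpen (w := f1 j) Δ.isOpen_carrier hx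
      (fun y hy => (he1 j y hy).symm), ← he2 j i x hx]
    have e1 := Finset.single_le_sum (f := M2 j) (fun i _ => hM2 j i) (Finset.mem_univ i)
    have e2 := Finset.single_le_sum (f := fun j => ∑ i, M2 j i)
      (fun j _ => Finset.sum_nonneg fun i _ => hM2 j i) (Finset.mem_univ j)
    have e3 := h2 j i x (subset_closure hx)
    linarith

theorem contDiffOn_guillemin : ContDiffOn ℝ ∞ Δ.guillemin Δ.carrier := by
  unfold guillemin
  refine ContDiffOn.sum fun k _ => (Δ.contDiff_delta k).contDiffOn.mul ?_
  exact (Δ.contDiff_delta k).contDiffOn.log fun x hx => (hx k).ne'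

theorem differentiableAt_delta (k : Fin Δ.m) (x : 𝔼 n) : DifferentiableAt ℝ (Δ.delta k) x :=
  (Δ.contDiff_delta k (m := 1)).differentiable (by simp) x

theorem partialDeriv_guillemin (i : Fin n) {x : 𝔼 n} (hx : x ∈ Δ.carrier) :
    partialDeriv i Δ.guillemin x = ∑ k, Δ.normal k i * (Real.log (Δ.delta k x) + 1) := by
  unfold guillemin
  have hd : ∀ k, DifferentiableAt ℝ (fun y => Δ.delta k y * Real.log (Δ.delta k y)) x := fun k =>
    (Δ.differentiableAt_delta k x).mul ((Δ.differentiableAt_delta k x).log (hx k).ne')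
  rw [partialDeriv_sum (F := fun k y => Δ.delta k y * Real.log (Δ.delta k y)) fun k _ => hd k]
  refine Finset.sum_congr rfl fun k _ => ?_
  rw [partialDeriv_comp (u := Δ.delta k) (Real.hasDerivAt_mul_log (hx k).ne')
    (Δ.differentiableAt_delta k x), partialDeriv_delta, mul_comm]

theorem hessian_guillemin (i j : Fin n) {x : 𝔼 n} (hx : x ∈ Δ.carrier) :
    hessian Δ.guillemin x i j
      = ∑ k, (Δ.delta k x)⁻¹ * (Δ.normal k i * Δ.normal k j) := by
  have hd : ∀ k, DifferentiableAt ℝ (fun y => Real.log (Δ.delta k y) + 1) x := fun k =>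
    ((Δ.differentiableAt_delta k x).log (hx k).ne').add_const 1
  rw [hessian_apply, partialDeriv_congr_of_isOpen Δ.isOpen_carrier hx
    (fun y hy => Δ.partialDeriv_guillemin j hy),
    partialDeriv_sum (F := fun k y => Δ.normal k j * (Real.log (Δ.delta k y) + 1))
      fun k _ => (hd k).const_mul _]
  refine Finset.sum_congr rfl fun k _ => ?_
  rw [partialDeriv_const_mul _ (hd k),
    partialDeriv_comp (u := Δ.delta k) (g := fun s => Real.log s + 1)
      ((Real.hasDerivAt_log (hx k).ne').add_const 1) (Δ.differentiableAt_delta k x),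
    partialDeriv_delta]
  ring

/-- Points whose distances to the facets are bounded below. -/
def core (η : ℝ) : Set (𝔼 n) := {x | ∀ k, η ≤ Δ.delta k x}

theorem core_subset {η : ℝ} (hη : 0 < η) : Δ.core η ⊆ Δ.carrier := fun _ hx k => hη.trans_le (hx k)

theorem isCompact_core {η : ℝ} (hη : 0 < η) : IsCompact (Δ.core η) := by
  refine Δ.isCompact_closure_carrier.of_isClosed_subset ?_
    ((Δ.core_subset hη).trans subset_closure)
  have : Δ.core η = ⋂ k, {x | η ≤ Δ.delta k x} := by ext; simp [core]
  rw [this]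
  exact isClosed_iInter fun k => isClosed_le continuous_const (Δ.continuous_delta k)

theorem exists_delta_le : ∃ D : ℝ, 1 ≤ D ∧ ∀ x ∈ closure Δ.carrier, ∀ k, Δ.delta k x ≤ D := by
  choose M hM0 hM using fun k =>
    Δ.exists_bound_of_continuousOn (Δ.continuous_delta k).continuousOn
  refine ⟨1 + ∑ k, M k, ?_, fun x hx k => ?_⟩
  · have : 0 ≤ ∑ k, M k := Finset.sum_nonneg fun k _ => hM0 k
    linarith
  · have := Finset.single_le_sum (f := M) (fun i _ => hM0 i) (Finset.mem_univ k)
    linarith [hM k x hx, le_abs_self (Δ.delta k x)]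

variable {Δ} {v : (𝔼 n) → ℝ}

theorem ClassS.contDiffOn (hv : Δ.ClassS v) : ContDiffOn ℝ ∞ v Δ.carrier := by
  have h := (hv.2.2.mono subset_closure).add Δ.contDiffOn_guillemin
  refine h.congr fun x _ => ?_
  simp

theorem ClassS.partialDeriv_eq (hv : Δ.ClassS v) (i : Fin n) {x : 𝔼 n} (hx : x ∈ Δ.carrier) :
    partialDeriv i v x = ∑ k, Δ.normal k i * (Real.log (Δ.delta k x) + 1)
      + partialDeriv i (fun y => v y - Δ.guillemin y) x := by
  rw [partialDeriv_sub (ContDiffOn.differentiableAt_of_isOpen Δ.isOpen_carrier hv.contDiffOn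
    (by simp) hx) (ContDiffOn.differentiableAt_of_isOpen Δ.isOpen_carrier Δ.contDiffOn_guillemin
    (by simp) hx), Δ.partialDeriv_guillemin i hx]
  ring

theorem ClassS.hessian_eq (hv : Δ.ClassS v) (i j : Fin n) {x : 𝔼 n} (hx : x ∈ Δ.carrier) :
    hessian v x i j = ∑ k, (Δ.delta k x)⁻¹ * (Δ.normal k i * Δ.normal k j)
      + hessian (fun y => v y - Δ.guillemin y) x i j := by
  have hU := Δ.isOpen_carrier
  have h1 := contDiffOn_partialDeriv (i := j) hU hv.contDiffOn
  have h2 := contDiffOn_partialDeriv (i := j) hU Δ.contDiffOn_guillemin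
  have e : hessian (fun y => v y - Δ.guillemin y) x i j
      = hessian v x i j - hessian Δ.guillemin x i j := by
    simp only [hessian_apply]
    rw [← partialDeriv_sub (ContDiffOn.differentiableAt_of_isOpen hU h1 (by simp) hx)
      (ContDiffOn.differentiableAt_of_isOpen hU h2 (by simp) hx)]
    refine partialDeriv_congr_of_isOpen hU hx fun y hy => ?_
    exact partialDeriv_sub (ContDiffOn.differentiableAt_of_isOpen hU hv.contDiffOn (by simp) hy)
      (ContDiffOn.differentiableAt_of_isOpen hU Δ.contDiffOn_guillemin (by simp) hy)
  rw [e, Δ.hessian_guillemin i j hx]; ring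

theorem ClassS.posDef_hessian (hv : Δ.ClassS v) {x : 𝔼 n} (hx : x ∈ Δ.carrier)
    (h0 : (hessian v x).det ≠ 0) : (hessian v x).PosDef := by
  have h := ConvexOn.posSemidef_hessian (hv.2.1.subset subset_closure Δ.convex_carrier)
    Δ.isOpen_carrier hv.contDiffOn hx
  rw [h.posDef_iff_isUnit, Matrix.isUnit_iff_isUnit_det]
  exact isUnit_iff_ne_zero.2 h0

/-- `log det` of the Hessian is at most `C - ∑ log δ_k`. -/
theorem ClassS.exists_log_det_le (hv : Δ.ClassS v)
    (h0 : ∀ x ∈ Δ.carrier, (hessian v x).det ≠ 0) :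
    ∃ C : ℝ, ∀ x ∈ Δ.carrier,
      Real.log (hessian v x).det ≤ C - ∑ k, Real.log (Δ.delta k x) := by
  obtain ⟨M, -, hM⟩ := Δ.exists_bound_partialDeriv hv.2.2
  obtain ⟨C, hC⟩ := exists_det_sum_le (fun k i => Δ.normal k i) M
  obtain ⟨D, hD1, hD⟩ := Δ.exists_delta_le
  refine ⟨Real.log C + ∑ _k : Fin Δ.m, Real.log (1 + D), fun x hx => ?_⟩
  have hδ : ∀ k, 0 < Δ.delta k x := hx
  have hdet : 0 < (hessian v x).det := (hv.posDef_hessian hx (h0 x hx)).det_pos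
  -- The Hessian is the rank-one sum with weights 1/δ_k plus the bounded Hessian of the smooth part,
  -- the shape to which the determinant bound applies.
  have h1 : (hessian v x).det ≤ C * ∏ k, (1 + (Δ.delta k x)⁻¹) := by
    refine le_trans (le_of_eq ?_) (hC (fun k => (Δ.delta k x)⁻¹)
      (hessian (fun y => v y - Δ.guillemin y) x) (fun k => (inv_pos.2 (hδ k)).le) (hM x hx).2.2)
    congr 1
    ext i j
    exact hv.hessian_eq i j hx
  have hprod : 0 < ∏ k, (1 + (Δ.delta k x)⁻¹) :=
    Finset.prod_pos fun k _ => by have := inv_pos.2 (hδ k); linarith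
  have hCpos : 0 < C := pos_of_mul_pos_left (hdet.trans_le h1) hprod.le
  refine (Real.log_le_log hdet h1).trans ?_
  rw [Real.log_mul hCpos.ne' hprod.ne', Real.log_prod fun k _ => by
    have := inv_pos.2 (hδ k); positivity]
  rw [add_sub_assoc, ← Finset.sum_sub_distrib]
  refine add_le_add le_rfl (Finset.sum_le_sum fun k _ => ?_)
  rw [← Real.log_div (by positivity) (hδ k).ne']
  refine Real.log_le_log (by have := inv_pos.2 (hδ k); linarith) ?_
  rw [le_div_iff₀ (hδ k), add_mul, one_mul, inv_mul_cancel₀ (hδ k).ne', add_comm]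
  linarith [hD x (subset_closure hx) k]

/-- The Legendre-type potential `⟪x - p, ∇v⟫ - v`, shifted so that it is at least one. -/
noncomputable def potential (v : (𝔼 n) → ℝ) (p x : 𝔼 n) : ℝ :=
  ∑ i, (x i - p i) * partialDeriv i v x - v x + v p + 1

/-- The radial derivative of the potential. -/
noncomputable def potentialSlope (v : (𝔼 n) → ℝ) (p x : 𝔼 n) : ℝ :=
  ∑ j, (x j - p j) * ∑ i, hessian v x j i * (x i - p i)

theorem contDiff_coord_sub (p : 𝔼 n) (i : Fin n) {m : WithTop ℕ∞} :
    ContDiff ℝ m (fun x : 𝔼 n => x i - p i) := by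
  have : ContDiff ℝ m (fun x : 𝔼 n => x i) :=
    (EuclideanSpace.proj i : (𝔼 n) →L[ℝ] ℝ).contDiff
  exact this.sub contDiff_const

theorem ClassS.contDiffOn_potential (hv : Δ.ClassS v) (p : 𝔼 n) :
    ContDiffOn ℝ ∞ (potential v p) Δ.carrier := by
  unfold potential
  refine ((ContDiffOn.sub (ContDiffOn.sum fun i _ => ?_) hv.contDiffOn).add
    contDiffOn_const).add contDiffOn_const
  exact (contDiff_coord_sub p i).contDiffOn.mul
    (contDiffOn_partialDeriv Δ.isOpen_carrier hv.contDiffOn)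

theorem ClassS.partialDeriv_potential (hv : Δ.ClassS v) (p : 𝔼 n) {x : 𝔼 n}
    (hx : x ∈ Δ.carrier) (j : Fin n) :
    partialDeriv j (potential v p) x = ∑ i, hessian v x j i * (x i - p i) := by
  have hU := Δ.isOpen_carrier
  have hd := ContDiffOn.differentiableAt_of_isOpen hU hv.contDiffOn (by simp) hx
  have hd1 : ∀ i, DifferentiableAt ℝ (partialDeriv i v) x := fun i =>
    ContDiffOn.differentiableAt_of_isOpen hU (contDiffOn_partialDeriv hU hv.contDiffOn) (by simp) hx
  have hX : ∀ i, DifferentiableAt ℝ (fun y : 𝔼 n => y i - p i) x := fun i =>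
    hasFDerivAt_coord.differentiableAt.sub_const _
  have hs : DifferentiableAt ℝ (fun y => ∑ i, (y i - p i) * partialDeriv i v y) x :=
    DifferentiableAt.fun_sum fun i _ => (hX i).mul (hd1 i)
  unfold potential
  rw [partialDeriv_add (u := fun y => ∑ i, (y i - p i) * partialDeriv i v y - v y + v p)
      ((hs.sub hd).add_const _) (differentiableAt_const _),
    partialDeriv_add (u := fun y => ∑ i, (y i - p i) * partialDeriv i v y - v y)
      (hs.sub hd) (differentiableAt_const _), partialDeriv_sub hs hd,
    partialDeriv_sum (F := fun i (y : 𝔼 n) => (y i - p i) * partialDeriv i v y)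
      (fun i _ => (hX i).mul (hd1 i))]
  simp only [partialDeriv_mul (hX _) (hd1 _), partialDeriv_coord_sub, partialDeriv_const,
    Finset.sum_add_distrib, ite_mul, one_mul, zero_mul, Finset.sum_ite_eq', Finset.mem_univ,
    if_true]
  rw [add_sub_cancel_right, add_zero, add_zero]
  refine Finset.sum_congr rfl fun i _ => ?_
  rw [hessian_apply, mul_comm]

/-- The tangent plane of v at x, evaluated at p, lies below v(p). The lower bound 1 keeps log r
nonnegative and 1/r at most 1 in the cutoff. -/
theorem ClassS.one_le_potential (hv : Δ.ClassS v) {p x : 𝔼 n} (hp : p ∈ Δ.carrier)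
    (hx : x ∈ Δ.carrier) : 1 ≤ potential v p x := by
  have h := ConvexOn.fderiv_le_sub hv.2.1 (subset_closure hx) (subset_closure hp)
    (ContDiffOn.differentiableAt_of_isOpen Δ.isOpen_carrier hv.contDiffOn (by simp) hx)
  rw [fderiv_eq_sum_partialDeriv] at h
  have e : ∑ i, (x i - p i) * partialDeriv i v x = - ∑ i, (p - x) i * partialDeriv i v x := by
    rw [← Finset.sum_neg_distrib]
    refine Finset.sum_congr rfl fun i _ => ?_
    simp; ring
  unfold potential
  rw [e]; linarith

theorem potentialSlope_eq (hv : Δ.ClassS v) (p : 𝔼 n) {x : 𝔼 n} (hx : x ∈ Δ.carrier) :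
    potentialSlope v p x = ∑ j, (x j - p j) * partialDeriv j (potential v p) x := by
  simp only [potentialSlope, hv.partialDeriv_potential p hx]

theorem exists_coord_sub_le (Δ : Polytope n) (p : 𝔼 n) :
    ∃ ρ : ℝ, 0 ≤ ρ ∧ ∀ x ∈ closure Δ.carrier, ∀ i, |x i - p i| ≤ ρ := by
  choose M hM0 hM using fun i => Δ.exists_bound_of_continuousOn
    (contDiff_coord_sub p i (m := 0)).continuous.continuousOn
  refine ⟨∑ i, M i, Finset.sum_nonneg fun i _ => hM0 i, fun x hx i => (hM i x hx).trans ?_⟩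
  exact Finset.single_le_sum (f := M) (fun i _ => hM0 i) (Finset.mem_univ i)

/-- The potential is `-∑ c_k log δ_k` up to a bounded error. -/
theorem ClassS.exists_abs_potential_add_le (hv : Δ.ClassS v) {p : 𝔼 n} (hp : p ∈ Δ.carrier) :
    ∃ C : ℝ, 0 ≤ C ∧ ∀ x ∈ Δ.carrier,
      |potential v p x + ∑ k, Δ.delta k p * Real.log (Δ.delta k x)| ≤ C := by
  obtain ⟨M, hM0, hM⟩ := Δ.exists_bound_partialDeriv hv.2.2
  obtain ⟨D, hD1, hD⟩ := Δ.exists_delta_le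
  obtain ⟨ρ, hρ0, hρ⟩ := exists_coord_sub_le Δ p
  refine ⟨∑ _k : Fin Δ.m, (D + D) + ∑ _i : Fin n, ρ * M + M + (|v p| + 1), ?_, fun x hx => ?_⟩
  · have : 0 ≤ ∑ _k : Fin Δ.m, (D + D) := Finset.sum_nonneg fun _ _ => by linarith
    have : 0 ≤ ∑ _i : Fin n, ρ * M := Finset.sum_nonneg fun _ _ => by positivity
    positivity
  set f := fun y => v y - Δ.guillemin y with hf
  -- The radial derivative of ∑ δ_k log δ_k contributes (δ_k(x) - δ_k(p)) log δ_k(x); its first part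
  -- cancels against v, leaving only the logarithms with constant coefficients.
  have e : potential v p x + ∑ k, Δ.delta k p * Real.log (Δ.delta k x)
      = ∑ k, (Δ.delta k x - Δ.delta k p) + ∑ i, (x i - p i) * partialDeriv i f x - f x
        + (v p + 1) := by
    have h1 : ∑ i, (x i - p i) * partialDeriv i v x
        = ∑ k, (Δ.delta k x - Δ.delta k p) * (Real.log (Δ.delta k x) + 1)
          + ∑ i, (x i - p i) * partialDeriv i f x := by
      simp only [hv.partialDeriv_eq _ hx, mul_add, Finset.sum_add_distrib, ← hf,
        Finset.mul_sum, mul_one]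
      rw [Finset.sum_comm, Finset.sum_comm (f := fun i k => (x i - p i) * Δ.normal k i)]
      simp only [sum_coord_mul_normal, ← mul_assoc, ← Finset.sum_mul]
    have h2 : v x = f x + ∑ k, Δ.delta k x * Real.log (Δ.delta k x) := by
      simp [hf, guillemin]
    unfold potential
    rw [h1, h2]
    have h3 : ∑ k, (Δ.delta k x - Δ.delta k p) * (Real.log (Δ.delta k x) + 1)
        = ∑ k, Δ.delta k x * Real.log (Δ.delta k x) - ∑ k, Δ.delta k p * Real.log (Δ.delta k x)
          + ∑ k, (Δ.delta k x - Δ.delta k p) := by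
      rw [← Finset.sum_sub_distrib, ← Finset.sum_add_distrib]
      exact Finset.sum_congr rfl fun k _ => by ring
    rw [h3]; ring
  rw [e]
  have b1 : |∑ k, (Δ.delta k x - Δ.delta k p)| ≤ ∑ _k : Fin Δ.m, (D + D) := by
    refine (Finset.abs_sum_le_sum_abs _ _).trans (Finset.sum_le_sum fun k _ => ?_)
    have h1 := hD x (subset_closure hx) k
    have h2 := hD p (subset_closure hp) k
    have h3 := hx k
    have h4 := hp k
    rw [abs_le]; constructor <;> linarith
  have b2 : |∑ i, (x i - p i) * partialDeriv i f x| ≤ ∑ _i : Fin n, ρ * M := by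
    refine (Finset.abs_sum_le_sum_abs _ _).trans (Finset.sum_le_sum fun i _ => ?_)
    rw [abs_mul]
    exact mul_le_mul (hρ x (subset_closure hx) i) ((hM x hx).2.1 i) (abs_nonneg _) hρ0
  have b3 : |f x| ≤ M := (hM x hx).1
  have b4 : |v p + 1| ≤ |v p| + 1 := (abs_add_le _ _).trans (by simp)
  calc _ ≤ |∑ k, (Δ.delta k x - Δ.delta k p)| + |∑ i, (x i - p i) * partialDeriv i f x| + |f x|
        + |v p + 1| :=
        (abs_add_le _ _).trans (add_le_add ((abs_sub _ _).trans
          (add_le_add (abs_add_le _ _) le_rfl)) le_rfl)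
    _ ≤ _ := by linarith

/-- The logarithms of the other δ_l are bounded above by log D, so discarding them costs a constant.
This isolates a single facet in the potential. -/
theorem ClassS.exists_neg_log_le_potential (hv : Δ.ClassS v) {p : 𝔼 n} (hp : p ∈ Δ.carrier) :
    ∃ C : ℝ, 0 ≤ C ∧ ∀ x ∈ Δ.carrier, ∀ k,
      - (Δ.delta k p * Real.log (Δ.delta k x)) ≤ potential v p x + C := by
  obtain ⟨C, hC0, hC⟩ := hv.exists_abs_potential_add_le hp
  obtain ⟨D, hD1, hD⟩ := Δ.exists_delta_le
  have hpk : ∀ k, 0 < Δ.delta k p := hp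
  have hlogD : 0 ≤ Real.log D := Real.log_nonneg hD1
  refine ⟨C + ∑ k, Δ.delta k p * Real.log D, add_nonneg hC0 (Finset.sum_nonneg fun k _ =>
    mul_nonneg (hpk k).le hlogD), fun x hx k => ?_⟩
  have h1 := (abs_le.1 (hC x hx)).1
  have h2 : ∀ l, Δ.delta l p * Real.log (Δ.delta l x) ≤ Δ.delta l p * Real.log D := fun l =>
    mul_le_mul_of_nonneg_left (Real.log_le_log (hx l) (hD x (subset_closure hx) l)) (hpk l).le
  have h3 : ∑ l ∈ Finset.univ.erase k, Δ.delta l p * Real.log (Δ.delta l x)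
      ≤ ∑ l, Δ.delta l p * Real.log D :=
    (Finset.sum_le_sum fun l _ => h2 l).trans (Finset.sum_le_sum_of_subset_of_nonneg
      (Finset.erase_subset _ _) fun l _ _ => mul_nonneg (hpk l).le hlogD)
  have h4 := Finset.add_sum_erase Finset.univ (fun l => Δ.delta l p * Real.log (Δ.delta l x))
    (Finset.mem_univ k)
  linarith

theorem exists_le_finite {ι : Type*} [Finite ι] (c : ι → ℝ) (hc : ∀ k, 0 < c k) :
    ∃ ε > 0, ∀ k, ε ≤ c k := by
  by_cases hm : Nonempty ι
  · obtain ⟨k, hk⟩ := Finite.exists_min c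
    exact ⟨c k, hc k, hk⟩
  · exact ⟨1, one_pos, fun k => absurd ⟨k⟩ hm⟩

theorem ClassS.exists_mem_core (hv : Δ.ClassS v) {p : 𝔼 n} (hp : p ∈ Δ.carrier) (R : ℝ) :
    ∃ η > 0, ∀ x ∈ Δ.carrier, potential v p x ≤ R → x ∈ Δ.core η := by
  obtain ⟨C, hC0, hC⟩ := hv.exists_neg_log_le_potential hp
  have hpk : ∀ k, 0 < Δ.delta k p := hp
  obtain ⟨η, hη0, hη⟩ := exists_le_finite (fun k => Real.exp (-(R + C) / Δ.delta k p))
    fun k => Real.exp_pos _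
  refine ⟨η, hη0, fun x hx hR k => (hη k).trans ?_⟩
  rw [← Real.le_log_iff_exp_le (hx k), div_le_iff₀ (hpk k)]
  have := hC x hx k
  linarith

/-- The singular part of H applied twice to x - p is ∑ (δ_k(x) - δ_k(p))²/δ_k(x), whose leading term
is δ_k(p)²/δ_k(x); the smooth part of the Hessian contributes a bounded error. -/
theorem ClassS.exists_le_potentialSlope (hv : Δ.ClassS v) {p : 𝔼 n} (hp : p ∈ Δ.carrier) :
    ∃ C : ℝ, 0 ≤ C ∧ ∀ x ∈ Δ.carrier,
      ∑ k, Δ.delta k p ^ 2 * (Δ.delta k x)⁻¹ - C ≤ potentialSlope v p x := by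
  obtain ⟨M, hM0, hM⟩ := Δ.exists_bound_partialDeriv hv.2.2
  obtain ⟨ρ, hρ0, hρ⟩ := exists_coord_sub_le Δ p
  have hpk : ∀ k, 0 < Δ.delta k p := hp
  refine ⟨∑ k, 2 * Δ.delta k p + ∑ _j : Fin n, ρ * ∑ _i : Fin n, M * ρ, ?_, fun x hx => ?_⟩
  · have : 0 ≤ ∑ k, 2 * Δ.delta k p := Finset.sum_nonneg fun k _ => by linarith [hpk k]
    positivity
  set f := fun y => v y - Δ.guillemin y with hf
  have e : potentialSlope v p x = ∑ k, (Δ.delta k x)⁻¹ * (Δ.delta k x - Δ.delta k p) ^ 2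
      + ∑ j, (x j - p j) * ∑ i, hessian f x j i * (x i - p i) := by
    unfold potentialSlope
    simp only [hv.hessian_eq _ _ hx, add_mul, Finset.sum_add_distrib, mul_add, ← hf]
    congr 1
    have h1 : ∀ j, ∑ i, (∑ k, (Δ.delta k x)⁻¹ * (Δ.normal k j * Δ.normal k i)) * (x i - p i)
        = ∑ k, (Δ.delta k x)⁻¹ * Δ.normal k j * (Δ.delta k x - Δ.delta k p) := by
      intro j
      simp only [Finset.sum_mul]
      rw [Finset.sum_comm]
      refine Finset.sum_congr rfl fun k _ => ?_
      rw [← sum_coord_mul_normal, Finset.mul_sum]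
      exact Finset.sum_congr rfl fun i _ => by ring
    simp only [h1, Finset.mul_sum]
    rw [Finset.sum_comm]
    refine Finset.sum_congr rfl fun k _ => ?_
    have h2 : (Δ.delta k x)⁻¹ * (Δ.delta k x - Δ.delta k p) ^ 2
        = ∑ j, (Δ.delta k x)⁻¹ * (Δ.delta k x - Δ.delta k p) *
          ((x j - p j) * Δ.normal k j) := by
      rw [← Finset.mul_sum, sum_coord_mul_normal]; ring
    rw [h2]
    exact Finset.sum_congr rfl fun j _ => by ring
  have b2 : |∑ j, (x j - p j) * ∑ i, hessian f x j i * (x i - p i)|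
      ≤ ∑ _j : Fin n, ρ * ∑ _i : Fin n, M * ρ := by
    refine (Finset.abs_sum_le_sum_abs _ _).trans (Finset.sum_le_sum fun j _ => ?_)
    rw [abs_mul]
    refine mul_le_mul (hρ x (subset_closure hx) j) ?_ (abs_nonneg _) hρ0
    refine (Finset.abs_sum_le_sum_abs _ _).trans (Finset.sum_le_sum fun i _ => ?_)
    rw [abs_mul]
    exact mul_le_mul ((hM x hx).2.2 j i) (hρ x (subset_closure hx) i) (abs_nonneg _) hM0
  have b1 : ∑ k, Δ.delta k p ^ 2 * (Δ.delta k x)⁻¹ - ∑ k, 2 * Δ.delta k p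
      ≤ ∑ k, (Δ.delta k x)⁻¹ * (Δ.delta k x - Δ.delta k p) ^ 2 := by
    rw [← Finset.sum_sub_distrib]
    refine Finset.sum_le_sum fun k _ => ?_
    have hk := hx k
    have : (Δ.delta k x)⁻¹ * (Δ.delta k x - Δ.delta k p) ^ 2
        = Δ.delta k x - 2 * Δ.delta k p + Δ.delta k p ^ 2 * (Δ.delta k x)⁻¹ := by
      field_simp; ring
    rw [this]; linarith
  rw [e]
  have := (abs_le.1 b2).1
  linarith

/-- Near the boundary the radial derivative of the potential beats any multiple of its square. -/
theorem ClassS.exists_mul_sq_le_potentialSlope (hv : Δ.ClassS v) {p : 𝔼 n}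
    (hp : p ∈ Δ.carrier) {K : ℝ} (hK : 0 ≤ K) :
    ∃ R₀ : ℝ, ∀ x ∈ Δ.carrier, R₀ ≤ potential v p x →
      K * potential v p x ^ 2 ≤ potentialSlope v p x := by
  obtain ⟨C0, hC00, hC0⟩ := hv.exists_abs_potential_add_le hp
  obtain ⟨C2, hC20, hC2⟩ := hv.exists_le_potentialSlope hp
  have hpk : ∀ k, 0 < Δ.delta k p := hp
  obtain ⟨ε, hε0, hε⟩ := exists_le_finite _ hpk
  set B : ℝ := ∑ k, Δ.delta k p with hB
  have hB0 : 0 ≤ B := Finset.sum_nonneg fun k _ => (hpk k).le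
  set Q : ℝ := ε ^ 2 + C2 + K * (C0 + B) ^ 2 with hQ
  have hQ0 : 0 ≤ Q := by positivity
  set Y : ℝ := max 1 (6 * Q / ε ^ 2) with hY
  refine ⟨C0 + B * Y + 1, fun x hx hr => ?_⟩
  set r := potential v p x with hr'
  have hr1 : 1 ≤ r := hv.one_le_potential hp hx
  set S : ℝ := ∑ k, (Δ.delta k x)⁻¹ with hS
  have hinv : ∀ k, 0 < (Δ.delta k x)⁻¹ := fun k => inv_pos.2 (hx k)
  have hS0 : 0 ≤ S := Finset.sum_nonneg fun k _ => (hinv k).le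
  -- With S = ∑ 1/δ_k, the potential is at most linear in y = log(1 + S), while the slope is at
  -- least linear in S = exp y - 1. The cubic term of the exponential already beats any multiple of
  -- y².
  set y : ℝ := Real.log (1 + S) with hy
  have hexp : Real.exp y = 1 + S := Real.exp_log (by linarith)
  have hry : r ≤ C0 + B * y := by
    have h1 := (abs_le.1 (hC0 x hx)).2
    have h2 : -∑ k, Δ.delta k p * Real.log (Δ.delta k x) ≤ B * y := by
      rw [hB, Finset.sum_mul, ← Finset.sum_neg_distrib]
      refine Finset.sum_le_sum fun k _ => ?_
      rw [← mul_neg, ← Real.log_inv]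
      refine mul_le_mul_of_nonneg_left (Real.log_le_log (hinv k) ?_) (hpk k).le
      have := Finset.single_le_sum (f := fun k => (Δ.delta k x)⁻¹) (fun l _ => (hinv l).le)
        (Finset.mem_univ k)
      linarith
    linarith
  -- The threshold R₀ was chosen so that a large potential forces y ≥ Y. The factor 6 in Y is the 3!
  -- of the cubic term.
  have hyY : Y ≤ y := by
    by_contra hcon
    push Not at hcon
    have := mul_le_mul_of_nonneg_left hcon.le hB0
    linarith
  have hy1 : 1 ≤ y := (le_max_left _ _).trans hyY
  have hy2 : 6 * Q ≤ ε ^ 2 * y := by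
    have := (le_max_right 1 (6 * Q / ε ^ 2)).trans hyY
    rw [div_le_iff₀ (by positivity)] at this
    linarith
  have hslope : ε ^ 2 * S - C2 ≤ potentialSlope v p x := by
    refine le_trans ?_ (hC2 x hx)
    rw [hS, Finset.mul_sum]
    refine sub_le_sub_right (Finset.sum_le_sum fun k _ => ?_) _
    exact mul_le_mul_of_nonneg_right (pow_le_pow_left₀ hε0.le (hε k) 2) (hinv k).le
  have hcube : y ^ 3 / 6 ≤ 1 + S := by
    rw [← hexp]
    have := Real.pow_div_factorial_le_exp y (by linarith) 3
    norm_num [Nat.factorial] at this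
    exact this
  have hr2 : K * r ^ 2 ≤ K * (C0 + B) ^ 2 * y ^ 2 := by
    rw [mul_assoc, ← mul_pow]
    refine mul_le_mul_of_nonneg_left (pow_le_pow_left₀ (by linarith) (hry.trans ?_) 2) hK
    nlinarith
  have h6 : Q * y ^ 2 ≤ ε ^ 2 * (y ^ 3 / 6) := by nlinarith [sq_nonneg y]
  have h7 : ε ^ 2 * (y ^ 3 / 6) ≤ ε ^ 2 * (1 + S) :=
    mul_le_mul_of_nonneg_left hcube (by positivity)
  have h8 : (ε ^ 2 + C2) ≤ (ε ^ 2 + C2) * y ^ 2 := by nlinarith [sq_nonneg ε]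
  have h9 : Q * y ^ 2 = (ε ^ 2 + C2) * y ^ 2 + K * (C0 + B) ^ 2 * y ^ 2 := by rw [hQ]; ring
  linarith

end Polytope

/-! ### The one-variable cutoff. -/

section Cutoff

/-- The exponent k + 2 makes the truncated power C¹; at the kink the derivative is the limit of the
derivatives nearby. -/
theorem hasDerivAt_max_zero_pow (k : ℕ) (t : ℝ) :
    HasDerivAt (fun s : ℝ => max s 0 ^ (k + 2)) ((k + 2) * max t 0 ^ (k + 1)) t := by
  have hne : ∀ s : ℝ, s ≠ 0 →
      HasDerivAt (fun s : ℝ => max s 0 ^ (k + 2)) ((k + 2) * max s 0 ^ (k + 1)) s := by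
    intro s hs
    rcases lt_or_gt_of_ne hs with h | h
    · rw [max_eq_right h.le, zero_pow (by omega), mul_zero]
      refine (hasDerivAt_const s (0 : ℝ)).congr_of_eventuallyEq ?_
      filter_upwards [Iio_mem_nhds h] with y hy
      rw [max_eq_right (le_of_lt hy), zero_pow (by omega)]
    · rw [max_eq_left h.le]
      have := hasDerivAt_pow (k + 2) s
      refine HasDerivAt.congr_of_eventuallyEq (f := fun y : ℝ => y ^ (k + 2)) ?_ ?_
      · simpa using this
      · filter_upwards [Ioi_mem_nhds h] with y hy
        rw [max_eq_left (le_of_lt hy)]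
  by_cases ht : t = 0
  · subst ht
    refine hasDerivAt_of_hasDerivAt_of_ne (g := fun s => ((k : ℝ) + 2) * max s 0 ^ (k + 1))
      (fun y hy => hne y hy) ?_ ?_ <;> fun_prop
  · exact hne t ht

theorem contDiff_max_zero_pow (k : ℕ) : ContDiff ℝ 1 (fun s : ℝ => max s 0 ^ (k + 2)) := by
  rw [contDiff_one_iff_deriv]
  refine ⟨fun t => (hasDerivAt_max_zero_pow k t).differentiableAt, ?_⟩
  have : deriv (fun s : ℝ => max s 0 ^ (k + 2)) = fun t : ℝ => ((k : ℝ) + 2) * max t 0 ^ (k + 1) :=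
    funext fun t => (hasDerivAt_max_zero_pow k t).deriv
  rw [this]; fun_prop

/-- The profile `1 - (r + log r) / R` entering the cutoff. -/
noncomputable def cutProfile (R r : ℝ) : ℝ := 1 - (r + Real.log r) / R

/-- A convex decreasing cutoff with compact support. -/
noncomputable def cut (R r : ℝ) : ℝ := max (cutProfile R r) 0 ^ 3

/-- Minus the derivative of `cut`. -/
noncomputable def cutSlope (R r : ℝ) : ℝ := 3 / R * max (cutProfile R r) 0 ^ 2 * (1 + r⁻¹)

/-- The derivative of `cutSlope`. -/
noncomputable def cutSlopeDeriv (R r : ℝ) : ℝ :=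
  -(6 / R ^ 2 * max (cutProfile R r) 0 * (1 + r⁻¹) ^ 2
    + 3 / R * max (cutProfile R r) 0 ^ 2 * (r ^ 2)⁻¹)

variable {R r : ℝ}

theorem hasDerivAt_cutProfile (hr : 0 < r) :
    HasDerivAt (cutProfile R) (-((1 + r⁻¹) / R)) r := by
  unfold cutProfile
  exact (((hasDerivAt_id r).add (Real.hasDerivAt_log hr.ne')).div_const R).const_sub 1

theorem hasDerivAt_cut (hr : 0 < r) : HasDerivAt (cut R) (-cutSlope R r) r := by
  have h := (hasDerivAt_max_zero_pow 1 (cutProfile R r)).comp r (hasDerivAt_cutProfile (R := R) hr)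
  refine h.congr_deriv ?_
  unfold cutSlope
  norm_num
  ring

theorem hasDerivAt_cutSlope (hr : 0 < r) :
    HasDerivAt (cutSlope R) (cutSlopeDeriv R r) r := by
  have h := (hasDerivAt_max_zero_pow 0 (cutProfile R r)).comp r (hasDerivAt_cutProfile (R := R) hr)
  have h2 := (h.const_mul (3 / R)).mul ((hasDerivAt_inv hr.ne').const_add 1)
  refine h2.congr_deriv ?_
  unfold cutSlopeDeriv
  simp only [Function.comp]
  norm_num
  ring

theorem contDiffOn_cutProfile : ContDiffOn ℝ 1 (cutProfile R) (Ioi 0) := by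
  unfold cutProfile
  exact contDiffOn_const.sub ((contDiffOn_id.add
    (Real.contDiffOn_log.mono fun x hx => (ne_of_gt hx))).div_const R)

theorem contDiffOn_cut : ContDiffOn ℝ 1 (cut R) (Ioi 0) :=
  (contDiff_max_zero_pow 1).comp_contDiffOn contDiffOn_cutProfile

/-- The cube in `cut` is there for this: the slope is itself integrated by parts, so it must still
be C¹. -/
theorem contDiffOn_cutSlope : ContDiffOn ℝ 1 (cutSlope R) (Ioi 0) :=
  (contDiffOn_const.mul ((contDiff_max_zero_pow 0).comp_contDiffOn contDiffOn_cutProfile)).mul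
    (contDiffOn_const.add (contDiffOn_inv ℝ |>.mono fun _ hx => ne_of_gt hx))

theorem max_cutProfile_le_one (hR : 0 < R) (hr : 1 ≤ r) : max (cutProfile R r) 0 ≤ 1 := by
  refine max_le ?_ zero_le_one
  have h1 := Real.log_nonneg hr
  unfold cutProfile
  have : 0 ≤ (r + Real.log r) / R := by positivity
  linarith

theorem max_cutProfile_eq_zero (hR : 0 < R) (hr1 : 1 ≤ r) (hr : R ≤ r) :
    max (cutProfile R r) 0 = 0 := by
  refine max_eq_right ?_
  have h1 := Real.log_nonneg hr1
  unfold cutProfile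
  rw [sub_nonpos, one_le_div hR]
  linarith

theorem cut_nonneg : 0 ≤ cut R r := by unfold cut; positivity

theorem cut_le_one (hR : 0 < R) (hr : 1 ≤ r) : cut R r ≤ 1 :=
  pow_le_one₀ (le_max_right _ _) (max_cutProfile_le_one hR hr)

theorem cut_eq_zero (hR : 0 < R) (hr1 : 1 ≤ r) (hr : R ≤ r) : cut R r = 0 := by
  unfold cut; rw [max_cutProfile_eq_zero hR hr1 hr]; norm_num

theorem cutSlope_eq_zero (hR : 0 < R) (hr1 : 1 ≤ r) (hr : R ≤ r) : cutSlope R r = 0 := by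
  unfold cutSlope; rw [max_cutProfile_eq_zero hR hr1 hr]; norm_num

theorem cutSlopeDeriv_eq_zero (hR : 0 < R) (hr1 : 1 ≤ r) (hr : R ≤ r) :
    cutSlopeDeriv R r = 0 := by
  unfold cutSlopeDeriv; rw [max_cutProfile_eq_zero hR hr1 hr]; norm_num

theorem cutSlope_nonneg (hR : 0 < R) (hr : 1 ≤ r) : 0 ≤ cutSlope R r := by
  unfold cutSlope
  have : 0 < r := by linarith
  positivity

theorem one_add_inv_le (hr : 1 ≤ r) : 1 + r⁻¹ ≤ 2 := by
  have := inv_le_one_of_one_le₀ hr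
  linarith

theorem cutSlope_le (hR : 0 < R) (hr : 1 ≤ r) : cutSlope R r ≤ 6 / R := by
  unfold cutSlope
  have h1 := max_cutProfile_le_one hR hr
  have h0 : 0 ≤ max (cutProfile R r) 0 := le_max_right _ _
  have h2 : max (cutProfile R r) 0 ^ 2 ≤ 1 := pow_le_one₀ h0 h1
  have h3 := one_add_inv_le hr
  calc 3 / R * max (cutProfile R r) 0 ^ 2 * (1 + r⁻¹) ≤ 3 / R * 1 * 2 := by gcongr
    _ = 6 / R := by ring

theorem abs_cutSlopeDeriv_le (hR : 1 ≤ R) (hr : 1 ≤ r) : |cutSlopeDeriv R r| ≤ 27 / R := by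
  have hR0 : 0 < R := by linarith
  have hr0 : 0 < r := by linarith
  have h1 := max_cutProfile_le_one hR0 hr
  have h0 : 0 ≤ max (cutProfile R r) 0 := le_max_right _ _
  have h2 : max (cutProfile R r) 0 ^ 2 ≤ 1 := pow_le_one₀ h0 h1
  have h3 := one_add_inv_le hr
  have h4 : (r ^ 2)⁻¹ ≤ 1 := inv_le_one_of_one_le₀ (one_le_pow₀ hr)
  unfold cutSlopeDeriv
  rw [abs_neg, abs_of_nonneg (by positivity)]
  have h5 : 6 / R ^ 2 ≤ 6 / R := by
    gcongr
    nlinarith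
  calc _ ≤ 6 / R * 1 * 2 ^ 2 + 3 / R * 1 * 1 := by gcongr
    _ = 27 / R := by ring

/-- This is the purpose of the logarithm in the profile: differentiating the factor 1 + 1/r makes
the slope decrease at relative rate at least 1/(2r²), uniformly in R. -/
theorem cutSlopeDeriv_le (hR : 0 < R) (hr : 1 ≤ r) :
    cutSlopeDeriv R r ≤ -(cutSlope R r / (2 * r ^ 2)) := by
  have hr0 : 0 < r := by linarith
  have h0 : 0 ≤ max (cutProfile R r) 0 := le_max_right _ _
  have h3 := one_add_inv_le hr
  unfold cutSlopeDeriv cutSlope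
  rw [neg_le_neg_iff]
  have h1 : 3 / R * max (cutProfile R r) 0 ^ 2 * (1 + r⁻¹) / (2 * r ^ 2)
      ≤ 3 / R * max (cutProfile R r) 0 ^ 2 * (r ^ 2)⁻¹ := by
    have : 3 / R * max (cutProfile R r) 0 ^ 2 * (1 + r⁻¹) / (2 * r ^ 2)
        = 3 / R * max (cutProfile R r) 0 ^ 2 * (r ^ 2)⁻¹ * ((1 + r⁻¹) / 2) := by
      field_simp
    rw [this]
    exact mul_le_of_le_one_right (by positivity) (by linarith)
  have h2 : 0 ≤ 6 / R ^ 2 * max (cutProfile R r) 0 * (1 + r⁻¹) ^ 2 := by positivity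
  linarith

/-- Monotonicity allows the potential inside the slope to be replaced by its lower bound in terms of
one δ_k. -/
theorem cutSlope_anti (hR : 0 < R) {s : ℝ} (hr : 1 ≤ r) (hrs : r ≤ s) :
    cutSlope R s ≤ cutSlope R r := by
  have hr0 : 0 < r := by linarith
  have hs0 : 0 < s := by linarith
  have h1 : cutProfile R s ≤ cutProfile R r := by
    unfold cutProfile
    have := Real.log_le_log hr0 hrs
    gcongr
  unfold cutSlope
  have h2 : max (cutProfile R s) 0 ≤ max (cutProfile R r) 0 := max_le_max h1 le_rfl
  gcongr

theorem tendsto_cut (r : ℝ) : Tendsto (fun R => cut R r) atTop (𝓝 1) := by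
  have h1 : Tendsto (fun R => cutProfile R r) atTop (𝓝 1) := by
    have := (tendsto_const_nhds (x := r + Real.log r)).div_atTop tendsto_id (l := atTop)
    simpa [cutProfile] using this.const_sub 1
  have h2 := (h1.max (tendsto_const_nhds (x := (0 : ℝ)))).pow 3
  simpa [cut] using h2

/-- Total mass of the boundary kernel. -/
theorem lintegral_cutSlope_le (hR : 1 ≤ R) {c C t₀ : ℝ} (hc : 0 < c) (ht₀ : 0 < t₀)
    (h1 : ∀ t, 0 < t → t ≤ t₀ → 1 ≤ -(c * Real.log (c * t)) - C) :
    ∫⁻ t in Ioo 0 t₀, ENNReal.ofReal (c * (cutSlope R (-(c * Real.log (c * t)) - C) * t⁻¹))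
      ≤ 1 := by
  have hR0 : 0 < R := by linarith
  set ρ : ℝ → ℝ := fun t => -(c * Real.log (c * t)) - C with hρ
  have hρd : ∀ t, 0 < t → HasDerivAt ρ (-(c * t⁻¹)) t := by
    intro t ht
    have h := (((Real.hasDerivAt_log (mul_pos hc ht).ne').comp t
      ((hasDerivAt_id t).const_mul c)).const_mul c).neg.sub_const C
    refine h.congr_deriv ?_
    field_simp
  set a : ℝ := min t₀ (Real.exp (-(R + C) / c) / c) with ha
  have ha0 : 0 < a := lt_min ht₀ (by positivity)
  have hat : a ≤ t₀ := min_le_left _ _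
  have hρa : ∀ t, 0 < t → t ≤ a → R ≤ ρ t := by
    intro t ht hta
    have h2 : c * t ≤ Real.exp (-(R + C) / c) := by
      have := hta.trans (min_le_right _ _)
      rwa [le_div_iff₀ hc, mul_comm] at this
    have h3 := (Real.log_le_iff_le_exp (mul_pos hc ht)).2 h2
    rw [le_div_iff₀ hc] at h3
    simp only [hρ]
    linarith
  set F : ℝ → ℝ := fun t => c * (cutSlope R (ρ t) * t⁻¹) with hF
  have hFnn : ∀ t, 0 < t → t ≤ t₀ → 0 ≤ F t := fun t ht htt =>
    mul_nonneg hc.le (mul_nonneg (cutSlope_nonneg hR0 (h1 t ht htt)) (inv_pos.2 ht).le)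
  have hderiv : ∀ t ∈ uIcc a t₀, HasDerivAt (fun s => cut R (ρ s)) (F t) t := by
    intro t ht
    rw [uIcc_of_le hat] at ht
    have ht0 : 0 < t := ha0.trans_le ht.1
    have h := (hasDerivAt_cut (R := R) (zero_lt_one.trans_le (h1 t ht0 ht.2))).comp t (hρd t ht0)
    refine h.congr_deriv ?_
    simp only [hF, hρ]; ring
  have hFc : ContinuousOn F (uIcc a t₀) := by
    rw [uIcc_of_le hat]
    have hρc : ContinuousOn ρ (Icc a t₀) := fun t ht =>
      (hρd t (ha0.trans_le ht.1)).continuousAt.continuousWithinAt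
    refine continuousOn_const.mul (ContinuousOn.mul ?_ ?_)
    · exact contDiffOn_cutSlope.continuousOn.comp hρc fun t ht =>
        zero_lt_one.trans_le (h1 t (ha0.trans_le ht.1) ht.2)
    · exact continuousOn_inv₀.mono fun t ht => (ha0.trans_le ht.1).ne'
  have hint := intervalIntegral.integral_eq_sub_of_hasDerivAt hderiv hFc.intervalIntegrable
  have hsub : Ioo 0 t₀ ⊆ Ioc 0 a ∪ Ioc a t₀ := by
    intro t ht
    rcases le_or_gt t a with h | h
    · exact Or.inl ⟨ht.1, h⟩
    · exact Or.inr ⟨h, ht.2.le⟩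
  refine (lintegral_mono_set hsub).trans ((lintegral_union_le _ _ _).trans ?_)
  have hz : ∫⁻ t in Ioc 0 a, ENNReal.ofReal (F t) = 0 := by
    rw [setLIntegral_congr_fun (g := fun _ => 0) measurableSet_Ioc]
    · simp
    · intro t ht
      simp only [hF]
      rw [cutSlope_eq_zero hR0 (h1 t ht.1 (ht.2.trans hat)) (hρa t ht.1 ht.2)]
      simp
  rw [hz, zero_add]
  have hFi : IntegrableOn F (Ioc a t₀) :=
    (intervalIntegrable_iff_integrableOn_Ioc_of_le hat).1 hFc.intervalIntegrable
  rw [← ofReal_integral_eq_lintegral_ofReal hFi, ← intervalIntegral.integral_of_le hat, hint,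
    ← ENNReal.ofReal_one]
  · refine ENNReal.ofReal_le_ofReal ?_
    have := cut_le_one hR0 (h1 t₀ ht₀ le_rfl)
    have := cut_nonneg (R := R) (r := ρ a)
    linarith
  · refine (ae_restrict_iff' measurableSet_Ioc).2 (Eventually.of_forall fun t ht => ?_)
    exact hFnn t (ha0.trans ht.1) ht.2

end Cutoff

/-! ### The Abreu equation tested against a cutoff of the potential. -/

namespace Polytope

variable {n : ℕ} {Δ : Polytope n} {v A u : (𝔼 n) → ℝ} {p : 𝔼 n}

/-- The radial derivative about `p`. -/
noncomputable def radial (p : 𝔼 n) (u : (𝔼 n) → ℝ) (x : 𝔼 n) : ℝ :=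
  ∑ i, (x i - p i) * partialDeriv i u x

/-- The pairing `∑ v^{ij} u_{ij}`. -/
noncomputable def hessPair (v u : (𝔼 n) → ℝ) (x : 𝔼 n) : ℝ :=
  ∑ i, ∑ j, (hessian v x)⁻¹ i j * hessian u x i j

theorem continuousOn_radial (hu : ContDiffOn ℝ 1 u Δ.carrier) :
    ContinuousOn (radial p u) Δ.carrier := by
  unfold radial
  exact continuousOn_finsetSum _ fun i _ =>
    ((contDiff_coord_sub p i (m := 0)).continuous.continuousOn).mul
      (continuousOn_partialDeriv Δ.isOpen_carrier hu)

theorem ClassS.contDiffOn_inv (hv : Δ.ClassS v) (h0 : ∀ x ∈ Δ.carrier, (hessian v x).det ≠ 0)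
    (i j : Fin n) : ContDiffOn ℝ ∞ (fun y => (hessian v y)⁻¹ i j) Δ.carrier :=
  contDiffOn_inv_apply (fun _ _ => contDiffOn_hessian Δ.isOpen_carrier hv.contDiffOn) h0 i j

theorem ClassS.continuousOn_hessPair (hv : Δ.ClassS v)
    (h0 : ∀ x ∈ Δ.carrier, (hessian v x).det ≠ 0) (hu : ContDiffOn ℝ ∞ u Δ.carrier) :
    ContinuousOn (hessPair v u) Δ.carrier := by
  unfold hessPair
  exact continuousOn_finsetSum _ fun i _ => continuousOn_finsetSum _ fun j _ =>
    (hv.contDiffOn_inv h0 i j).continuousOn.mul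
      (contDiffOn_hessian Δ.isOpen_carrier hu).continuousOn

theorem ClassS.inv_hessian_comm (hv : Δ.ClassS v) {x : 𝔼 n} (hx : x ∈ Δ.carrier) (i j : Fin n) :
    (hessian v x)⁻¹ i j = (hessian v x)⁻¹ j i := by
  have h : (hessian v x).transpose = hessian v x := by
    ext a b; exact hessian_comm Δ.isOpen_carrier hv.contDiffOn hx
  have h2 := congrFun (congrFun (Matrix.transpose_nonsing_inv (hessian v x)) i) j
  rw [h, Matrix.transpose_apply] at h2
  exact h2.symm

/-- The divergence of the inverse Hessian. -/
noncomputable def invDiv (v : (𝔼 n) → ℝ) (i : Fin n) (x : 𝔼 n) : ℝ :=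
  ∑ j, partialDeriv j (fun y => (hessian v y)⁻¹ i j) x

theorem ClassS.contDiffOn_invDiv (hv : Δ.ClassS v)
    (h0 : ∀ x ∈ Δ.carrier, (hessian v x).det ≠ 0) (i : Fin n) :
    ContDiffOn ℝ ∞ (invDiv v i) Δ.carrier := by
  unfold invDiv
  exact ContDiffOn.sum fun j _ =>
    contDiffOn_partialDeriv Δ.isOpen_carrier (hv.contDiffOn_inv h0 i j)

theorem ClassS.sum_partialDeriv_invDiv (hv : Δ.ClassS v) (hA : SolvesAbreu Δ A v) {x : 𝔼 n}
    (hx : x ∈ Δ.carrier) : ∑ i, partialDeriv i (invDiv v i) x = - A x := by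
  have h0 := fun x hx => (hA x hx).1
  rw [← (hA x hx).2]
  refine Finset.sum_congr rfl fun i _ => ?_
  unfold invDiv
  exact partialDeriv_sum (F := fun j => partialDeriv j (fun y => (hessian v y)⁻¹ i j)) fun j _ =>
    ContDiffOn.differentiableAt_of_isOpen Δ.isOpen_carrier
      (contDiffOn_partialDeriv Δ.isOpen_carrier (hv.contDiffOn_inv h0 i j)) (by simp) hx

/-- Contracting the divergence of the inverse Hessian with the Hessian gives minus the gradient of
`log det`. -/
theorem ClassS.sum_invDiv_mul_hessian (hv : Δ.ClassS v)
    (h0 : ∀ x ∈ Δ.carrier, (hessian v x).det ≠ 0) {x : 𝔼 n} (hx : x ∈ Δ.carrier) (k : Fin n) :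
    ∑ i, invDiv v i x * hessian v x i k
      = - partialDeriv k (fun y => Real.log (hessian v y).det) x := by
  have hU := Δ.isOpen_carrier
  have hH : ∀ i j, ContDiffOn ℝ ∞ (fun y => hessian v y i j) Δ.carrier := fun _ _ =>
    contDiffOn_hessian hU hv.contDiffOn
  have hHd : ∀ i j, DifferentiableAt ℝ (fun y => hessian v y i j) x := fun i j =>
    ContDiffOn.differentiableAt_of_isOpen hU (hH i j) (by simp) hx
  rw [partialDeriv_log_det hHd (h0 x hx)]
  have e1 : ∀ j, ∑ i, partialDeriv j (fun y => (hessian v y)⁻¹ i j) x * hessian v x i k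
      = - ∑ i, (hessian v x)⁻¹ j i * partialDeriv k (fun y => hessian v y i j) x := by
    intro j
    -- Symmetry of G allows ∂G·H = -G·∂H to be applied, and full symmetry of the third derivatives
    -- of v then turns the contraction into Jacobi's formula.
    have h1 : ∀ i, partialDeriv j (fun y => (hessian v y)⁻¹ i j) x
        = partialDeriv j (fun y => (hessian v y)⁻¹ j i) x := fun i =>
      partialDeriv_congr_of_isOpen hU hx fun y hy => hv.inv_hessian_comm hy i j
    simp only [h1]
    rw [sum_partialDeriv_inv_mul hU hH h0 hx]
    congr 1
    refine Finset.sum_congr rfl fun i _ => ?_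
    congr 1
    have h2 : ∀ y ∈ Δ.carrier, hessian v y i k = partialDeriv k (partialDeriv i v) y :=
      fun y hy => hessian_comm hU hv.contDiffOn hy
    have h3 : ∀ y ∈ Δ.carrier, hessian v y i j = partialDeriv j (partialDeriv i v) y :=
      fun y hy => hessian_comm hU hv.contDiffOn hy
    rw [partialDeriv_congr_of_isOpen hU hx h2, partialDeriv_congr_of_isOpen hU hx h3]
    exact partialDeriv_comm hU (contDiffOn_partialDeriv hU hv.contDiffOn) hx
  have e2 : ∑ i, invDiv v i x * hessian v x i k
      = ∑ j, ∑ i, partialDeriv j (fun y => (hessian v y)⁻¹ i j) x * hessian v x i k := by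
    rw [Finset.sum_comm]
    exact Finset.sum_congr rfl fun i _ => by rw [invDiv, Finset.sum_mul]
  rw [e2, Finset.sum_congr rfl fun j _ => e1 j, Finset.sum_neg_distrib, Finset.sum_comm]

/-- Since ∇r = H(x - p), applying G returns the radial field. This identity motivates the choice of
the potential as the cutoff variable. -/
theorem ClassS.sum_inv_mul_partialDeriv_potential (hv : Δ.ClassS v)
    (h0 : ∀ x ∈ Δ.carrier, (hessian v x).det ≠ 0) {x : 𝔼 n} (hx : x ∈ Δ.carrier) (i : Fin n) :
    ∑ j, (hessian v x)⁻¹ i j * partialDeriv j (potential v p) x = x i - p i := by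
  simp only [hv.partialDeriv_potential p hx]
  have h1 : (hessian v x)⁻¹ * hessian v x = 1 :=
    Matrix.nonsing_inv_mul _ (isUnit_iff_ne_zero.2 (h0 x hx))
  simp only [Finset.mul_sum]
  rw [Finset.sum_comm]
  have e : ∀ k, ∑ j, (hessian v x)⁻¹ i j * (hessian v x j k * (x k - p k))
      = (1 : Matrix (Fin n) (Fin n) ℝ) i k * (x k - p k) := by
    intro k
    rw [← h1, Matrix.mul_apply, Finset.sum_mul]
    exact Finset.sum_congr rfl fun j _ => by ring
  simp only [e, Matrix.one_apply, ite_mul, one_mul, zero_mul, Finset.sum_ite_eq,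
    Finset.mem_univ, if_true]

section Identity

variable (hv : Δ.ClassS v) (hp : p ∈ Δ.carrier) {R : ℝ}

include hv hp in
theorem ClassS.contDiffOn_comp_potential {g : ℝ → ℝ} (hg : ContDiffOn ℝ 1 g (Ioi 0)) :
    ContDiffOn ℝ 1 (fun x => g (potential v p x)) Δ.carrier :=
  hg.comp ((hv.contDiffOn_potential p).of_le (by simp)) fun _ hx =>
    zero_lt_one.trans_le (hv.one_le_potential hp hx)

include hv hp in
/-- Outside a compact set the potential exceeds `R`. -/
theorem ClassS.exists_isCompact (R : ℝ) : ∃ K ⊆ Δ.carrier, IsCompact K ∧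
    ∀ x ∈ Δ.carrier, x ∉ K → R ≤ potential v p x := by
  obtain ⟨η, hη0, hη⟩ := hv.exists_mem_core hp R
  refine ⟨Δ.core η, Δ.core_subset hη0, Δ.isCompact_core hη0, fun x hx hxK => ?_⟩
  by_contra h
  exact hxK (hη x hx (not_le.1 h).le)

include hv hp in
/-- The basic integral identity, tested against `u` times a cutoff of the potential. -/
theorem ClassS.integral_cut_eq (hA : SolvesAbreu Δ A v) (hu : ContDiffOn ℝ ∞ u Δ.carrier)
    (hR : 0 < R) :
    ∫ x in Δ.carrier, A x * (u x * cut R (potential v p x))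
      = - (∫ x in Δ.carrier, cut R (potential v p x) * hessPair v u x)
        + (∫ x in Δ.carrier, cutSlope R (potential v p x) * radial p u x)
        + ∫ x in Δ.carrier, u x * cutSlope R (potential v p x) *
            radial p (fun y => Real.log (hessian v y).det) x := by
  have h0 : ∀ x ∈ Δ.carrier, (hessian v x).det ≠ 0 := fun x hx => (hA x hx).1
  have hU := Δ.isOpen_carrier
  obtain ⟨K, hKU, hK, hKR⟩ := hv.exists_isCompact hp R
  set r := potential v p with hr
  have hr1 : ∀ x ∈ Δ.carrier, 1 ≤ r x := fun x hx => hv.one_le_potential hp hx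
  have hrs := hv.contDiffOn_potential p
  have hrd : ∀ x ∈ Δ.carrier, DifferentiableAt ℝ r x := fun x hx =>
    ContDiffOn.differentiableAt_of_isOpen hU hrs (by simp) hx
  set g := fun x => cut R (r x) with hg
  set γ := fun x => cutSlope R (r x) with hγ
  have hgs : ContDiffOn ℝ 1 g Δ.carrier := hv.contDiffOn_comp_potential hp contDiffOn_cut
  have hγs : ContDiffOn ℝ 1 γ Δ.carrier := hv.contDiffOn_comp_potential hp contDiffOn_cutSlope
  have hg0 : ∀ x ∈ Δ.carrier, x ∉ K → g x = 0 := fun x hx hxK =>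
    cut_eq_zero hR (hr1 x hx) (hKR x hx hxK)
  have hγ0 : ∀ x ∈ Δ.carrier, x ∉ K → γ x = 0 := fun x hx hxK =>
    cutSlope_eq_zero hR (hr1 x hx) (hKR x hx hxK)
  have hdg : ∀ x ∈ Δ.carrier, ∀ i, partialDeriv i g x = - γ x * partialDeriv i r x := by
    intro x hx i
    exact partialDeriv_comp (hasDerivAt_cut (zero_lt_one.trans_le (hr1 x hx))) (hrd x hx)
  have hu1 : ContDiffOn ℝ 1 u Δ.carrier := hu.of_le (by simp)
  have hui : ∀ i, ContDiffOn ℝ ∞ (partialDeriv i u) Δ.carrier := fun i =>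
    contDiffOn_partialDeriv hU hu
  have hgd : ∀ x ∈ Δ.carrier, DifferentiableAt ℝ g x := fun x hx =>
    ContDiffOn.differentiableAt_of_isOpen hU hgs le_rfl hx
  have hVs := hv.contDiffOn_invDiv h0
  have hGs := hv.contDiffOn_inv h0
  set L := fun y => Real.log (hessian v y).det with hL
  have hLs : ContDiffOn ℝ ∞ L Δ.carrier :=
    (contDiffOn_det fun i j => contDiffOn_hessian hU hv.contDiffOn).log h0
  have integ : ∀ {F : (𝔼 n) → ℝ}, ContinuousOn F Δ.carrier →
      (∀ y ∈ Δ.carrier, y ∉ K → F y = 0) → IntegrableOn F Δ.carrier := fun hF h0 =>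
    integrableOn_of_continuousOn_of_eq_zero hK hKU hF h0 hU
  have hrc : ∀ i, ContinuousOn (partialDeriv i r) Δ.carrier := fun i =>
    continuousOn_partialDeriv hU (hrs.of_le (by simp))
  -- first integration by parts
  have step1 : ∫ x in Δ.carrier, A x * (u x * g x)
      = ∑ i, ∫ x in Δ.carrier, invDiv v i x * partialDeriv i (fun y => u y * g y) x := by
    have hugs : ContDiffOn ℝ 1 (fun y => u y * g y) Δ.carrier := hu1.mul hgs
    have hi : ∀ i, ∫ x in Δ.carrier, invDiv v i x * partialDeriv i (fun y => u y * g y) x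
        = - ∫ x in Δ.carrier, partialDeriv i (invDiv v i) x * (u x * g x) := fun i =>
      integral_mul_partialDeriv hU hK hKU ((hVs i).of_le (by simp)) hugs
        (fun y hy hyK => by simp [hg0 y hy hyK]) i
    simp only [hi]
    rw [Finset.sum_neg_distrib, ← integral_finsetSum, ← integral_neg]
    · refine setIntegral_congr_fun hU.measurableSet fun x hx => ?_
      rw [← Finset.sum_mul, hv.sum_partialDeriv_invDiv hA hx]
      ring
    · intro i _
      refine integ ((continuousOn_partialDeriv hU ((hVs i).of_le (by simp))).mul
        hugs.continuousOn) fun y hy hyK => by simp [hg0 y hy hyK]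
  have step2 : ∀ i, ∫ x in Δ.carrier, invDiv v i x * partialDeriv i (fun y => u y * g y) x
      = (∫ x in Δ.carrier, invDiv v i x * (g x * partialDeriv i u x))
        - ∫ x in Δ.carrier, u x * γ x * (invDiv v i x * partialDeriv i r x) := by
    intro i
    rw [← integral_sub]
    · refine setIntegral_congr_fun hU.measurableSet fun x hx => ?_
      rw [partialDeriv_mul (ContDiffOn.differentiableAt_of_isOpen hU hu1 le_rfl hx) (hgd x hx),
        hdg x hx]
      ring
    · exact integ ((hVs i).continuousOn.mul (hgs.continuousOn.mul (hui i).continuousOn))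
        fun y hy hyK => by simp [hg0 y hy hyK]
    · exact integ ((hu1.continuousOn.mul hγs.continuousOn).mul
        ((hVs i).continuousOn.mul (hrc i))) fun y hy hyK => by simp [hγ0 y hy hyK]
  -- Here V·∇r = ∑ V_i H_ik (x_k - p_k), and V contracted with H is minus the gradient of log det.
  have step3 : ∑ i, ∫ x in Δ.carrier, u x * γ x * (invDiv v i x * partialDeriv i r x)
      = - ∫ x in Δ.carrier, u x * γ x * radial p L x := by
    rw [← integral_finsetSum, ← integral_neg]
    · refine setIntegral_congr_fun hU.measurableSet fun x hx => ?_
      rw [← Finset.mul_sum, ← mul_neg]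
      congr 1
      have e : ∀ i, invDiv v i x * partialDeriv i r x
          = ∑ k, (x k - p k) * (invDiv v i x * hessian v x i k) := by
        intro i
        rw [hr, hv.partialDeriv_potential p hx, Finset.mul_sum]
        exact Finset.sum_congr rfl fun k _ => by ring
      simp only [e]
      rw [Finset.sum_comm, radial, ← Finset.sum_neg_distrib]
      refine Finset.sum_congr rfl fun k _ => ?_
      rw [← Finset.mul_sum, hv.sum_invDiv_mul_hessian h0 hx]
      ring
    · intro i _
      exact integ ((hu1.continuousOn.mul hγs.continuousOn).mul
        ((hVs i).continuousOn.mul (hrc i))) fun y hy hyK => by simp [hγ0 y hy hyK]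
  -- second integration by parts
  have hgu : ∀ i, ContDiffOn ℝ 1 (fun y => g y * partialDeriv i u y) Δ.carrier := fun i =>
    hgs.mul ((hui i).of_le (by simp))
  have hGc : ∀ i j, ContinuousOn (partialDeriv j (fun y => (hessian v y)⁻¹ i j)) Δ.carrier :=
    fun i j => continuousOn_partialDeriv hU ((hGs i j).of_le (by simp))
  have step4 : ∀ i, ∫ x in Δ.carrier, invDiv v i x * (g x * partialDeriv i u x)
      = - ∑ j, ∫ x in Δ.carrier, (hessian v x)⁻¹ i j *
          partialDeriv j (fun y => g y * partialDeriv i u y) x := by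
    intro i
    have hj : ∀ j, ∫ x in Δ.carrier, (hessian v x)⁻¹ i j *
          partialDeriv j (fun y => g y * partialDeriv i u y) x
        = - ∫ x in Δ.carrier, partialDeriv j (fun y => (hessian v y)⁻¹ i j) x *
          (g x * partialDeriv i u x) := fun j =>
      integral_mul_partialDeriv hU hK hKU ((hGs i j).of_le (by simp)) (hgu i)
        (fun y hy hyK => by simp [hg0 y hy hyK]) j
    simp only [hj]
    rw [Finset.sum_neg_distrib, neg_neg, ← integral_finsetSum]
    · refine setIntegral_congr_fun hU.measurableSet fun x hx => ?_
      simp only [invDiv]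
      rw [Finset.sum_mul]
    · intro j _
      exact integ ((hGc i j).mul (hgu i).continuousOn) fun y hy hyK => by simp [hg0 y hy hyK]
  have hguc : ∀ i j, ContinuousOn (fun x => (hessian v x)⁻¹ i j *
      partialDeriv j (fun y => g y * partialDeriv i u y) x) Δ.carrier := fun i j =>
    (hGs i j).continuousOn.mul (continuousOn_partialDeriv hU (hgu i))
  have hpt : ∀ x ∈ Δ.carrier, ∀ i j, partialDeriv j (fun y => g y * partialDeriv i u y) x
      = g x * hessian u x i j - γ x * partialDeriv j r x * partialDeriv i u x := by
    intro x hx i j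
    rw [partialDeriv_mul (hgd x hx)
      (ContDiffOn.differentiableAt_of_isOpen hU (hui i) (by simp) hx), hdg x hx,
      hessian_comm hU hu hx, hessian_apply]
    ring
  have step5 : ∑ i, ∑ j, ∫ x in Δ.carrier, (hessian v x)⁻¹ i j *
          partialDeriv j (fun y => g y * partialDeriv i u y) x
      = (∫ x in Δ.carrier, g x * hessPair v u x) - ∫ x in Δ.carrier, γ x * radial p u x := by
    have hint : ∀ i j, IntegrableOn (fun x => (hessian v x)⁻¹ i j *
          partialDeriv j (fun y => g y * partialDeriv i u y) x) Δ.carrier := fun i j =>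
      integ (hguc i j) fun y hy hyK => by
        rw [hpt y hy, hg0 y hy hyK, hγ0 y hy hyK]; simp
    rw [← integral_sub]
    · simp only [← integral_finsetSum _ fun j _ => hint _ j]
      rw [← integral_finsetSum _ fun i _ => integrable_finsetSum _ fun j _ => hint i j]
      refine setIntegral_congr_fun hU.measurableSet fun x hx => ?_
      simp only [hpt x hx, hessPair, radial, mul_sub, Finset.sum_sub_distrib]
      congr 1
      · rw [Finset.mul_sum]
        refine Finset.sum_congr rfl fun i _ => ?_
        rw [Finset.mul_sum]
        exact Finset.sum_congr rfl fun j _ => by ring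
      · rw [Finset.mul_sum]
        refine Finset.sum_congr rfl fun i _ => ?_
        rw [← hv.sum_inv_mul_partialDeriv_potential h0 hx i, Finset.sum_mul, Finset.mul_sum]
        exact Finset.sum_congr rfl fun j _ => by ring
    · exact integ (hgs.continuousOn.mul (hv.continuousOn_hessPair h0 hu))
        fun y hy hyK => by simp [hg0 y hy hyK]
    · exact integ (hγs.continuousOn.mul (continuousOn_radial hu1))
        fun y hy hyK => by simp [hγ0 y hy hyK]
  rw [step1]
  simp only [step2]
  rw [Finset.sum_sub_distrib, step3]
  simp only [step4]
  rw [Finset.sum_neg_distrib, step5]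
  ring

end Identity

end Polytope

/-! ### The singular kernels and their facet limits. -/

namespace Polytope

variable {n : ℕ} {Δ : Polytope n} {v A u h : (𝔼 n) → ℝ} {p : 𝔼 n} {B C : ℝ}

theorem ClassS.continuousOn_comp_potential (hv : Δ.ClassS v) (hp : p ∈ Δ.carrier) {g : ℝ → ℝ}
    (hg : ContDiffOn ℝ 1 g (Ioi 0)) :
    ContinuousOn (fun x => g (potential v p x)) Δ.carrier :=
  (hv.contDiffOn_comp_potential hp hg).continuousOn

theorem integrableOn_carrier_of_continuousOn (hu : ContinuousOn u (closure Δ.carrier)) :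
    IntegrableOn u Δ.carrier :=
  (hu.integrableOn_compact Δ.isCompact_closure_carrier).mono_set subset_closure

theorem ae_mem_closure_boundaryMeasure : ∀ᵐ x ∂Δ.boundaryMeasure, x ∈ closure Δ.carrier := by
  rw [boundaryMeasure_eq_sum, ← Measure.sum_fintype, Measure.ae_sum_iff]
  intro k
  refine Measure.ae_smul_measure ?_ _
  rw [ae_restrict_iff' (Δ.isClosed_facet k).measurableSet]
  exact Eventually.of_forall fun x hx => hx.1

theorem facetMeasure_le (k : Fin Δ.m) : Δ.facetMeasure k ≤ Δ.boundaryMeasure := by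
  rw [boundaryMeasure_eq_sum]
  exact Finset.single_le_sum (f := fun k => Δ.facetMeasure k) (fun _ _ => bot_le)
    (Finset.mem_univ k)

theorem integrable_boundaryMeasure (hu : ContinuousOn u (closure Δ.carrier)) :
    Integrable u Δ.boundaryMeasure := by
  obtain ⟨M, _, hM⟩ := Δ.exists_bound_of_continuousOn hu
  have hr : Δ.boundaryMeasure.restrict (closure Δ.carrier) = Δ.boundaryMeasure :=
    Measure.restrict_eq_self_of_ae_mem Δ.ae_mem_closure_boundaryMeasure
  have hm := hu.aestronglyMeasurable (μ := Δ.boundaryMeasure) isClosed_closure.measurableSet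
  rw [hr] at hm
  exact Integrable.of_bound hm M (Δ.ae_mem_closure_boundaryMeasure.mono hM)

theorem integral_boundaryMeasure (hu : ContinuousOn u (closure Δ.carrier)) :
    ∫ x, u x ∂Δ.boundaryMeasure = ∑ k, ∫ x, u x ∂(Δ.facetMeasure k) := by
  rw [boundaryMeasure_eq_sum]
  exact integral_finsetSum_measure fun k _ =>
    (integrable_boundaryMeasure hu).mono_measure (Δ.facetMeasure_le k)

/-- The part of the boundary term carried by one facet. -/
theorem ClassS.eventually_integral_cutSlope_div_le (hv : Δ.ClassS v) (hp : p ∈ Δ.carrier)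
    (hu : ContinuousOn u (closure Δ.carrier)) (h1 : ∀ x ∈ closure Δ.carrier, 0 ≤ u x)
    (k : Fin Δ.m) {ε : ℝ} (hε : 0 < ε) :
    ∀ᶠ R in atTop, ∫ x in Δ.carrier,
        u x * cutSlope R (potential v p x) * (Δ.delta k p / Δ.delta k x)
      ≤ ∫ x, u x ∂(Δ.facetMeasure k) + ε := by
  obtain ⟨B, hB0, hB⟩ := Δ.exists_bound_of_continuousOn hu
  obtain ⟨C, hC0, hC⟩ := hv.exists_neg_log_le_potential hp
  set c := Δ.delta k p with hc
  have hcp : 0 < c := hp k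
  have hε2 : 0 < ε / 2 := by positivity
  obtain ⟨τ, hτ, hker⟩ := exists_lintegral_kernel_le (Δ := Δ) (p := p) hp hu k
    (ε := ENNReal.ofReal (ε / 2)) (ENNReal.ofReal_pos.2 hε2)
  -- Below level s the lower bound for the potential is at least 1, the range where the slope is
  -- known to be monotone.
  obtain ⟨s, hs, hs1⟩ : ∃ s > 0, ∀ t, 0 < t → t ≤ s → 1 ≤ -(c * Real.log (c * t)) - C := by
    refine ⟨Real.exp (-((1 + C) / c)) / c, by positivity, fun t ht hts => ?_⟩
    have e1 : c * t ≤ Real.exp (-((1 + C) / c)) := by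
      rw [le_div_iff₀ hcp] at hts; linarith
    have e2 := (Real.log_le_iff_le_exp (by positivity)).2 e1
    have e3 : c * Real.log (c * t) ≤ c * (-((1 + C) / c)) := by gcongr
    have e4 : c * (-((1 + C) / c)) = -(1 + C) := by field_simp
    linarith
  set t₀ := min τ s with ht₀
  have ht0 : 0 < t₀ := lt_min hτ hs
  set V := (volume Δ.carrier).toReal with hV
  have hVfin := Δ.volume_carrier_lt_top.ne
  have hR1 : ∀ᶠ R : ℝ in atTop, B * (6 / R) * t₀⁻¹ * V ≤ ε / 2 := by
    have : Tendsto (fun R : ℝ => B * (6 / R) * t₀⁻¹ * V) atTop (𝓝 (B * 0 * t₀⁻¹ * V)) :=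
      (((tendsto_const_nhds.div_atTop tendsto_id).const_mul B).mul_const _).mul_const _
    refine this.eventually_le_const ?_
    simpa using hε2
  filter_upwards [eventually_ge_atTop 1, hR1] with R hR hRV
  have hR0 : 0 < R := by linarith
  have hU := Δ.isOpen_carrier
  have hr1 : ∀ x ∈ Δ.carrier, 1 ≤ potential v p x := fun x hx => hv.one_le_potential hp hx
  have hδ : ∀ x ∈ Δ.carrier, 0 < Δ.delta k x := fun x hx => hx k
  have hnn : ∀ x ∈ Δ.carrier,
      0 ≤ u x * cutSlope R (potential v p x) * (c / Δ.delta k x) := fun x hx =>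
    mul_nonneg (mul_nonneg (h1 x (subset_closure hx)) (cutSlope_nonneg hR0 (hr1 x hx)))
      (div_pos hcp (hδ x hx)).le
  have hcont : ContinuousOn (fun x => u x * cutSlope R (potential v p x) * (c / Δ.delta k x))
      Δ.carrier :=
    ((hu.mono subset_closure).mul (hv.continuousOn_comp_potential hp contDiffOn_cutSlope)).mul
      (continuousOn_const.div (Δ.continuous_delta k).continuousOn fun x hx => (hδ x hx).ne')
  have hui := (integrable_boundaryMeasure hu).mono_measure (Δ.facetMeasure_le k)
  have hu0 : 0 ≤ᵐ[Δ.facetMeasure k] u :=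
    Filter.Eventually.mono (ae_mono (Δ.facetMeasure_le k) Δ.ae_mem_closure_boundaryMeasure) h1
  rw [integral_eq_lintegral_of_nonneg_ae
    ((ae_restrict_iff' hU.measurableSet).2 (Eventually.of_forall hnn))
    (hcont.aestronglyMeasurable hU.measurableSet)]
  have hI0 : 0 ≤ ∫ x, u x ∂(Δ.facetMeasure k) := integral_nonneg_of_ae hu0
  refine ENNReal.toReal_le_of_le_ofReal (by positivity) ?_
  set S := {x | x ∈ Δ.carrier ∧ Δ.delta k x < t₀ * c} with hS
  have hSm : MeasurableSet S :=
    (hU.inter (isOpen_lt (Δ.continuous_delta k) continuous_const)).measurableSet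
  set κ : ℝ → ENNReal := fun t =>
    ENNReal.ofReal (cutSlope R (-(c * Real.log (c * t)) - C) * t⁻¹) with hκ
  have hκm : Measurable κ := by
    have : Measurable (cutSlope R) := by unfold cutSlope cutProfile; fun_prop
    exact ((this.comp (by fun_prop)).mul measurable_inv).ennreal_ofReal
  have hsplit : Δ.carrier = S ∪ Δ.carrier \ S := (union_sdiff_cancel fun x hx => hx.1).symm
  have hpart1 : ∫⁻ x in S, ENNReal.ofReal
        (u x * cutSlope R (potential v p x) * (c / Δ.delta k x))
      ≤ ENNReal.ofReal (∫ x, u x ∂(Δ.facetMeasure k)) + ENNReal.ofReal (ε / 2) := by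
    calc _ ≤ ∫⁻ x in S, κ (Δ.delta k x / c) * ENNReal.ofReal (u x) := by
          refine setLIntegral_mono' hSm fun x hx => ?_
          rw [hκ, ← ENNReal.ofReal_mul' (h1 x (subset_closure hx.1))]
          refine ENNReal.ofReal_le_ofReal ?_
          have hx0 := hδ x hx.1
          have e1 : c * (Δ.delta k x / c) = Δ.delta k x := by field_simp
          have e2 : (Δ.delta k x / c)⁻¹ = c / Δ.delta k x := inv_div _ _
          rw [e2, mul_comm (u x), mul_right_comm]
          have h3 : 1 ≤ -(c * Real.log (c * (Δ.delta k x / c))) - C := by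
            refine hs1 _ (by positivity) ?_
            rw [div_le_iff₀ hcp]
            exact hx.2.le.trans (by gcongr; exact min_le_right _ _)
          -- After this replacement the kernel depends on δ_k alone, so it can be integrated over
          -- the slices.
          have h4 := cutSlope_anti hR0 h3 (s := potential v p x) (by
            rw [e1]; have := hC x hx.1 k; linarith)
          have := h1 x (subset_closure hx.1)
          gcongr
      _ ≤ ENNReal.ofReal c * ((∫⁻ t in Ioo 0 t₀, κ t) *
          (∫⁻ x, ENNReal.ofReal (u x) ∂(Δ.facetMeasure k) + ENNReal.ofReal (ε / 2))) :=
        hker t₀ ht0 (min_le_left _ _) κ hκm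
      _ = (∫⁻ t in Ioo 0 t₀, ENNReal.ofReal
            (c * (cutSlope R (-(c * Real.log (c * t)) - C) * t⁻¹))) *
          (∫⁻ x, ENNReal.ofReal (u x) ∂(Δ.facetMeasure k) + ENNReal.ofReal (ε / 2)) := by
        rw [← mul_assoc, ← lintegral_const_mul _ hκm]
        simp only [hκ, ENNReal.ofReal_mul hcp.le]
      _ ≤ 1 * (∫⁻ x, ENNReal.ofReal (u x) ∂(Δ.facetMeasure k) + ENNReal.ofReal (ε / 2)) := by
        gcongr
        exact lintegral_cutSlope_le hR hcp ht0 fun t ht htt =>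
          hs1 t ht (htt.trans (min_le_right _ _))
      _ = _ := by rw [one_mul, ofReal_integral_eq_lintegral_ofReal hui hu0]
  -- Away from the facet δ_k is bounded below and the slope is at most 6/R, so this part dies as R
  -- grows, even near other facets.
  have hpart2 : ∫⁻ x in Δ.carrier \ S, ENNReal.ofReal
        (u x * cutSlope R (potential v p x) * (c / Δ.delta k x))
      ≤ ENNReal.ofReal (ε / 2) := by
    calc _ ≤ ∫⁻ _ in Δ.carrier \ S, ENNReal.ofReal (B * (6 / R) * t₀⁻¹) := by
          refine setLIntegral_mono' (hU.measurableSet.diff hSm) fun x hx => ?_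
          refine ENNReal.ofReal_le_ofReal ?_
          have hx0 := hδ x hx.1
          have h2 : t₀ * c ≤ Δ.delta k x := not_lt.1 fun hlt => hx.2 ⟨hx.1, hlt⟩
          have h3 : c / Δ.delta k x ≤ t₀⁻¹ := by
            rw [div_le_iff₀ hx0, inv_mul_eq_div, le_div_iff₀ ht0]; linarith
          have h4 := cutSlope_le hR0 (hr1 x hx.1)
          have h5 := cutSlope_nonneg hR0 (hr1 x hx.1)
          have h6 := (le_abs_self _).trans (hB x (subset_closure hx.1))
          have h7 := h1 x (subset_closure hx.1)
          gcongr
      _ ≤ ENNReal.ofReal (B * (6 / R) * t₀⁻¹) * volume Δ.carrier := by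
          rw [setLIntegral_const]
          gcongr
          exact sdiff_subset
      _ = ENNReal.ofReal (B * (6 / R) * t₀⁻¹ * V) := by
          rw [ENNReal.ofReal_mul (p := B * (6 / R) * t₀⁻¹) (by positivity), hV, ENNReal.ofReal_toReal hVfin]
      _ ≤ _ := ENNReal.ofReal_le_ofReal hRV
  rw [hsplit]
  refine (lintegral_union_le _ _ _).trans ((add_le_add hpart1 hpart2).trans ?_)
  rw [← ENNReal.ofReal_add hI0 hε2.le, ← ENNReal.ofReal_add (by positivity) hε2.le]
  exact ENNReal.ofReal_le_ofReal (by linarith)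

end Polytope

/-! ### The inequality between ℒ_A and the pairing with the inverse Hessian. -/

namespace Polytope

variable {n : ℕ} {Δ : Polytope n} {v A u h : (𝔼 n) → ℝ} {p : 𝔼 n} {B C : ℝ}

theorem radial_sum_log (p : 𝔼 n) {x : 𝔼 n} (hx : x ∈ Δ.carrier) :
    radial p (fun y => ∑ k, Real.log (Δ.delta k y)) x
      = ∑ k, (1 - Δ.delta k p / Δ.delta k x) := by
  unfold radial
  have e : ∀ i, partialDeriv i (fun y => ∑ k, Real.log (Δ.delta k y)) x
      = ∑ k, (Δ.delta k x)⁻¹ * Δ.normal k i := by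
    intro i
    rw [partialDeriv_sum (F := fun k y => Real.log (Δ.delta k y)) fun k _ =>
      (Δ.differentiableAt_delta k x).log (hx k).ne']
    refine Finset.sum_congr rfl fun k _ => ?_
    rw [partialDeriv_comp (Real.hasDerivAt_log (hx k).ne') (Δ.differentiableAt_delta k x),
      partialDeriv_delta]
  simp only [e, Finset.mul_sum]
  rw [Finset.sum_comm]
  refine Finset.sum_congr rfl fun k _ => ?_
  have := hx k
  rw [one_sub_div this.ne', ← Δ.sum_coord_mul_normal k x p, Finset.sum_div]
  exact Finset.sum_congr rfl fun i _ => by ring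

/-- The contribution of a nonnegative function `N` to the boundary term. -/
theorem ClassS.exists_integral_radial_le (hv : Δ.ClassS v) (hp : p ∈ Δ.carrier)
    {N : (𝔼 n) → ℝ} (hN : ContDiffOn ℝ ∞ N Δ.carrier) (hN0 : ∀ x ∈ Δ.carrier, 0 ≤ N x)
    (hu : ContDiffOn ℝ ∞ u Δ.carrier) (h1 : ∀ x ∈ Δ.carrier, 1 ≤ u x)
    (h2 : ∀ x ∈ Δ.carrier, u x ≤ B) (h3 : ∀ x ∈ Δ.carrier, radial p u x ≤ C) :
    ∃ M : ℝ, ∀ R, 1 ≤ R →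
      -∫ x in Δ.carrier, u x * cutSlope R (potential v p x) * radial p N x ≤ M / R := by
  have hU := Δ.isOpen_carrier
  have hB : 1 ≤ B := (h1 p hp).trans (h2 p hp)
  -- The factor 2 cancels the one in the decay rate 1/(2r²) of the slope; n B and |C| are the sizes
  -- of the two terms to be absorbed.
  obtain ⟨R₀, hR₀⟩ := hv.exists_mul_sq_le_potentialSlope hp (K := 2 * (n * B + |C|))
    (by positivity)
  obtain ⟨K₀, hK₀U, hK₀, hK₀R⟩ := hv.exists_isCompact hp R₀
  have hu1 : ContDiffOn ℝ 1 u Δ.carrier := hu.of_le (by simp)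
  have hrs := hv.contDiffOn_potential p
  have hslope : ContinuousOn (potentialSlope v p) Δ.carrier := by
    have : ContinuousOn (fun x => ∑ j, (x j - p j) * partialDeriv j (potential v p) x)
        Δ.carrier := continuousOn_radial (hrs.of_le (by simp))
    exact this.congr fun x hx => potentialSlope_eq hv p hx
  have hbound : ∀ {F : (𝔼 n) → ℝ}, ContinuousOn F Δ.carrier →
      ∃ M : ℝ, 0 ≤ M ∧ ∀ x ∈ K₀, |F x| ≤ M := by
    intro F hF
    obtain ⟨M, hM⟩ := hK₀.exists_bound_of_continuousOn (hF.mono hK₀U)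
    exact ⟨max M 0, le_max_right _ _, fun x hx => (hM x hx).trans (le_max_left _ _)⟩
  obtain ⟨M₁, hM₁0, hM₁⟩ := hbound hN.continuousOn
  obtain ⟨M₂, hM₂0, hM₂⟩ := hbound hslope
  set D : ℝ := M₁ * (n * B * 6 + 6 * |C| + B * 27 * M₂) with hD
  have hD0 : 0 ≤ D := by positivity
  refine ⟨D * (volume Δ.carrier).toReal, fun R hR => ?_⟩
  have hR0 : 0 < R := by linarith
  obtain ⟨K, hKU, hK, hKR⟩ := hv.exists_isCompact hp R
  set r := potential v p with hr
  have hr1 : ∀ x ∈ Δ.carrier, 1 ≤ r x := fun x hx => hv.one_le_potential hp hx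
  have hrd : ∀ x ∈ Δ.carrier, DifferentiableAt ℝ r x := fun x hx =>
    ContDiffOn.differentiableAt_of_isOpen hU hrs (by simp) hx
  set γ := fun x => cutSlope R (r x) with hγ
  have hγs : ContDiffOn ℝ 1 γ Δ.carrier := hv.contDiffOn_comp_potential hp contDiffOn_cutSlope
  have hγ0 : ∀ x ∈ Δ.carrier, x ∉ K → γ x = 0 := fun x hx hxK =>
    cutSlope_eq_zero hR0 (hr1 x hx) (hKR x hx hxK)
  have hψ : ∀ i, ContDiffOn ℝ 1 (fun y : 𝔼 n => u y * γ y * (y i - p i)) Δ.carrier := fun i =>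
    (hu1.mul hγs).mul (contDiff_coord_sub p i).contDiffOn
  have hψ0 : ∀ i, ∀ y ∈ Δ.carrier, y ∉ K → u y * γ y * (y i - p i) = 0 :=
    fun i y hy hyK => by simp [hγ0 y hy hyK]
  have integ : ∀ {F : (𝔼 n) → ℝ}, ContinuousOn F Δ.carrier →
      (∀ y ∈ Δ.carrier, y ∉ K → F y = 0) → IntegrableOn F Δ.carrier := fun hF h0 =>
    integrableOn_of_continuousOn_of_eq_zero hK hKU hF h0 hU
  have hpt : ∀ x ∈ Δ.carrier, ∀ i, partialDeriv i (fun y : 𝔼 n => u y * γ y * (y i - p i)) x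
      = u x * γ x + (u x * (cutSlopeDeriv R (r x) * ((x i - p i) * partialDeriv i r x))
        + γ x * ((x i - p i) * partialDeriv i u x)) := by
    intro x hx i
    have hud := ContDiffOn.differentiableAt_of_isOpen hU hu1 le_rfl hx
    have hγd := ContDiffOn.differentiableAt_of_isOpen hU hγs le_rfl hx
    have hdγ : partialDeriv i γ x = cutSlopeDeriv R (r x) * partialDeriv i r x :=
      partialDeriv_comp (hasDerivAt_cutSlope (zero_lt_one.trans_le (hr1 x hx))) (hrd x hx)
    rw [partialDeriv_mul (u := fun y => u y * γ y) (hud.mul hγd)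
      ((contDiff_coord_sub p i (m := 1)).differentiable (by simp) x),
      partialDeriv_coord_sub, partialDeriv_mul hud hγd, hdγ]
    simp only [if_true]
    ring
  have hsum : ∀ x ∈ Δ.carrier, ∑ i, partialDeriv i (fun y : 𝔼 n => u y * γ y * (y i - p i)) x
      = n * (u x * γ x) + u x * (cutSlopeDeriv R (r x) * potentialSlope v p x)
        + γ x * radial p u x := by
    intro x hx
    simp only [hpt x hx]
    rw [Finset.sum_add_distrib, Finset.sum_add_distrib, Finset.sum_const, Finset.card_univ,
      Fintype.card_fin, nsmul_eq_mul, ← Finset.mul_sum, ← Finset.mul_sum, ← Finset.mul_sum,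
      ← potentialSlope_eq hv p hx, radial, add_assoc]
  have hdc : ∀ i, ContinuousOn (partialDeriv i (fun y : 𝔼 n => u y * γ y * (y i - p i)))
      Δ.carrier := fun i => continuousOn_partialDeriv hU (hψ i)
  have hd0 : ∀ i, ∀ y ∈ Δ.carrier, y ∉ K →
      N y * partialDeriv i (fun y : 𝔼 n => u y * γ y * (y i - p i)) y = 0 := by
    intro i y hy hyK
    rw [hpt y hy, hγ0 y hy hyK, cutSlopeDeriv_eq_zero hR0 (hr1 y hy) (hKR y hy hyK)]
    simp
  -- Moving the radial derivative off N leaves the divergence of uγ(x - p). No upper bound on N near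
  -- the boundary is needed once that divergence is nonpositive there.
  have step : -∫ x in Δ.carrier, u x * γ x * radial p N x
      = ∫ x in Δ.carrier, N x * ∑ i, partialDeriv i (fun y : 𝔼 n => u y * γ y * (y i - p i)) x := by
    simp only [Finset.mul_sum]
    rw [integral_finsetSum (f := fun i x => N x *
      partialDeriv i (fun y : 𝔼 n => u y * γ y * (y i - p i)) x) _
      fun i _ => integ (hN.continuousOn.mul (hdc i)) (hd0 i)]
    simp only [integral_mul_partialDeriv hU hK hKU (hN.of_le (by simp)) (hψ _) (hψ0 _)]
    rw [Finset.sum_neg_distrib, ← integral_finsetSum]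
    · congr 1
      refine setIntegral_congr_fun hU.measurableSet fun x hx => ?_
      simp only [radial, Finset.mul_sum]
      exact Finset.sum_congr rfl fun i _ => by ring
    · exact fun i _ => integ ((continuousOn_partialDeriv hU (hN.of_le (by simp))).mul
        (hψ i).continuousOn) fun y hy hyK => by rw [hψ0 i y hy hyK, mul_zero]
  rw [step]
  have hle : ∀ x ∈ Δ.carrier,
      N x * ∑ i, partialDeriv i (fun y : 𝔼 n => u y * γ y * (y i - p i)) x ≤ D / R := by
    intro x hx
    rw [hsum x hx]
    have hγn : 0 ≤ γ x := cutSlope_nonneg hR0 (hr1 x hx)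
    have hux := h1 x hx
    have huB := h2 x hx
    have hrad : γ x * radial p u x ≤ γ x * |C| := by
      gcongr; exact (h3 x hx).trans (le_abs_self C)
    rcases le_or_gt R₀ (r x) with hrR | hrR
    · have hs := hR₀ x hx hrR
      have hd := cutSlopeDeriv_le hR0 (hr1 x hx)
      have hrp : 0 < r x := zero_lt_one.trans_le (hr1 x hx)
      have hs0 : 0 ≤ potentialSlope v p x := le_trans (by positivity) hs
      have e1 : cutSlopeDeriv R (r x) * potentialSlope v p x ≤ -(γ x * (n * B + |C|)) := by
        calc _ ≤ -(γ x / (2 * r x ^ 2)) * potentialSlope v p x := by gcongr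
          _ = -(γ x / (2 * r x ^ 2) * potentialSlope v p x) := by ring
          _ ≤ -(γ x / (2 * r x ^ 2) * (2 * (n * B + |C|) * r x ^ 2)) := by gcongr
          _ = _ := by field_simp
      -- The normalization u ≥ 1 enters here: multiplying the negative term by u can only help.
      have e2 : u x * (cutSlopeDeriv R (r x) * potentialSlope v p x)
          ≤ -(γ x * (n * B + |C|)) := by
        have : 0 ≤ γ x * (n * B + |C|) := by positivity
        nlinarith
      have e3 : (n : ℝ) * (u x * γ x) ≤ n * (B * γ x) := by gcongr
      have e4 : n * (u x * γ x) + u x * (cutSlopeDeriv R (r x) * potentialSlope v p x)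
        + γ x * radial p u x ≤ 0 := by nlinarith
      exact (mul_nonpos_of_nonneg_of_nonpos (hN0 x hx) e4).trans (by positivity)
    -- Where the potential is below R₀ the point lies in a compact set independent of R, and each
    -- term carries a factor 1/R.
    · have hxK : x ∈ K₀ := by
        by_contra hxK
        exact absurd (hK₀R x hx hxK) (not_le.2 hrR)
      have e1 := (le_abs_self _).trans (hM₁ x hxK)
      have e2 := hM₂ x hxK
      have e3 := abs_cutSlopeDeriv_le hR (hr1 x hx)
      have e4 : γ x ≤ 6 / R := cutSlope_le hR0 (hr1 x hx)
      have e5 : cutSlopeDeriv R (r x) * potentialSlope v p x ≤ 27 / R * M₂ :=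
        (le_abs_self _).trans (by rw [abs_mul]; gcongr)
      have e6 : n * (u x * γ x) + u x * (cutSlopeDeriv R (r x) * potentialSlope v p x)
          + γ x * radial p u x ≤ (n * B * 6 + 6 * |C| + B * 27 * M₂) / R := by
        calc _ ≤ n * (B * (6 / R)) + u x * (27 / R * M₂) + γ x * |C| := by gcongr
          _ ≤ n * (B * (6 / R)) + B * (27 / R * M₂) + 6 / R * |C| := by gcongr
          _ = _ := by ring
      calc _ ≤ N x * ((n * B * 6 + 6 * |C| + B * 27 * M₂) / R) := by
            gcongr; exact hN0 x hx
        _ ≤ M₁ * ((n * B * 6 + 6 * |C| + B * 27 * M₂) / R) := by gcongr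
        _ = D / R := by rw [hD]; ring
  have hconst : ∫ _ in Δ.carrier, D / R = D * (volume Δ.carrier).toReal / R := by
    rw [setIntegral_const, smul_eq_mul, Measure.real]; ring
  rw [← hconst]
  refine setIntegral_mono_on ?_ (integrableOn_const Δ.volume_carrier_lt_top.ne) hU.measurableSet hle
  simp only [Finset.mul_sum]
  exact integrable_finsetSum _ fun i _ => integ (hN.continuousOn.mul (hdc i)) (hd0 i)

/-- The key inequality: `ℒ_A(u)` dominates the integral of `∑ v^{ij} u_{ij}`. -/
theorem ClassS.integral_le_functionalL (hv : Δ.ClassS v) (hA : SolvesAbreu Δ A v)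
    (hAc : ContinuousOn A (closure Δ.carrier)) (hp : p ∈ Δ.carrier)
    (huc : ContinuousOn u (closure Δ.carrier)) (hu : ContDiffOn ℝ ∞ u Δ.carrier)
    (h1 : ∀ x ∈ closure Δ.carrier, 1 ≤ u x) (h3 : ∀ x ∈ Δ.carrier, radial p u x ≤ C)
    (hh : IntegrableOn h Δ.carrier) (hle : ∀ x ∈ Δ.carrier, h x ≤ hessPair v u x) :
    ∫ x in Δ.carrier, h x ≤ Δ.functionalL A u := by
  have hU := Δ.isOpen_carrier
  have h0 : ∀ x ∈ Δ.carrier, (hessian v x).det ≠ 0 := fun x hx => (hA x hx).1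
  obtain ⟨B, hB0, hB⟩ := Δ.exists_bound_of_continuousOn huc
  have h2 : ∀ x ∈ Δ.carrier, u x ≤ B := fun x hx =>
    (le_abs_self _).trans (hB x (subset_closure hx))
  obtain ⟨C₁, hC₁⟩ := hv.exists_log_det_le h0
  set L := fun y => Real.log (hessian v y).det with hL
  have hLs : ContDiffOn ℝ ∞ L Δ.carrier :=
    (contDiffOn_det fun i j => contDiffOn_hessian hU hv.contDiffOn).log h0
  set Q : (𝔼 n) → ℝ := fun y => ∑ k, Real.log (Δ.delta k y) with hQ
  have hQs : ContDiffOn ℝ ∞ Q Δ.carrier :=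
    ContDiffOn.sum fun k _ => (Δ.contDiff_delta k).contDiffOn.log fun x hx => (hx k).ne'
  -- The upper bound for the determinant makes N nonnegative and separates log det into explicit
  -- logarithms and a term of favourable sign.
  set N : (𝔼 n) → ℝ := fun y => C₁ - (Q y + L y) with hN
  have hNs : ContDiffOn ℝ ∞ N Δ.carrier := contDiffOn_const.sub (hQs.add hLs)
  have hN0 : ∀ x ∈ Δ.carrier, 0 ≤ N x := fun x hx => by
    have := hC₁ x hx
    simp only [hN, hQ, hL]; linarith
  obtain ⟨M, hM⟩ := hv.exists_integral_radial_le hp hNs hN0 hu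
    (fun x hx => h1 x (subset_closure hx)) h2 h3
  have hu1 : ContDiffOn ℝ 1 u Δ.carrier := hu.of_le (by simp)
  set r := potential v p with hr
  have hr1 : ∀ x ∈ Δ.carrier, 1 ≤ r x := fun x hx => hv.one_le_potential hp hx
  have hrad : ∀ x ∈ Δ.carrier, radial p L x = ∑ k, (Δ.delta k p / Δ.delta k x - 1)
      - radial p N x := by
    intro x hx
    have e : ∑ k, (Δ.delta k p / Δ.delta k x - 1) = - radial p Q x := by
      rw [radial_sum_log p hx, ← Finset.sum_neg_distrib]
      exact Finset.sum_congr rfl fun k _ => by ring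
    have hQd := ContDiffOn.differentiableAt_of_isOpen hU hQs (by simp) hx
    have hLd := ContDiffOn.differentiableAt_of_isOpen hU hLs (by simp) hx
    rw [e]
    unfold radial
    rw [← Finset.sum_neg_distrib, ← Finset.sum_sub_distrib]
    refine Finset.sum_congr rfl fun i _ => ?_
    rw [hN, partialDeriv_sub (u := fun _ => C₁) (w := fun y => Q y + L y)
      (differentiableAt_const _) (hQd.add hLd), partialDeriv_add hQd hLd, partialDeriv_const]
    ring
  set V := (volume Δ.carrier).toReal with hV
  have hV0 : 0 ≤ V := ENNReal.toReal_nonneg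
  have hAb := Δ.exists_bound_of_continuousOn hAc
  have hAint : IntegrableOn (fun x => A x * u x) Δ.carrier :=
    integrableOn_carrier_of_continuousOn (hAc.mul huc)
  have hcutc : ∀ R, ContinuousOn (fun x => cut R (r x)) Δ.carrier := fun R =>
    hv.continuousOn_comp_potential hp contDiffOn_cut
  have hslc : ∀ R, ContinuousOn (fun x => cutSlope R (r x)) Δ.carrier := fun R =>
    hv.continuousOn_comp_potential hp contDiffOn_cutSlope
  have hdct : ∀ {F : (𝔼 n) → ℝ}, IntegrableOn F Δ.carrier →
      Tendsto (fun R => ∫ x in Δ.carrier, F x * cut R (r x)) atTop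
        (𝓝 (∫ x in Δ.carrier, F x)) := by
    intro F hF
    refine tendsto_integral_filter_of_dominated_convergence (fun x => |F x|) ?_ ?_ hF.abs ?_
    · exact Eventually.of_forall fun R => hF.aestronglyMeasurable.mul
        ((hcutc R).aestronglyMeasurable hU.measurableSet)
    · filter_upwards [eventually_gt_atTop 0] with R hR
      refine (ae_restrict_iff' hU.measurableSet).2 (Eventually.of_forall fun x hx => ?_)
      rw [norm_mul, Real.norm_eq_abs, Real.norm_eq_abs, abs_of_nonneg cut_nonneg]
      exact mul_le_of_le_one_right (abs_nonneg _) (cut_le_one hR (hr1 x hx))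
    · exact Eventually.of_forall fun x => by
        simpa using (tendsto_cut (r x)).const_mul (F x)
  refine le_of_forall_pos_le_add fun ε hε => ?_
  have hlim := (hdct hAint).add (hdct hh)
  -- The error ε is shared among the facets; dividing by m + 1 also covers the case of no facets.
  have hlim2 : Tendsto (fun R : ℝ => |C| * (6 / R) * V + M / R
      + ∑ k : Fin Δ.m, (∫ x, u x ∂(Δ.facetMeasure k) + ε / (Δ.m + 1))) atTop
      (𝓝 (|C| * 0 * V + 0 + ∑ k : Fin Δ.m, (∫ x, u x ∂(Δ.facetMeasure k) + ε / (Δ.m + 1)))) :=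
    ((((tendsto_const_nhds.div_atTop tendsto_id).const_mul _).mul_const _).add
      (tendsto_const_nhds.div_atTop tendsto_id)).add_const _
  have hev : ∀ᶠ R in atTop, (∫ x in Δ.carrier, A x * u x * cut R (r x))
      + (∫ x in Δ.carrier, h x * cut R (r x)) ≤ |C| * (6 / R) * V + M / R
      + ∑ k : Fin Δ.m, (∫ x, u x ∂(Δ.facetMeasure k) + ε / (Δ.m + 1)) := by
    have hfac : ∀ᶠ R in atTop, ∀ k, ∫ x in Δ.carrier,
        u x * cutSlope R (potential v p x) * (Δ.delta k p / Δ.delta k x)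
        ≤ ∫ x, u x ∂(Δ.facetMeasure k) + ε / (Δ.m + 1) :=
      eventually_all.2 fun k => hv.eventually_integral_cutSlope_div_le hp huc
        (fun x hx => zero_le_one.trans (h1 x hx)) k (by positivity)
    filter_upwards [eventually_ge_atTop 1, hfac] with R hR hRk
    have hR0 : 0 < R := by linarith
    obtain ⟨K, hKU, hK, hKR⟩ := hv.exists_isCompact hp R
    have integ : ∀ {F : (𝔼 n) → ℝ}, ContinuousOn F Δ.carrier →
        (∀ y ∈ Δ.carrier, y ∉ K → F y = 0) → IntegrableOn F Δ.carrier := fun hF h0 =>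
      integrableOn_of_continuousOn_of_eq_zero hK hKU hF h0 hU
    have hg0 : ∀ x ∈ Δ.carrier, x ∉ K → cut R (r x) = 0 := fun x hx hxK =>
      cut_eq_zero hR0 (hr1 x hx) (hKR x hx hxK)
    have hγ0 : ∀ x ∈ Δ.carrier, x ∉ K → cutSlope R (r x) = 0 := fun x hx hxK =>
      cutSlope_eq_zero hR0 (hr1 x hx) (hKR x hx hxK)
    have key := hv.integral_cut_eq hp hA hu hR0
    have e1 : ∫ x in Δ.carrier, A x * u x * cut R (r x)
        = ∫ x in Δ.carrier, A x * (u x * cut R (r x)) := by simp only [mul_assoc]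
    have e2 : ∫ x in Δ.carrier, h x * cut R (r x)
        ≤ ∫ x in Δ.carrier, cut R (r x) * hessPair v u x := by
      refine setIntegral_mono_on ?_ (integ ((hcutc R).mul (hv.continuousOn_hessPair h0 hu))
        fun y hy hyK => by rw [hg0 y hy hyK, zero_mul]) hU.measurableSet fun x hx => ?_
      · refine hh.mul_bdd (c := 1) ((hcutc R).aestronglyMeasurable hU.measurableSet)
          ((ae_restrict_iff' hU.measurableSet).2 (Eventually.of_forall fun x hx => ?_))
        rw [Real.norm_eq_abs, abs_of_nonneg cut_nonneg]
        exact cut_le_one hR0 (hr1 x hx)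
      · rw [mul_comm]
        exact mul_le_mul_of_nonneg_left (hle x hx) cut_nonneg
    have e3 : ∫ x in Δ.carrier, cutSlope R (r x) * radial p u x ≤ |C| * (6 / R) * V := by
      have hc : ∫ _ in Δ.carrier, |C| * (6 / R) = |C| * (6 / R) * V := by
        rw [setIntegral_const, smul_eq_mul, Measure.real]; ring
      rw [← hc]
      refine setIntegral_mono_on (integ ((hslc R).mul (continuousOn_radial hu1))
        fun y hy hyK => by rw [hγ0 y hy hyK, zero_mul])
        (integrableOn_const Δ.volume_carrier_lt_top.ne) hU.measurableSet fun x hx => ?_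
      calc _ ≤ cutSlope R (r x) * |C| := by
            have := cutSlope_nonneg hR0 (hr1 x hx)
            gcongr; exact (h3 x hx).trans (le_abs_self C)
        _ ≤ 6 / R * |C| := by gcongr; exact cutSlope_le hR0 (hr1 x hx)
        _ = _ := mul_comm _ _
    have hdiv : ∀ k, ContinuousOn (fun x => u x * cutSlope R (r x)
        * (Δ.delta k p / Δ.delta k x)) Δ.carrier := fun k =>
      (hu.continuousOn.mul (hslc R)).mul (continuousOn_const.div
        (Δ.continuous_delta k).continuousOn fun x hx => (hx k).ne')
    have hdivi : ∀ k, IntegrableOn (fun x => u x * cutSlope R (r x)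
        * (Δ.delta k p / Δ.delta k x)) Δ.carrier := fun k =>
      integ (hdiv k) fun y hy hyK => by rw [hγ0 y hy hyK]; simp
    have huγ : IntegrableOn (fun x => u x * cutSlope R (r x)) Δ.carrier :=
      integ (hu.continuousOn.mul (hslc R)) fun y hy hyK => by rw [hγ0 y hy hyK]; simp
    have hNr : IntegrableOn (fun x => u x * cutSlope R (r x) * radial p N x) Δ.carrier :=
      integ ((hu.continuousOn.mul (hslc R)).mul (continuousOn_radial (hNs.of_le (by simp))))
        fun y hy hyK => by rw [hγ0 y hy hyK]; simp
    have e4 : ∫ x in Δ.carrier, u x * cutSlope R (r x) * radial p L x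
        ≤ ∑ k, (∫ x in Δ.carrier, u x * cutSlope R (r x) * (Δ.delta k p / Δ.delta k x))
          - ∫ x in Δ.carrier, u x * cutSlope R (r x) * radial p N x := by
      rw [← integral_finsetSum _ fun k _ => hdivi k, ← integral_sub
        (integrable_finsetSum _ fun k _ => hdivi k) hNr]
      refine setIntegral_mono_on (integ ((hu.continuousOn.mul (hslc R)).mul
        (continuousOn_radial (hLs.of_le (by simp)))) fun y hy hyK => by rw [hγ0 y hy hyK]; simp)
        ((integrable_finsetSum _ fun k _ => hdivi k).sub hNr) hU.measurableSet fun x hx => ?_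
      -- The summands -1 in δ_k(p)/δ_k - 1 are simply dropped, since u times the slope is
      -- nonnegative.
      rw [hrad x hx, mul_sub, ← Finset.mul_sum]
      have : 0 ≤ u x * cutSlope R (r x) := mul_nonneg
        (zero_le_one.trans (h1 x (subset_closure hx))) (cutSlope_nonneg hR0 (hr1 x hx))
      gcongr
      linarith
    have e5 := hM R hR
    have e6 : ∑ k, (∫ x in Δ.carrier, u x * cutSlope R (r x) * (Δ.delta k p / Δ.delta k x))
        ≤ ∑ k : Fin Δ.m, (∫ x, u x ∂(Δ.facetMeasure k) + ε / (Δ.m + 1)) :=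
      Finset.sum_le_sum fun k _ => hRk k
    rw [e1, key]
    linarith
  have hfin := le_of_tendsto_of_tendsto hlim hlim2 hev
  rw [Finset.sum_add_distrib, ← integral_boundaryMeasure huc] at hfin
  have hε' : ∑ _k : Fin Δ.m, ε / (Δ.m + 1) ≤ ε := by
    rw [Finset.sum_const, Finset.card_univ, Fintype.card_fin, nsmul_eq_mul, mul_div_assoc',
      div_le_iff₀ (by positivity)]
    nlinarith
  unfold functionalL
  linarith

end Polytope

/-! ### Bounding ℒ_A at the solution, and consequences for convex test functions. -/

namespace Polytope

variable {n : ℕ} {Δ : Polytope n} {v A u : (𝔼 n) → ℝ} {p : 𝔼 n}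

theorem functionalL_add {w : (𝔼 n) → ℝ} (hA : ContinuousOn A (closure Δ.carrier))
    (hu : ContinuousOn u (closure Δ.carrier)) (hw : ContinuousOn w (closure Δ.carrier)) :
    Δ.functionalL A (fun x => u x + w x) = Δ.functionalL A u + Δ.functionalL A w := by
  unfold functionalL
  simp only [mul_add]
  rw [integral_add (integrable_boundaryMeasure hu) (integrable_boundaryMeasure hw),
    integral_add (f := fun x => A x * u x) (g := fun x => A x * w x)
      (integrableOn_carrier_of_continuousOn (hA.mul hu))
      (integrableOn_carrier_of_continuousOn (hA.mul hw))]
  ring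

theorem functionalL_neg : Δ.functionalL A (fun x => -u x) = -Δ.functionalL A u := by
  unfold functionalL
  simp only [mul_neg, integral_neg]
  ring

theorem AffineExtremal.functionalL_const (hE : Δ.AffineExtremal A) (c : ℝ) :
    Δ.functionalL A (fun _ => c) = 0 := by
  simpa using hE 0 c

theorem ClassS.hessPair_self (hv : Δ.ClassS v) {x : 𝔼 n} (hx : x ∈ Δ.carrier)
    (h0 : (hessian v x).det ≠ 0) : hessPair v v x = n := by
  have h1 : (hessian v x)⁻¹ * hessian v x = 1 :=
    Matrix.nonsing_inv_mul _ (isUnit_iff_ne_zero.2 h0)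
  have e : ∀ i, ∑ j, (hessian v x)⁻¹ i j * hessian v x i j = 1 := by
    intro i
    have h2 := congrFun (congrFun h1 i) i
    rw [Matrix.mul_apply, Matrix.one_apply_eq] at h2
    rw [← h2]
    exact Finset.sum_congr rfl fun j _ => by
      rw [hessian_comm Δ.isOpen_carrier hv.contDiffOn hx (i := i)]
  simp [hessPair, e]

/-- A solution of the Abreu equation has `ℒ_A` at most `n` times the volume. -/
theorem ClassS.functionalL_le (hv : Δ.ClassS v) (hA : SolvesAbreu Δ A v)
    (hAc : ContinuousOn A (closure Δ.carrier)) (hE : Δ.AffineExtremal A) (hp : p ∈ Δ.carrier) :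
    Δ.functionalL A v ≤ n * (volume Δ.carrier).toReal := by
  have hU := Δ.isOpen_carrier
  obtain ⟨B, hB0, hB⟩ := Δ.exists_bound_of_continuousOn hv.1
  have hvs := hv.contDiffOn
  have hvd : ∀ x ∈ Δ.carrier, DifferentiableAt ℝ v x := fun x hx =>
    ContDiffOn.differentiableAt_of_isOpen hU hvs (by simp) hx
  have hp1 : ∀ x ∈ Δ.carrier, ∀ i,
      partialDeriv i (fun y => B + 1 + -v y) x = -partialDeriv i v x := by
    intro x hx i
    rw [partialDeriv_add (u := fun _ => B + 1) (differentiableAt_const _) (hvd x hx).fun_neg,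
      partialDeriv_const, partialDeriv_neg, zero_add]
  have hp2 : ∀ x ∈ Δ.carrier, hessPair v (fun y => B + 1 + -v y) x = -n := by
    intro x hx
    have e : ∀ i j, hessian (fun y => B + 1 + -v y) x i j = -hessian v x i j := by
      intro i j
      rw [hessian_apply, partialDeriv_congr_of_isOpen hU hx fun y hy => hp1 y hy j,
        partialDeriv_neg, hessian_apply]
    rw [← hv.hessPair_self hx (hA x hx).1]
    simp [hessPair, e]
  -- The test function need not be convex; subtracting v reverses the sign and produces the upper
  -- bound on ℒ_A(v).
  have key := hv.integral_le_functionalL hA hAc hp (u := fun x => B + 1 + -v x)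
    (h := fun _ => -(n : ℝ)) (C := 2 * B) (continuousOn_const.add hv.1.neg)
    (contDiffOn_const.add hvs.neg)
    (fun x hx => by have := (abs_le.1 (hB x hx)).2; linarith)
    (fun x hx => ?_) (integrableOn_const Δ.volume_carrier_lt_top.ne) fun x hx => (hp2 x hx).ge
  · rw [functionalL_add (u := fun _ => B + 1) (w := fun x => -v x) hAc continuousOn_const
      hv.1.neg, hE.functionalL_const, functionalL_neg,
      setIntegral_const, smul_eq_mul, Measure.real] at key
    linarith
  -- The gradient of v may blow up at the boundary, but only an upper bound on the radial derivative
  -- of -v is required, and convexity gives v(p) - v(x).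
  · have h1 := hv.one_le_potential hp hx
    have h2 := (abs_le.1 (hB x (subset_closure hx))).1
    have h3 := (abs_le.1 (hB p (subset_closure hp))).2
    unfold potential at h1
    unfold radial
    simp only [hp1 x hx, mul_neg, Finset.sum_neg_distrib]
    linarith

/-- Normalized convex functions smooth up to the boundary. -/
def ClassSmooth (Δ : Polytope n) (p : 𝔼 n) (u : (𝔼 n) → ℝ) : Prop :=
  ContDiffOn ℝ ∞ u (closure Δ.carrier) ∧ ConvexOn ℝ (closure Δ.carrier) u ∧ Δ.Normalized p u

theorem ClassSmooth.convexOn (hu : Δ.ClassSmooth p u) : ConvexOn ℝ Δ.carrier u :=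
  hu.2.1.subset subset_closure Δ.convex_carrier

theorem ClassSmooth.contDiffOn (hu : Δ.ClassSmooth p u) : ContDiffOn ℝ ∞ u Δ.carrier :=
  hu.1.mono subset_closure

theorem ClassSmooth.posSemidef (hu : Δ.ClassSmooth p u) {x : 𝔼 n} (hx : x ∈ Δ.carrier) :
    (hessian u x).PosSemidef :=
  ConvexOn.posSemidef_hessian hu.convexOn Δ.isOpen_carrier hu.contDiffOn hx

theorem ClassS.trace_le_mul_hessPair (hv : Δ.ClassS v) (hu : Δ.ClassSmooth p u) {x : 𝔼 n}
    (hx : x ∈ Δ.carrier) (h0 : (hessian v x).det ≠ 0) :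
    (hessian u x).trace ≤ (hessian v x).trace * hessPair v u x :=
  trace_le_trace_mul_sum (hv.posDef_hessian hx h0) (hu.posSemidef hx)

theorem ClassS.hessPair_nonneg (hv : Δ.ClassS v) (hu : Δ.ClassSmooth p u) {x : 𝔼 n}
    (hx : x ∈ Δ.carrier) (h0 : (hessian v x).det ≠ 0) : 0 ≤ hessPair v u x := by
  -- In dimension zero the trace is not positive, so that case is separate.
  rcases Nat.eq_zero_or_pos n with rfl | hn
  · simp [hessPair]
  · have : Nonempty (Fin n) := ⟨⟨0, hn⟩⟩
    have h1 := (hu.posSemidef hx).trace_nonneg.trans (hv.trace_le_mul_hessPair hu hx h0)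
    exact nonneg_of_mul_nonneg_right h1 (hv.posDef_hessian hx h0).trace_pos

theorem continuousOn_trace_hessian (hu : ContDiffOn ℝ ∞ u Δ.carrier) :
    ContinuousOn (fun x => (hessian u x).trace) Δ.carrier := by
  unfold Matrix.trace Matrix.diag
  exact continuousOn_finsetSum _ fun i _ => (contDiffOn_hessian Δ.isOpen_carrier hu).continuousOn

/-- `ℒ_A` controls the Laplacian on compact sets. -/
theorem ClassS.exists_integral_trace_le (hv : Δ.ClassS v) (hA : SolvesAbreu Δ A v)
    (hAc : ContinuousOn A (closure Δ.carrier)) (hE : Δ.AffineExtremal A) (hp : p ∈ Δ.carrier)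
    {K : Set (𝔼 n)} (hK : IsCompact K) (hKΔ : K ⊆ Δ.carrier) :
    ∃ C : ℝ, 0 < C ∧ ∀ u, Δ.ClassSmooth p u →
      ∫ x in K, (hessian u x).trace ≤ C * Δ.functionalL A u := by
  have hU := Δ.isOpen_carrier
  obtain ⟨M, hM⟩ := hK.exists_bound_of_continuousOn
    ((continuousOn_trace_hessian hv.contDiffOn).mono hKΔ)
  set C := max M 1 with hC
  have hC0 : 0 < C := lt_max_of_lt_right one_pos
  refine ⟨C, hC0, fun u hu => ?_⟩
  have hus := hu.contDiffOn
  obtain ⟨M', hM'0, hM'⟩ := Δ.exists_bound_partialDeriv hu.1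
  obtain ⟨ρ, hρ0, hρ⟩ := Δ.exists_coord_sub_le p
  have hud : ∀ x ∈ Δ.carrier, DifferentiableAt ℝ u x := fun x hx =>
    ContDiffOn.differentiableAt_of_isOpen hU hus (by simp) hx
  have hp1 : ∀ x ∈ Δ.carrier, ∀ i,
      partialDeriv i (fun y => u y + 1) x = partialDeriv i u x := by
    intro x hx i
    rw [partialDeriv_add (w := fun _ => (1 : ℝ)) (hud x hx) (differentiableAt_const _),
      partialDeriv_const, add_zero]
  have hp2 : ∀ x ∈ Δ.carrier, hessPair v (fun y => u y + 1) x = hessPair v u x := by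
    intro x hx
    have e : ∀ i j, hessian (fun y => u y + 1) x i j = hessian u x i j := fun i j =>
      partialDeriv_congr_of_isOpen hU hx fun y hy => hp1 y hy j
    simp [hessPair, e]
  have hint : IntegrableOn (fun x => C⁻¹ * (hessian u x).trace) K :=
    (continuousOn_const.mul ((continuousOn_trace_hessian hus).mono hKΔ)).integrableOn_compact hK
  -- Adding 1 meets the requirement u ≥ 1 and changes neither the Hessian nor ℒ_A. Off K the lower
  -- bound for the pairing is taken to be 0.
  have key := hv.integral_le_functionalL hA hAc hp (u := fun x => u x + 1)
    (h := K.indicator fun x => C⁻¹ * (hessian u x).trace) (C := ∑ _i : Fin n, ρ * M')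
    (hu.1.continuousOn.add continuousOn_const) (hus.add contDiffOn_const)
    (fun x hx => by have := hu.2.2.2 x hx; linarith) (fun x hx => ?_)
    ((integrable_indicator_iff hK.measurableSet).2 hint).integrableOn fun x hx => ?_
  · rw [functionalL_add hAc hu.1.continuousOn continuousOn_const, hE.functionalL_const, add_zero,
      setIntegral_indicator hK.measurableSet, inter_eq_self_of_subset_right hKΔ,
      integral_const_mul, inv_mul_le_iff₀ hC0] at key
    exact key
  · unfold radial
    simp only [hp1 x hx]
    refine Finset.sum_le_sum fun i _ => (le_abs_self _).trans ?_
    rw [abs_mul]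
    gcongr
    · exact hρ x (subset_closure hx) i
    · exact (hM' x hx).2.1 i
  · rw [hp2 x hx]
    have h0 := hv.hessPair_nonneg hu hx (hA x hx).1
    by_cases hxK : x ∈ K
    · rw [indicator_of_mem hxK, inv_mul_le_iff₀ hC0]
      refine (hv.trace_le_mul_hessPair hu hx (hA x hx).1).trans ?_
      gcongr
      exact (le_abs_self _).trans ((hM x hxK).trans (le_max_left _ _))
    · rwa [indicator_of_notMem hxK]

/-- The Laplacian estimate over the empty set already contains this. -/
theorem ClassS.functionalL_nonneg (hv : Δ.ClassS v) (hA : SolvesAbreu Δ A v)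
    (hAc : ContinuousOn A (closure Δ.carrier)) (hE : Δ.AffineExtremal A) (hp : p ∈ Δ.carrier)
    (hu : Δ.ClassSmooth p u) : 0 ≤ Δ.functionalL A u := by
  obtain ⟨C, hC, h⟩ := hv.exists_integral_trace_le hA hAc hE hp isCompact_empty (empty_subset _)
  have := h u hu
  simp only [setIntegral_empty] at this
  exact nonneg_of_mul_nonneg_right this hC

/-- A convex function is at most its mean over a ball. -/
theorem ConvexOn.mul_le_setIntegral_ball {S : Set (𝔼 n)} (hu : ConvexOn ℝ S u) {x : 𝔼 n} {s : ℝ}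
    (hs : Metric.ball x s ⊆ S) (hi : IntegrableOn u (Metric.ball x s)) :
    (volume (Metric.ball x s)).toReal * u x ≤ ∫ y in Metric.ball x s, u y := by
  have hm : MeasurableSet (Metric.ball x s) := measurableSet_ball
  -- The reflection through the centre preserves the ball and the measure, so midpoint convexity can
  -- be integrated.
  have hmem : ∀ y, 2 • x - y ∈ Metric.ball x s ↔ y ∈ Metric.ball x s := by
    intro y
    rw [Metric.mem_ball, Metric.mem_ball, dist_eq_norm, dist_comm y x, dist_eq_norm]
    have : 2 • x - y - x = x - y := by rw [two_smul]; abel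
    rw [this]
  have hind : (fun y => (Metric.ball x s).indicator u (2 • x - y))
      = (Metric.ball x s).indicator fun y => u (2 • x - y) := by
    ext y
    by_cases hy : y ∈ Metric.ball x s
    · rw [indicator_of_mem hy, indicator_of_mem ((hmem y).2 hy)]
    · rw [indicator_of_notMem hy, indicator_of_notMem fun h => hy ((hmem y).1 h)]
  have hi' := (integrable_indicator_iff hm).2 hi
  have hr : IntegrableOn (fun y => u (2 • x - y)) (Metric.ball x s) := by
    rw [← integrable_indicator_iff hm, ← hind]
    exact hi'.comp_sub_left _
  have e : ∫ y in Metric.ball x s, u (2 • x - y) = ∫ y in Metric.ball x s, u y := by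
    rw [← integral_indicator hm, ← hind, integral_sub_left_eq_self
      ((Metric.ball x s).indicator u), integral_indicator hm]
  have h2 : ∫ _ in Metric.ball x s, 2 * u x
      ≤ ∫ y in Metric.ball x s, (u y + u (2 • x - y)) := by
    refine setIntegral_mono_on (integrableOn_const measure_ball_lt_top.ne) (hi.add hr) hm
      fun y hy => ?_
    have h := hu.2 (hs hy) (hs ((hmem y).2 hy)) (show (0 : ℝ) ≤ 1 / 2 by norm_num)
      (show (0 : ℝ) ≤ 1 / 2 by norm_num) (by norm_num)
    have hmid : (1 / 2 : ℝ) • y + (1 / 2 : ℝ) • (2 • x - y) = x := by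
      rw [two_smul]; module
    rw [hmid] at h
    simp only [smul_eq_mul] at h
    linarith
  rw [integral_add hi hr, e, setIntegral_const, smul_eq_mul, Measure.real] at h2
  linarith

/-- With w the positive part of ρ² - |x - c|², the gradient of w³ is -6w²(x - c): a radial field
whose weight 6w² is the one used for averaging u. -/
theorem partialDeriv_ball_bump (c : 𝔼 n) (ρ : ℝ) (i : Fin n) (x : 𝔼 n) :
    partialDeriv i (fun y : 𝔼 n => max (ρ ^ 2 - ‖y - c‖ ^ 2) 0 ^ 3) x
      = -(6 * max (ρ ^ 2 - ‖x - c‖ ^ 2) 0 ^ 2) * (x i - c i) := by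
  have h1 : HasFDerivAt (fun y : 𝔼 n => ρ ^ 2 - ‖y - c‖ ^ 2)
      (-(2 • innerSL ℝ (x - c)) : (𝔼 n) →L[ℝ] ℝ) x := by
    have := (((hasFDerivAt_id x).sub_const c).norm_sq).const_sub (ρ ^ 2)
    simpa using this
  have h2 := (hasDerivAt_max_zero_pow 1 (ρ ^ 2 - ‖x - c‖ ^ 2)).comp_hasFDerivAt x h1
  have h3 : HasFDerivAt (fun y : 𝔼 n => max (ρ ^ 2 - ‖y - c‖ ^ 2) 0 ^ 3) _ x := h2
  rw [partialDeriv_of_hasFDerivAt h3]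
  simp [EuclideanSpace.inner_single_right]
  ring

theorem contDiff_ball_bump (c : 𝔼 n) (ρ : ℝ) :
    ContDiff ℝ 1 (fun y : 𝔼 n => max (ρ ^ 2 - ‖y - c‖ ^ 2) 0 ^ 3) :=
  (contDiff_max_zero_pow 1).comp (contDiff_const.sub ((contDiff_id.sub contDiff_const).norm_sq ℝ))

end Polytope

/-! ### Harnack estimate, local bounds and uniform stability. -/

namespace Polytope

variable {n : ℕ} {Δ : Polytope n} {v A u : (𝔼 n) → ℝ} {p : 𝔼 n}

/-- On a ball, a weighted mean of a convex function is controlled by the value at the centre and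
the integral of the Laplacian. -/
theorem ClassSmooth.integral_bump_mul_le (hu : Δ.ClassSmooth p u) {c : 𝔼 n} {ρ : ℝ}
    (hρ : Metric.closedBall c ρ ⊆ Δ.carrier) (hc : c ∈ Δ.carrier) (hρ0 : 0 < ρ) :
    ∫ x in Δ.carrier, 6 * max (ρ ^ 2 - ‖x - c‖ ^ 2) 0 ^ 2 * u x
      ≤ u c * (∫ x in Δ.carrier, 6 * max (ρ ^ 2 - ‖x - c‖ ^ 2) 0 ^ 2)
        + (ρ ^ 2) ^ 3 * ∫ x in Metric.closedBall c ρ, (hessian u x).trace := by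
  have hU := Δ.isOpen_carrier
  have hus := hu.contDiffOn
  set K := Metric.closedBall c ρ with hK
  have hKc : IsCompact K := isCompact_closedBall c ρ
  set w : (𝔼 n) → ℝ := fun x => max (ρ ^ 2 - ‖x - c‖ ^ 2) 0 with hw
  have hw0 : ∀ x, 0 ≤ w x := fun x => le_max_right _ _
  have hwc : Continuous w := by fun_prop
  have hwK : ∀ x, x ∉ K → w x = 0 := by
    intro x hx
    rw [hK, Metric.mem_closedBall, not_le, dist_eq_norm] at hx
    refine max_eq_right ?_
    nlinarith [norm_nonneg (x - c)]
  have hw1 : ∀ x, w x ≤ ρ ^ 2 := fun x =>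
    max_le (by nlinarith [sq_nonneg ‖x - c‖]) (by positivity)
  have hud : ∀ x ∈ Δ.carrier, DifferentiableAt ℝ u x := fun x hx =>
    ContDiffOn.differentiableAt_of_isOpen hU hus (by simp) hx
  have integ : ∀ {F : (𝔼 n) → ℝ}, ContinuousOn F Δ.carrier →
      (∀ y ∈ Δ.carrier, y ∉ K → F y = 0) → IntegrableOn F Δ.carrier := fun hF h0 =>
    integrableOn_of_continuousOn_of_eq_zero hKc hρ hF h0 hU
  have hdc : ∀ i, ContDiffOn ℝ ∞ (partialDeriv i u) Δ.carrier := fun i =>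
    contDiffOn_partialDeriv hU hus
  have hbump : ∀ i x, partialDeriv i (fun y => w y ^ 3) x = -(6 * w x ^ 2) * (x i - c i) :=
    fun i x => partialDeriv_ball_bump c ρ i x
  have hpart : ∀ i, ∫ x in Δ.carrier, partialDeriv i u x * (-(6 * w x ^ 2) * (x i - c i))
      = - ∫ x in Δ.carrier, partialDeriv i (partialDeriv i u) x * w x ^ 3 := by
    intro i
    simp only [← hbump]
    exact integral_mul_partialDeriv hU hKc hρ ((hdc i).of_le (by simp))
      (contDiff_ball_bump c ρ).contDiffOn (fun y _ hyK => by
        have := hwK y hyK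
        simp only [hw] at this
        rw [this]; norm_num) i
  have hcoord : ∀ i, ContinuousOn (fun x : 𝔼 n => -(6 * w x ^ 2) * (x i - c i)) Δ.carrier :=
    fun i => (((continuous_const.mul (hwc.pow 2)).neg).mul
      (contDiff_coord_sub c i (m := 0)).continuous).continuousOn
  have hI1 : ∀ i, IntegrableOn
      (fun x : 𝔼 n => partialDeriv i u x * (-(6 * w x ^ 2) * (x i - c i))) Δ.carrier := fun i =>
    integ ((hdc i).continuousOn.mul (hcoord i)) fun y _ hyK => by rw [hwK y hyK]; simp
  have hI2 : ∀ i, IntegrableOn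
      (fun x : 𝔼 n => partialDeriv i (partialDeriv i u) x * w x ^ 3) Δ.carrier := fun i =>
    integ ((contDiffOn_partialDeriv hU (hdc i)).continuousOn.mul (hwc.pow 3).continuousOn)
      fun y _ hyK => by rw [hwK y hyK]; simp
  have hI3 : IntegrableOn (fun x => 6 * w x ^ 2) Δ.carrier :=
    integ (continuous_const.mul (hwc.pow 2)).continuousOn fun y _ hyK => by rw [hwK y hyK]; simp
  have hI4 : IntegrableOn (fun x => 6 * w x ^ 2 * u x) Δ.carrier :=
    integ ((continuous_const.mul (hwc.pow 2)).continuousOn.mul hus.continuousOn)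
      fun y _ hyK => by rw [hwK y hyK]; simp
  -- The tangent plane at x evaluated at c gives u(x) ≤ u(c) + ∇u(x)·(x - c). Weighted by 6w², the
  -- last term is -∇u·∇(w³), and integrating by parts turns it into the Laplacian against w³.
  have hconv : ∫ x in Δ.carrier, 6 * w x ^ 2 * u x
      ≤ ∫ x in Δ.carrier, (u c * (6 * w x ^ 2)
        - ∑ i, partialDeriv i u x * (-(6 * w x ^ 2) * (x i - c i))) := by
    refine setIntegral_mono_on hI4 ((hI3.const_mul _).sub (integrable_finsetSum _ fun i _ => hI1 i))
      hU.measurableSet fun x hx => ?_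
    have h1 := ConvexOn.fderiv_le_sub hu.convexOn hx hc (hud x hx)
    rw [fderiv_eq_sum_partialDeriv] at h1
    have h2 : ∑ i, partialDeriv i u x * (-(6 * w x ^ 2) * (x i - c i))
        = 6 * w x ^ 2 * ∑ i, (c - x) i * partialDeriv i u x := by
      rw [Finset.mul_sum]
      exact Finset.sum_congr rfl fun i _ => by rw [PiLp.sub_apply]; ring
    rw [h2]
    have h3 : 0 ≤ 6 * w x ^ 2 := by positivity
    nlinarith
  have htr : ∫ x in Δ.carrier, ∑ i, partialDeriv i (partialDeriv i u) x * w x ^ 3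
      ≤ (ρ ^ 2) ^ 3 * ∫ x in K, (hessian u x).trace := by
    have e : ∀ x, ∑ i, partialDeriv i (partialDeriv i u) x * w x ^ 3
        = (hessian u x).trace * w x ^ 3 := fun x => by
      rw [← Finset.sum_mul]; rfl
    simp only [e]
    rw [← integral_const_mul, ← inter_eq_self_of_subset_right hρ,
      ← setIntegral_indicator hKc.measurableSet]
    have htc := continuousOn_trace_hessian hus
    refine setIntegral_mono_on (integ (htc.mul (hwc.pow 3).continuousOn)
      fun y _ hyK => by rw [hwK y hyK]; simp) ?_ hU.measurableSet fun x hx => ?_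
    · exact ((integrable_indicator_iff hKc.measurableSet).2
        ((continuousOn_const.mul (htc.mono hρ)).integrableOn_compact hKc)).integrableOn
    · by_cases hxK : x ∈ K
      · rw [indicator_of_mem hxK, mul_comm]
        have := (hu.posSemidef hx).trace_nonneg
        have := hw0 x
        gcongr
        exact hw1 x
      · rw [indicator_of_notMem hxK, hwK x hxK]; simp
  rw [integral_sub (hI3.const_mul _) (integrable_finsetSum _ fun i _ => hI1 i),
    integral_const_mul, integral_finsetSum _ fun i _ => hI1 i] at hconv
  simp only [hpart] at hconv
  rw [integral_finsetSum _ fun i _ => hI2 i] at htr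
  rw [Finset.sum_neg_distrib] at hconv
  linarith

/-- A Harnack type estimate on a ball. -/
theorem ClassS.exists_ball_le (hv : Δ.ClassS v) (hA : SolvesAbreu Δ A v)
    (hAc : ContinuousOn A (closure Δ.carrier)) (hE : Δ.AffineExtremal A) (hp : p ∈ Δ.carrier)
    {c : 𝔼 n} {ρ : ℝ} (hρ0 : 0 < ρ) (hρ : Metric.closedBall c ρ ⊆ Δ.carrier) :
    ∃ C : ℝ, 0 ≤ C ∧ ∀ u, Δ.ClassSmooth p u → ∀ x ∈ Metric.closedBall c (ρ / 2),
      u x ≤ C * (u c + Δ.functionalL A u) := by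
  have hU := Δ.isOpen_carrier
  have hc : c ∈ Δ.carrier := hρ (Metric.mem_closedBall_self hρ0.le)
  obtain ⟨C₁, hC₁, hL⟩ := hv.exists_integral_trace_le hA hAc hE hp (isCompact_closedBall c ρ) hρ
  set I := ∫ x in Δ.carrier, 6 * max (ρ ^ 2 - ‖x - c‖ ^ 2) 0 ^ 2 with hI
  have hI0 : 0 ≤ I := integral_nonneg fun x => by positivity
  set V := (volume (Metric.ball (0 : 𝔼 n) (ρ / 4))).toReal with hV
  have hV0 : 0 < V := ENNReal.toReal_pos (Metric.measure_ball_pos _ _ (by positivity)).ne'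
    measure_ball_lt_top.ne
  -- A ball of radius ρ/4 about a point of the half ball stays within 3ρ/4 of c, where the weight is
  -- at least b because 1 - 9/16 = 7/16.
  set b : ℝ := 6 * (7 / 16 * ρ ^ 2) ^ 2 with hb
  have hb0 : 0 < b := by positivity
  set D := max I ((ρ ^ 2) ^ 3 * C₁) with hD
  have hD0 : 0 ≤ D := hI0.trans (le_max_left _ _)
  refine ⟨D / (b * V), by positivity, fun u hu x hx => ?_⟩
  have hL0 := hv.functionalL_nonneg hA hAc hE hp hu
  have huc0 : 0 ≤ u c := hu.2.2.2 c (subset_closure hc)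
  have h1 := hu.integral_bump_mul_le hρ hc hρ0
  rw [← hI] at h1
  have h2 := hL u hu
  have h3 : ∫ x in Δ.carrier, 6 * max (ρ ^ 2 - ‖x - c‖ ^ 2) 0 ^ 2 * u x
      ≤ D * (u c + Δ.functionalL A u) := by
    calc _ ≤ u c * I + (ρ ^ 2) ^ 3 * (C₁ * Δ.functionalL A u) := h1.trans (by gcongr)
      _ = I * u c + (ρ ^ 2) ^ 3 * C₁ * Δ.functionalL A u := by ring
      _ ≤ D * u c + D * Δ.functionalL A u := by
        gcongr
        · exact le_max_left _ _
        · exact le_max_right _ _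
      _ = _ := by ring
  have hsub : ∀ y ∈ Metric.ball x (ρ / 4), ‖y - c‖ ≤ 3 / 4 * ρ := by
    intro y hy
    rw [Metric.mem_ball] at hy
    rw [Metric.mem_closedBall] at hx
    rw [← dist_eq_norm]
    linarith [dist_triangle y x c]
  have hballU : Metric.ball x (ρ / 4) ⊆ Δ.carrier := fun y hy => hρ (by
    rw [Metric.mem_closedBall, dist_eq_norm]
    linarith [hsub y hy])
  have hint : IntegrableOn u Δ.carrier := integrableOn_carrier_of_continuousOn hu.1.continuousOn
  have h4 := ConvexOn.mul_le_setIntegral_ball hu.convexOn hballU (hint.mono_set hballU)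
  have hVx : (volume (Metric.ball x (ρ / 4))).toReal = V := by
    rw [Measure.addHaar_ball_center]
  rw [hVx] at h4
  have hbc : Continuous fun x : 𝔼 n => 6 * max (ρ ^ 2 - ‖x - c‖ ^ 2) 0 ^ 2 := by fun_prop
  have hbint : IntegrableOn (fun x => 6 * max (ρ ^ 2 - ‖x - c‖ ^ 2) 0 ^ 2 * u x) Δ.carrier :=
    integrableOn_carrier_of_continuousOn (hbc.continuousOn.mul hu.1.continuousOn)
  have h5 : b * ∫ y in Metric.ball x (ρ / 4), u y
      ≤ ∫ x in Δ.carrier, 6 * max (ρ ^ 2 - ‖x - c‖ ^ 2) 0 ^ 2 * u x := by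
    rw [← integral_const_mul]
    refine (setIntegral_mono_on ((hint.mono_set hballU).const_mul b) (hbint.mono_set hballU)
      measurableSet_ball fun y hy => ?_).trans (setIntegral_mono_set hbint ?_
        hballU.eventuallyLE)
    · have h6 := hsub y hy
      have h7 : 7 / 16 * ρ ^ 2 ≤ max (ρ ^ 2 - ‖y - c‖ ^ 2) 0 :=
        le_max_of_le_left (by nlinarith [norm_nonneg (y - c)])
      have := hu.2.2.2 y (subset_closure (hballU hy))
      rw [hb]
      gcongr
    · exact (ae_restrict_iff' hU.measurableSet).2 (Eventually.of_forall fun y hy =>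
        mul_nonneg (by positivity) (hu.2.2.2 y (subset_closure hy)))
  have h8 : b * V * u x ≤ D * (u c + Δ.functionalL A u) := by
    calc _ = b * (V * u x) := by ring
      _ ≤ _ := (mul_le_mul_of_nonneg_left h4 hb0.le).trans (h5.trans h3)
  rw [div_mul_eq_mul_div, le_div_iff₀ (by positivity), mul_comm]
  exact h8

/-- `ℒ_A` controls normalized convex functions locally uniformly. -/
theorem ClassS.exists_le_of_isCompact (hv : Δ.ClassS v) (hA : SolvesAbreu Δ A v)
    (hAc : ContinuousOn A (closure Δ.carrier)) (hE : Δ.AffineExtremal A) (hp : p ∈ Δ.carrier)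
    {K : Set (𝔼 n)} (hK : IsCompact K) (hKΔ : K ⊆ Δ.carrier) :
    ∃ C : ℝ, 0 ≤ C ∧ ∀ u, Δ.ClassSmooth p u → ∀ x ∈ K, u x ≤ C * Δ.functionalL A u := by
  have hU := Δ.isOpen_carrier
  set Bd : Set (𝔼 n) → Prop := fun T => ∃ C : ℝ, 0 ≤ C ∧ ∀ u, Δ.ClassSmooth p u →
    ∀ x ∈ T, u x ≤ C * Δ.functionalL A u with hBd
  have hmono : ∀ {s t : Set (𝔼 n)}, s ⊆ t → Bd t → Bd s := fun hst ⟨C, hC, h⟩ =>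
    ⟨C, hC, fun u hu x hx => h u hu x (hst hx)⟩
  -- A bound at any single nearby point spreads to a ball of fixed radius about c. Taking that point
  -- to be c gives openness of the good set, taking it close to c gives relative closedness.
  have hstep : ∀ c ∈ Δ.carrier, ∃ s > 0, ∀ c' ∈ Metric.ball c s, Bd {c'} →
      Bd (Metric.ball c s) := by
    intro c hc
    obtain ⟨ρ, hρ0, hρ⟩ := Metric.isOpen_iff.1 hU c hc
    refine ⟨ρ / 8, by positivity, fun c' hc' ⟨C', hC', h'⟩ => ?_⟩
    rw [Metric.mem_ball] at hc'
    have hsub : Metric.closedBall c' (ρ / 2) ⊆ Δ.carrier := fun y hy => hρ (by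
      rw [Metric.mem_closedBall] at hy
      rw [Metric.mem_ball]
      linarith [dist_triangle y c' c])
    obtain ⟨C, hC, h⟩ := hv.exists_ball_le hA hAc hE hp (half_pos hρ0) hsub
    refine ⟨C * (C' + 1), by positivity, fun u hu x hx => ?_⟩
    rw [Metric.mem_ball] at hx
    refine (h u hu x ?_).trans ?_
    · rw [Metric.mem_closedBall]
      linarith [dist_triangle_right x c' c]
    · have := h' u hu c' rfl
      calc C * (u c' + Δ.functionalL A u)
          ≤ C * (C' * Δ.functionalL A u + Δ.functionalL A u) := by gcongr
        _ = _ := by ring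
  set S : Set (𝔼 n) := {c | c ∈ Δ.carrier ∧ Bd {c}} with hS
  have hSo : IsOpen S := by
    rw [isOpen_iff_mem_nhds]
    rintro c ⟨hc, hBc⟩
    obtain ⟨s, hs, h⟩ := hstep c hc
    filter_upwards [Metric.ball_mem_nhds c hs, hU.mem_nhds hc] with y hy hyU
    exact ⟨hyU, hmono (singleton_subset_iff.2 hy) (h c (Metric.mem_ball_self hs) hBc)⟩
  have hpS : p ∈ S := ⟨hp, 0, le_rfl, fun u hu x hx => by
    rw [mem_singleton_iff.1 hx, hu.2.2.1, zero_mul]⟩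
  -- Connectedness: the bound holds trivially at p, where every normalized function vanishes.
  have hall : Δ.carrier ⊆ S := by
    refine Δ.convex_carrier.isPreconnected.subset_of_closure_inter_subset hSo ⟨p, hp, hpS⟩ ?_
    rintro c ⟨hcS, hc⟩
    obtain ⟨s, hs, h⟩ := hstep c hc
    obtain ⟨c', hc', hd⟩ := Metric.mem_closure_iff.1 hcS s hs
    refine ⟨hc, hmono (singleton_subset_iff.2 (Metric.mem_ball_self hs)) (h c' ?_ hc'.2)⟩
    rwa [Metric.mem_ball, dist_comm]
  refine hK.induction_on (p := Bd) ⟨0, le_rfl, fun u _ x hx => absurd hx (notMem_empty x)⟩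
    (fun s t hst ht => hmono hst ht) ?_ fun c hc => ?_
  · rintro s t ⟨C₁, hC₁, h₁⟩ ⟨C₂, hC₂, h₂⟩
    refine ⟨C₁ + C₂, by positivity, fun u hu x hx => ?_⟩
    have hL0 := hv.functionalL_nonneg hA hAc hE hp hu
    rcases hx with hx | hx
    · refine (h₁ u hu x hx).trans ?_
      gcongr; linarith
    · refine (h₂ u hu x hx).trans ?_
      gcongr; linarith
  · obtain ⟨s, hs, h⟩ := hstep c (hKΔ hc)
    exact ⟨Metric.ball c s, mem_nhdsWithin_of_mem_nhds (Metric.ball_mem_nhds c hs),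
      h c (Metric.mem_ball_self hs) (hall (hKΔ hc)).2⟩

/-- The stability estimate for functions smooth up to the boundary. -/
theorem ClassS.exists_stable_classSmooth (hv : Δ.ClassS v) (hA : SolvesAbreu Δ A v)
    (hAc : ContinuousOn A (closure Δ.carrier)) (hE : Δ.AffineExtremal A) (hp : p ∈ Δ.carrier) :
    ∃ lam : ℝ, 0 < lam ∧ ∀ u, Δ.ClassSmooth p u → lam * Δ.normB u ≤ Δ.functionalL A u := by
  have hU := Δ.isOpen_carrier
  obtain ⟨M, hM0, hM⟩ := Δ.exists_bound_of_continuousOn hAc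
  set D := ∑ k, Δ.delta k p with hD
  have hD0 : 0 ≤ D := Finset.sum_nonneg fun k _ => (hp k).le
  -- The collar is thin enough that its share of ∫ A u is at most half the boundary norm.
  set η : ℝ := 1 / (2 * (M * D + 1)) with hη
  have hη0 : 0 < η := by positivity
  have hη1 : η < 1 := by
    rw [hη, div_lt_one (by positivity)]; nlinarith [mul_nonneg hM0 hD0]
  have hMη : M * (D * η) ≤ 1 / 2 := by
    rw [hη, ← mul_assoc, mul_one_div, div_le_iff₀ (by positivity)]; nlinarith
  obtain ⟨e, he0, he⟩ := exists_le_finite (fun k => η * Δ.delta k p) fun k => mul_pos hη0 (hp k)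
  obtain ⟨C, hC0, hC⟩ := hv.exists_le_of_isCompact hA hAc hE hp (Δ.isCompact_core he0)
    (Δ.core_subset he0)
  set V := (volume Δ.carrier).toReal with hV
  have hV0 : 0 ≤ V := ENNReal.toReal_nonneg
  -- Writing b for the boundary norm, the estimates give ℒ_A(u) ≥ b - b/2 - M C V ℒ_A(u); solving
  -- for ℒ_A(u) yields this constant.
  refine ⟨1 / (2 * (M * (C * V) + 1)), by positivity, fun u hu => ?_⟩
  have hL0 := hv.functionalL_nonneg hA hAc hE hp hu
  have huc := hu.1.continuousOn
  have hu0 : ∀ x ∈ closure Δ.carrier, 0 ≤ u x := hu.2.2.2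
  have hint : IntegrableOn u Δ.carrier := integrableOn_carrier_of_continuousOn huc
  set T := {x | x ∈ Δ.carrier ∧ ∃ k, Δ.delta k x ≤ η * Δ.delta k p} with hT
  have hTm : MeasurableSet T := by
    have : T = Δ.carrier ∩ ⋃ k, {x | Δ.delta k x ≤ η * Δ.delta k p} := by
      ext x; simp [hT]
    rw [this]
    exact hU.measurableSet.inter (MeasurableSet.iUnion fun k =>
      (isClosed_le (Δ.continuous_delta k) continuous_const).measurableSet)
  have hTU : T ⊆ Δ.carrier := fun x hx => hx.1
  have hb0 : 0 ≤ᵐ[Δ.boundaryMeasure] u := Δ.ae_mem_closure_boundaryMeasure.mono hu0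
  have hb : 0 ≤ Δ.normB u := integral_nonneg_of_ae hb0
  have hcollar : ∫ x in T, u x ≤ D * η * Δ.normB u := by
    have h := Δ.lintegral_collar_le hp huc hu.2.1 hu.2.2 hη1
    rw [integral_eq_lintegral_of_nonneg_ae ((ae_restrict_iff' hTm).2 (Eventually.of_forall
      fun x hx => hu0 x (subset_closure (hTU hx)))) (hint.mono_set hTU).aestronglyMeasurable]
    refine ENNReal.toReal_le_of_le_ofReal (by positivity) (h.trans (le_of_eq ?_))
    rw [mul_assoc, ENNReal.ofReal_mul hD0, ENNReal.ofReal_mul hη0.le, normB,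
      ofReal_integral_eq_lintegral_ofReal (integrable_boundaryMeasure huc) hb0]
  have hcore : ∫ x in Δ.carrier \ T, u x ≤ C * Δ.functionalL A u * V := by
    calc ∫ x in Δ.carrier \ T, u x
        ≤ ∫ _ in Δ.carrier \ T, C * Δ.functionalL A u := by
          refine setIntegral_mono_on (hint.mono_set sdiff_subset) (integrableOn_const
            (measure_mono sdiff_subset |>.trans_lt Δ.volume_carrier_lt_top).ne)
            (hU.measurableSet.diff hTm) fun x hx => hC u hu x fun k => ?_
          have : ¬ Δ.delta k x ≤ η * Δ.delta k p := fun hk => hx.2 ⟨hx.1, k, hk⟩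
          exact (he k).trans (not_le.1 this).le
      _ ≤ ∫ _ in Δ.carrier, C * Δ.functionalL A u :=
          setIntegral_mono_set (integrableOn_const Δ.volume_carrier_lt_top.ne)
            (Eventually.of_forall fun _ => by positivity) sdiff_subset.eventuallyLE
      _ = _ := by rw [setIntegral_const, smul_eq_mul, Measure.real, mul_comm]
  have hsplit : ∫ x in Δ.carrier, u x = (∫ x in T, u x) + ∫ x in Δ.carrier \ T, u x := by
    conv_lhs => rw [← union_sdiff_cancel hTU]
    exact setIntegral_union disjoint_sdiff_right (hU.measurableSet.diff hTm)
      (hint.mono_set hTU) (hint.mono_set sdiff_subset)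
  have hAu : ∫ x in Δ.carrier, A x * u x ≤ M * ∫ x in Δ.carrier, u x := by
    rw [← integral_const_mul]
    refine setIntegral_mono_on (integrableOn_carrier_of_continuousOn (hAc.mul huc))
      (hint.const_mul M) hU.measurableSet fun x hx => ?_
    have := hu0 x (subset_closure hx)
    gcongr
    exact (le_abs_self _).trans (hM x (subset_closure hx))
  have hLdef : Δ.functionalL A u = Δ.normB u - ∫ x in Δ.carrier, A x * u x := rfl
  have h1 : M * ∫ x in Δ.carrier, u x
      ≤ M * (D * η * Δ.normB u + C * Δ.functionalL A u * V) := by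
    rw [hsplit]; gcongr
  have h2 : M * (D * η) * Δ.normB u ≤ 1 / 2 * Δ.normB u := by gcongr
  rw [div_mul_eq_mul_div, one_mul, div_le_iff₀ (by positivity)]
  nlinarith

/-- Dilating a normalized convex function makes it smooth up to the boundary. -/
theorem ClassCTilde.classSmooth_dilate (hp : p ∈ Δ.carrier) (hu : Δ.ClassCTilde p u) {s : ℝ}
    (h0 : 0 < s) (h1 : s < 1) : Δ.ClassSmooth p fun x => u (p + s • (x - p)) := by
  have hmaps : ∀ x ∈ closure Δ.carrier, p + s • (x - p) ∈ Δ.carrier := fun x hx =>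
    Δ.line_mem_carrier hp (Δ.mem_closure_carrier.1 hx) h0.le h1
  refine ⟨hu.1.2.2.comp (ContDiff.contDiffOn (by fun_prop)) hmaps,
    ⟨hu.1.2.1.1, fun x hx y hy a b ha hb hab => ?_⟩, ?_, fun x hx =>
      hu.2.2 _ (subset_closure (hmaps x hx))⟩
  · have e : p + s • (a • x + b • y - p)
        = a • (p + s • (x - p)) + b • (p + s • (y - p)) := by
      have : p = a • p + b • p := by rw [← add_smul, hab, one_smul]
      nth_rewrite 1 2 [this]
      module
    beta_reduce
    rw [e]
    exact hu.1.2.1.2 (subset_closure (hmaps x hx)) (subset_closure (hmaps y hy)) ha hb hab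
  · simpa using hu.2.1

/-- Dominated convergence with a constant bound. Stating it for a general finite measure on the
closed polytope covers both the boundary integral and the interior integral with weight A. -/
theorem tendsto_integral_dilate (hp : p ∈ Δ.carrier) (hu : ContinuousOn u (closure Δ.carrier))
    {w : (𝔼 n) → ℝ} (hw : ContinuousOn w (closure Δ.carrier)) (μ : Measure (𝔼 n))
    [IsFiniteMeasure μ] (hμ : ∀ᵐ x ∂μ, x ∈ closure Δ.carrier) :
    Tendsto (fun s : ℝ => ∫ x, w x * u (p + s • (x - p)) ∂μ) (𝓝[<] 1)
      (𝓝 (∫ x, w x * u x ∂μ)) := by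
  obtain ⟨M, hM0, hM⟩ := Δ.exists_bound_of_continuousOn hu
  obtain ⟨M', hM'0, hM'⟩ := Δ.exists_bound_of_continuousOn hw
  have hr : μ.restrict (closure Δ.carrier) = μ := Measure.restrict_eq_self_of_ae_mem hμ
  have hmaps : ∀ s ∈ Ioo (0 : ℝ) 1, ∀ x ∈ closure Δ.carrier,
      p + s • (x - p) ∈ closure Δ.carrier := fun s hs x hx => subset_closure
    (Δ.line_mem_carrier hp (Δ.mem_closure_carrier.1 hx) hs.1.le hs.2)
  have hev : ∀ᶠ s : ℝ in 𝓝[<] 1, s ∈ Ioo (0 : ℝ) 1 :=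
    Ioo_mem_nhdsLT zero_lt_one
  refine tendsto_integral_filter_of_dominated_convergence (fun _ => M' * M) ?_ ?_
    (integrable_const _) ?_
  · filter_upwards [hev] with s hs
    have hc : ContinuousOn (fun x => w x * u (p + s • (x - p))) (closure Δ.carrier) :=
      hw.mul (hu.comp (Continuous.continuousOn (by fun_prop)) (hmaps s hs))
    have := hc.aestronglyMeasurable (μ := μ) isClosed_closure.measurableSet
    rwa [hr] at this
  · filter_upwards [hev] with s hs
    filter_upwards [hμ] with x hx
    rw [norm_mul, Real.norm_eq_abs, Real.norm_eq_abs]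
    gcongr
    · exact hM' x hx
    · exact hM _ (hmaps s hs x hx)
  · filter_upwards [hμ] with x hx
    refine Tendsto.const_mul _ ?_
    refine (hu x hx).tendsto.comp (tendsto_nhdsWithin_iff.2 ⟨?_, hev.mono fun s hs => hmaps s hs x hx⟩)
    have : Tendsto (fun s : ℝ => p + s • (x - p)) (𝓝 1) (𝓝 (p + (1 : ℝ) • (x - p))) :=
      Continuous.tendsto (by fun_prop) 1
    rw [one_smul, add_sub_cancel] at this
    exact this.mono_left nhdsWithin_le_nhds

theorem tendsto_functionalL_dilate (hp : p ∈ Δ.carrier) (hu : ContinuousOn u (closure Δ.carrier))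
    (hA : ContinuousOn A (closure Δ.carrier)) :
    Tendsto (fun s : ℝ => Δ.normB fun x => u (p + s • (x - p))) (𝓝[<] 1) (𝓝 (Δ.normB u)) ∧
    Tendsto (fun s : ℝ => Δ.functionalL A fun x => u (p + s • (x - p))) (𝓝[<] 1)
      (𝓝 (Δ.functionalL A u)) := by
  have h1 := tendsto_integral_dilate hp hu (w := fun _ => 1) continuousOn_const
    Δ.boundaryMeasure Δ.ae_mem_closure_boundaryMeasure
  simp only [one_mul] at h1
  have : IsFiniteMeasure (volume.restrict Δ.carrier) :=
    ⟨by rw [Measure.restrict_apply_univ]; exact Δ.volume_carrier_lt_top⟩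
  have h2 := tendsto_integral_dilate hp hu hA (volume.restrict Δ.carrier)
    ((ae_restrict_mem Δ.isOpen_carrier.measurableSet).mono fun x hx => subset_closure hx)
  exact ⟨h1, h1.sub h2⟩

/-- Solvability of the Abreu equation implies uniform K-stability. -/
theorem ClassS.uniformlyKStable (hv : Δ.ClassS v) (hA : SolvesAbreu Δ A v)
    (hAc : ContinuousOn A (closure Δ.carrier)) (hE : Δ.AffineExtremal A) (hp : p ∈ Δ.carrier) :
    Δ.UniformlyKStable p A := by
  obtain ⟨lam, hlam, h⟩ := hv.exists_stable_classSmooth hA hAc hE hp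
  refine ⟨lam, hlam, fun u hu => ?_⟩
  obtain ⟨h1, h2⟩ := tendsto_functionalL_dilate hp hu.1.1 hAc
  refine le_of_tendsto_of_tendsto (h1.const_mul lam) h2 ?_
  filter_upwards [Ioo_mem_nhdsLT (zero_lt_one (α := ℝ))] with s hs
  exact h _ (hu.classSmooth_dilate hp hs.1 hs.2)

end Polytope

end Toric

theorem mainTheorem5 {n : ℕ} (Δ : Toric.Polytope n) :
    ∃ C : ℝ → ℝ,
      ∀ p ∈ Δ.carrier,
      ∀ A : EuclideanSpace ℝ (Fin n) → ℝ,
        ContDiffOn ℝ ∞ A (closure Δ.carrier) →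
        Δ.AffineExtremal A →
      ∀ v : EuclideanSpace ℝ (Fin n) → ℝ,
        Δ.ClassS v →
        Toric.SolvesAbreu Δ A v →
          Δ.UniformlyKStable p A ∧
          ∀ lam : ℝ, Δ.IsStable p A lam → Δ.Normalized p v → Δ.normB v ≤ C lam := by
  -- The normalized solution is itself an admissible test function, so λ times its boundary norm is
  -- at most ℒ_A(v) ≤ n vol(Δ). This bound involves neither A nor p, so the constant depends only on
  -- Δ and λ.
  refine ⟨fun lam => n * (volume Δ.carrier).toReal / lam, fun p hp A hA hE v hv hS =>
    ⟨hv.uniformlyKStable hS hA.continuousOn hE hp, fun lam hlam hn => ?_⟩⟩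
  rw [le_div_iff₀ hlam.1, mul_comm]
  exact (hlam.2 v ⟨⟨hv.1, hv.2.1, hv.contDiffOn⟩, hn⟩).trans
    (hv.functionalL_le hS hA.continuousOn hE hp)
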